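/- **Setting.** Let $\mathcal K$ be a finite root 2-complex with boundary and at least one internal face: bulk vertices $v$, edges (each joining two bulk vertices, or a bulk vertex and a boundary node), internal faces $h$ bounded by closed oriented edge walks, and boundary faces $b$ bounded by oriented walks from one boundary node to another; no two faces have the same boundary cycle. $E_{\rm int}$ is the set of edges on the boundary of internal faces. For a vertex $v$, the graph $\Gamma_v$ has the edge ends at $v$ as nodes, two being linked if they are consecutive along the boundary of a face; $\Gamma_{v,-}$ is the analogous graph on the ends of edges in $E_{\rm int}$, with links from internal faces only. Variables $g_{ve}\in \mathrm{SL}(2,\mathbb C)$ are attached to the pairs $(v,e)$; at each $v$ one edge $e_0(v)$ is chosen, with $e_0(v)\in E_{\rm int}$ if $v$ lies on an internal face, and $g_{v,e_0(v)}=1$. $\mathscr G_{\rm int}$ is the space of the $\{g_{ve}\}_{e\in E_{\rm int}}$ with this gauge fixing. At a corner $(v;e,e')$ of a face put $U_{vh}=g_{ve}^{-1}g_{ve'}$. Let $\gamma\in\mathbb R$, $d_k=k+1$, and let $P_k$ be the orthogonal projection of the $\mathrm{SL}(2,\mathbb C)$ principal series $(k,\rho)$, $\rho=\gamma(k+2)$,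 onto its lowest $\mathrm{SU}(2)$ irrep (spin $k/2$). Put $$\tau^{(h)}_k=d_k\mathrm{Tr}\Big[\prod_{v\in\partial h}P_kg_{ve}^{-1}g_{ve'}P_k\Big],\qquad \tau^{(b)}_k(H)=d_k\mathrm{Tr}\Big[\Big(\prod_{v\in\partial b}P_kg_{ve}^{-1}g_{ve'}P_k\Big)H\Big],\quad H\in \mathrm{SU}(2).$$ Let $(E_k)_{k\ge1}$ be a nondecreasing sequence of positive integers growing like $k^N$ for some integer $N\ge1$. Let $\lambda_h\in\mathbb C\setminus\{0\}$, and suppose that $\beta_k(\lambda_h)=E_k^{-1}\ln(|\lambda_h|d_k^2)$, $k\ge1$, attains its maximum at a unique $k_0=k_0(h)$; put $\beta^*_h=\sup_{k\ne k_0}\beta_k(\lambda_h)$. Define $$\mathscr U_{\rm int}=\{g\in\mathscr G_{\rm int}: \tau_{k_0}^{(h)}\neq0,\ E_{k_0}^{-1}\ln|\lambda_h\tau^{(h)}_{k_0}|>\beta_h^*\ \ \forall h\}.$$ For signs $\mathcal S=\{\varsigma_h\}$, $\varsigma_h=\pm1$, let $\mathcal C_{\rm int}^{\mathcal S}\subset\mathscr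 G_{\rm int}$ be the set where, for every $h$, all $U_{vh}\in\mathrm{SU}(2)$ and their ordered product around $\partial h$ is $\varsigma_h\mathbb I$; let $\mathcal C_{\rm int}=\bigcup_{\mathcal S}\mathcal C^{\mathcal S}_{\rm int}$. **Compactness.** Suppose that $\Gamma_{v,-}$ is connected for every $v$ (or empty, if $v$ lies on no internal face). Let $x^{(n)}$ be a sequence in $\mathscr G_{\rm int}$ that eventually leaves every compact set. Then $\max_{v,h}\|U_{vh}(x^{(n)})\|\to\infty$, where $\|U\|=\sqrt{\mathrm{Tr}(UU^\dagger)}$, and $\min_h|\tau^{(h)}_k(x^{(n)})|\to0$ for every $k\ge1$. Moreover there are a face $h$, a corner of $h$ and a subsequence along which $\|U_{vh}\|\to\infty$ and $\tau_k^{(h)}\to0$ for all $k\ge1$. The closure of $\mathscr U_{\rm int}$, each $\mathcal C^{\mathcal S}_{\rm int}$, and $\mathcal C_{\rm int}$ are compact. **Localization.** Suppose in addition that every $\Gamma_v$ is 3-connected. For a cut-off $A_f$ and coupling $\lambda_f$ of a face $f$ let $$\omega_f=\sum_{p\ge1}\lambda_f^p\sum_{1\le k_1\le\dots\le k_p}\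 \prod_{i=1}^p\tau_{k_i}^{(f)}\ \Theta\Big(A_f-\sum_{i=1}^pE_{k_i}\Big),$$ with $\Theta(x)=1,\tfrac12,0$ for $x>0$, $x=0$, $x<0$, and with $\tau^{(b)}_{k_i}=\tau^{(b)}_{k_i}(H_b^{(i)})$ for boundary faces, $H^{(i)}_b\in\mathrm{SU}(2)$. Let $$\mathscr A_{\mathcal K}=\int d\Omega(g)\prod_h\omega_h\prod_b\omega_b ,$$ where $d\Omega$ is the product of Haar measures over all $g_{ve}$ that are not gauge fixed, and for $W\subset\mathscr G_{\rm int}$ let $\mathscr A_{\mathcal K}|_W$ be the integral restricted to $\{g_{ve}\}_{e\in E_{\rm int}}\in W$ (with the other variables unrestricted). Let $A_h=A a_h$ with fixed $a_h>0$, keep the data $(A_b,\lambda_b,H_b)$ of the boundary faces fixed, and put $\kappa=\sum_h\beta_{k_0(h)}(\lambda_h)a_h$. Then: 1. The integral converges absolutely for every $A$. 2. For every measurable (in particular every compact) $W\subset\mathscr G_{\rm int}$ disjoint from $\mathscr U_{\rm int}$ there are $B>0$ and $\beta'<\kappa$ with $\big|\mathscr A_{\mathcal K}|_W\big|\le Be^{\beta'A}$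 for all $A>0$. 3. For every compact neighbourhood $\mathcal U$ of $\mathcal C_{\rm int}$ contained in $\mathscr U_{\rm int}$ there are $B>0$ and $\beta'<\kappa$ with $\big|\mathscr A_{\mathcal K}-\mathscr A_{\mathcal K}|_{\mathcal U}\big|\le Be^{\beta'A}$ for all $A>0$. 4. Consequently, along any set $T$ of values $A\to\infty$ on which $\mathscr A_{\mathcal K}|_{\mathcal U}$ has its exponential order $e^{\kappa A}$ (for each $\delta>0$, $\big|\mathscr A_{\mathcal K}|_{\mathcal U}\big|\ge e^{(\kappa-\delta)A}$ for all large $A\in T$), $\mathscr A_{\mathcal K}|_W$ is exponentially small relative to $\mathscr A_{\mathcal K}|_{\mathcal U}$ for every $W$ as in 2, and $\mathscr A_{\mathcal K}=\mathscr A_{\mathcal K}|_{\mathcal U}\,[1+O(A^{-\infty})]$, where $O(A^{-\infty})$ denotes a term bounded by $Be^{-cA}$ with some $B$ and $c>0$. -/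

import Mathlib

open MeasureTheory Filter Topology Asymptotics

noncomputable section

namespace SpinfoamStack

/-! ### The group `SL(2, ℂ)` and its unitary principal series -/

/-- The group `SL(2, ℂ)`. -/
abbrev SL2C : Type := Matrix.SpecialLinearGroup (Fin 2) ℂ

/-- The group `SU(2)`. -/
abbrev SU2 : Type := Matrix.specialUnitaryGroup (Fin 2) ℂ

instance : MeasurableSpace SL2C := borel SL2C

instance : BorelSpace SL2C := ⟨rfl⟩

/-- The inclusion of `SU(2)` in `SL(2, ℂ)`. -/
def ofSU2 (u : SU2) : SL2C :=
  ⟨(u : Matrix (Fin 2) (Fin 2) ℂ), (Matrix.mem_specialUnitaryGroup_iff.1 u.2).2⟩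

/-- The Hilbert-Schmidt norm `‖M‖ = √Tr(M M†)` of a `2 × 2` matrix. -/
def hsNorm (M : Matrix (Fin 2) (Fin 2) ℂ) : ℝ :=
  Real.sqrt (Matrix.trace (M * M.conjTranspose)).re

/-- Two-component spinors, that is `ℂ²` with its Hermitian norm. -/
abbrev Spinor : Type := EuclideanSpace ℂ (Fin 2)

/-- The right action of `SL(2, ℂ)` on row vectors, `z ↦ z g`. -/
def rowMul (z : Spinor) (g : SL2C) : Spinor :=
  WithLp.toLp 2 (Matrix.vecMul z.ofLp (g : Matrix (Fin 2) (Fin 2) ℂ))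

/-- The scaling factor of the `(k, ρ)` principal series,
`α ^ (-k/2 + iρ/2 - 1) * (conj α) ^ (k/2 + iρ/2 - 1)`, which is the same as
`(conj α) ^ k * |α| ^ (iρ - 2 - k)`. -/
def psFactor (k : ℕ) (ρ : ℝ) (α : ℂ) : ℂ :=
  (starRingEnd ℂ α) ^ k * (‖α‖ : ℂ) ^ (Complex.I * (ρ : ℂ) - 2 - (k : ℂ))

theorem rowMul_mul (z : Spinor) (g h : SL2C) : rowMul (rowMul z g) h = rowMul z (g * h) := by
  simp [rowMul, Matrix.vecMul_vecMul]

theorem rowMul_one (z : Spinor) : rowMul z 1 = z := by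
  simp [rowMul]

theorem rowMul_zero (g : SL2C) : rowMul 0 g = 0 := by
  simp [rowMul]

theorem rowMul_smul (α : ℂ) (z : Spinor) (g : SL2C) : rowMul (α • z) g = α • rowMul z g := by
  simp [rowMul, Matrix.smul_vecMul]

theorem rowMul_ne_zero {z : Spinor} (hz : z ≠ 0) (g : SL2C) : rowMul z g ≠ 0 := by
  intro h
  apply hz
  have h2 := rowMul_mul z g g⁻¹
  rw [h, rowMul_zero, mul_inv_cancel, rowMul_one] at h2
  exact h2.symm

theorem continuous_rowMul (g : SL2C) : Continuous (fun z : Spinor => rowMul z g) := by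
  unfold rowMul
  refine (PiLp.continuous_toLp 2 _).comp ?_
  exact Continuous.matrix_vecMul (PiLp.continuous_ofLp 2 _) continuous_const

/-- The carrier of the `(k, ρ)` principal series in the homogeneous realisation: functions on
`ℂ² ∖ {0}` (extended by `0` to the origin), continuous there, with
`F (α z) = α ^ (-k/2 + iρ/2 - 1) * (conj α) ^ (k/2 + iρ/2 - 1) * F z`. Restricting such a function
to the bottom row `z` of `u ∈ SU(2)` gives the continuous functions on `SU(2)` with
`F (e^{iφσ₃} u) = e^{ikφ} F u`; the Hilbert space of the representation is the completion of this
space for `psInner` below. It contains all `SU(2)`-finite vectors. -/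
def PrincipalSeries (k : ℕ) (ρ : ℝ) : Submodule ℂ (Spinor → ℂ) where
  carrier := {F | ContinuousOn F {0}ᶜ ∧ F 0 = 0 ∧
    ∀ α : ℂ, α ≠ 0 → ∀ z : Spinor, F (α • z) = psFactor k ρ α * F z}
  add_mem' := by
    rintro F G ⟨hF, hF0, hFh⟩ ⟨hG, hG0, hGh⟩
    refine ⟨hF.add hG, by simp [hF0, hG0], fun α hα z => ?_⟩
    simp only [Pi.add_apply, hFh α hα z, hGh α hα z, mul_add]
  zero_mem' := ⟨continuousOn_const, rfl, fun α _ z => by simp⟩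
  smul_mem' := by
    rintro c F ⟨hF, hF0, hFh⟩
    refine ⟨hF.const_smul c, by simp [hF0], fun α hα z => ?_⟩
    simp only [Pi.smul_apply, smul_eq_mul, hFh α hα z]
    ring

/-- The principal series representation, `(g · F) z = F (z g)`. On functions on `SU(2)` this is
`(g · F) u = λ ^ (-k/2 + iρ/2 - 1) * (conj λ) ^ (k/2 + iρ/2 - 1) * F u'`, where `u g = b u'` is the
Iwasawa decomposition and `λ` is the lower right entry of the upper triangular matrix `b`. -/
def principalSeriesRep (k : ℕ) (ρ : ℝ) : Representation ℂ SL2C (PrincipalSeries k ρ) where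
  toFun g :=
    { toFun := fun F => ⟨fun z => F.1 (rowMul z g), by
        obtain ⟨F, hF, hF0, hFh⟩ := F
        refine ⟨hF.comp (continuous_rowMul g).continuousOn
          (fun z hz => rowMul_ne_zero hz g), ?_, fun α hα z => ?_⟩
        · simp only [rowMul_zero, hF0]
        · simp only [rowMul_smul, hFh α hα]⟩
      map_add' := fun _ _ => rfl
      map_smul' := fun _ _ => rfl }
  map_one' := by
    ext F z
    simp [rowMul_one]
  map_mul' g h := by
    ext F z
    simp [rowMul_mul]

/-- The invariant inner product (antilinear in the first entry): the integral over the unit sphere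
`S³ ≅ SU(2)` of `ℂ²` for the normalised rotation invariant measure (the Haar measure of `SU(2)`). -/
def psInner {k : ℕ} {ρ : ℝ} (F G : PrincipalSeries k ρ) : ℂ :=
  ⨍ z : Metric.sphere (0 : Spinor) 1, (starRingEnd ℂ) (F.1 z) * G.1 z
    ∂(volume : Measure Spinor).toSphere

/-- The function `√((k+1) (k choose m)) (conj z₀)^(k-m) (conj z₁)^m ‖z‖^(iρ - 2 - k)`. -/
def lowestFun (k : ℕ) (ρ : ℝ) (m : ℕ) (z : Spinor) : ℂ :=
  if z = 0 then 0 else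
    (Real.sqrt (((k : ℝ) + 1) * (k.choose m : ℝ)) : ℂ) *
      ((starRingEnd ℂ) (z 0) ^ (k - m) * (starRingEnd ℂ) (z 1) ^ m) *
      (‖z‖ : ℂ) ^ (Complex.I * (ρ : ℂ) - 2 - (k : ℂ))

/-- For `m = 0, …, k` these functions form the standard orthonormal basis of the lowest `SU(2)`
irrep (of spin `k/2`, dimension `d_k = k + 1`) in the `(k, ρ)` principal series. -/
def lowestVec (k : ℕ) (ρ : ℝ) (m : Fin (k + 1)) : PrincipalSeries k ρ :=
  ⟨lowestFun k ρ m, by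
    refine ⟨?_, by simp [lowestFun], fun α hα z => ?_⟩
    · have h : ContinuousOn (fun z : Spinor =>
          (Real.sqrt (((k : ℝ) + 1) * (k.choose m : ℝ)) : ℂ) *
            ((starRingEnd ℂ) (z 0) ^ (k - (m : ℕ)) * (starRingEnd ℂ) (z 1) ^ (m : ℕ)) *
            (‖z‖ : ℂ) ^ (Complex.I * (ρ : ℂ) - 2 - (k : ℂ))) {0}ᶜ := by
        refine ContinuousOn.mul ?_ ?_
        · refine Continuous.continuousOn ?_
          have h0 : Continuous fun z : Spinor => (starRingEnd ℂ) (z 0) :=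
            Complex.continuous_conj.comp (by fun_prop)
          have h1 : Continuous fun z : Spinor => (starRingEnd ℂ) (z 1) :=
            Complex.continuous_conj.comp (by fun_prop)
          exact continuous_const.mul ((h0.pow _).mul (h1.pow _))
        · refine ContinuousOn.cpow_const ?_ ?_
          · exact (Complex.continuous_ofReal.comp continuous_norm).continuousOn
          · intro z hz
            exact Or.inl (by simpa using hz)
      refine h.congr fun z hz => ?_
      have hz' : z ≠ 0 := hz
      simp [lowestFun, hz']
    · by_cases hz : z = 0
      · simp [lowestFun, hz]
      · have hk : (k - (m : ℕ)) + (m : ℕ) = k := Nat.sub_add_cancel (Nat.lt_succ_iff.1 m.2)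
        have hαz : α • z ≠ 0 := smul_ne_zero hα hz
        have hpow : (starRingEnd ℂ α) ^ k
            = (starRingEnd ℂ α) ^ (k - (m : ℕ)) * (starRingEnd ℂ α) ^ (m : ℕ) := by
          rw [← pow_add, hk]
        simp only [lowestFun, hz, hαz, if_false, psFactor, norm_smul, PiLp.smul_apply,
          smul_eq_mul, map_mul, mul_pow, Complex.ofReal_mul,
          Complex.mul_cpow_ofReal_nonneg (norm_nonneg α) (norm_nonneg z), hpow]
        ring⟩

/-- The compression `P_k D^{(k,ρ)}(g) P_k` to the lowest `SU(2)` irrep, as a matrix in the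
orthonormal basis `lowestVec`. As `P_k` has finite rank, the trace over the whole representation of
a product of such compressions is the trace of the product of these matrices. -/
def compression (k : ℕ) (ρ : ℝ) (g : SL2C) : Matrix (Fin (k + 1)) (Fin (k + 1)) ℂ :=
  Matrix.of fun m n => psInner (lowestVec k ρ m) (principalSeriesRep k ρ g (lowestVec k ρ n))

/-! ### Root 2-complexes -/

/-- A (finite) root 2-complex `𝒦` with boundary. Its 1-skeleton is given by the bulk vertices `V`
and the half-edges `D`, i.e. the pairs `(v, e)` with `e` an edge end at the bulk vertex `v`. If
`opp d = some d'`, then `d` and `d'` are the two ends of one edge between bulk vertices; if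
`opp d = none`, then the edge of `d` ends at a node of the boundary graph.

A face is the oriented walk along its boundary, written as the list of its corners
`(v; e, e')` in the order of the walk; a corner consists of the incoming half-edge `(v, e)` and the
outgoing half-edge `(v, e')`. The walk is closed for an internal face; for a boundary face it is a
semi-cycle that runs from one boundary node to another (the boundary link of the face closes it).
No two faces have the same boundary cycle. -/
structure RootComplex where
  V : Type
  D : Type
  FInt : Type
  FBd : Type
  [finV : Fintype V]
  [finD : Fintype D]
  [finFInt : Fintype FInt]
  [finFBd : Fintype FBd]
  vert : D → V
  opp : D → Option D
  opp_symm : ∀ d d', opp d = some d' → opp d' = some d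
  opp_ne : ∀ d, opp d ≠ some d
  bdInt : FInt → List (D × D)
  bdBd : FBd → List (D × D)
  bdInt_ne : ∀ h, bdInt h ≠ []
  bdBd_ne : ∀ b, bdBd b ≠ []
  bdInt_corner : ∀ h, ∀ c ∈ bdInt h, vert c.1 = vert c.2
  bdBd_corner : ∀ b, ∀ c ∈ bdBd b, vert c.1 = vert c.2
  bdInt_closed : ∀ h, Cycle.Chain (fun c c' => opp c.2 = some c'.1) (bdInt h : Cycle (D × D))
  bdBd_walk : ∀ b, List.IsChain (fun c c' => opp c.2 = some c'.1) (bdBd b)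
  bdBd_start : ∀ b, ∀ c ∈ (bdBd b).head?, opp c.1 = none
  bdBd_end : ∀ b, ∀ c ∈ (bdBd b).getLast?, opp c.2 = none
  bdInt_inj : Function.Injective fun h => (bdInt h : Cycle (D × D))
  bdBd_inj : Function.Injective bdBd

attribute [instance] RootComplex.finV RootComplex.finD RootComplex.finFInt RootComplex.finFBd

namespace RootComplex

variable (K : RootComplex)

/-- The half-edge `d` belongs to an edge of `E_int`, the edges on the boundary of internal faces. -/
def IsInt (d : K.D) : Prop :=
  ∃ h, ∃ c ∈ K.bdInt h, c.1 = d ∨ c.2 = d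

/-- The intersection graph `Γ_v` of the complex with a small sphere around the vertex `v`: its nodes
are the half-edges at `v`, and two of them are linked if they form a corner of some face. -/
def vertexGraph (v : K.V) : SimpleGraph {d : K.D // K.vert d = v} :=
  SimpleGraph.fromRel fun d d' =>
    (∃ h, (d.1, d'.1) ∈ K.bdInt h) ∨ (∃ b, (d.1, d'.1) ∈ K.bdBd b)

/-- The intersection graph `Γ_{v,-}` of a small sphere around `v` with the subcomplex `𝒦_-` formed
by the internal faces and their edges. -/
def interiorVertexGraph (v : K.V) : SimpleGraph {d : K.D // K.vert d = v ∧ K.IsInt d} :=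
  SimpleGraph.fromRel fun d d' => ∃ h, (d.1, d'.1) ∈ K.bdInt h

end RootComplex

/-- A graph is 3-connected if it has more than three vertices and stays connected when fewer than
three of its vertices are removed. -/
def IsThreeConnected {W : Type} (G : SimpleGraph W) : Prop :=
  3 < Nat.card W ∧ ∀ s : Set W, s.encard < 3 → (G.induce sᶜ).Connected

/-! ### Holonomies with gauge fixing -/

section Holonomies

variable (K : RootComplex) (e₀ : K.V → K.D)

/-- The group variables `g_{ve}` that are not gauge fixed (`g_{v,e₀(v)} = 1` for every `v`). -/
abbrev Config : Type := {d : K.D // d ≠ e₀ (K.vert d)} → SL2C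

/-- The space `𝒢_int` of the `g_{ve}` with `e ∈ E_int`, with the gauge fixing implemented. -/
abbrev IntConfig : Type := {d : K.D // d ≠ e₀ (K.vert d) ∧ K.IsInt d} → SL2C

variable {K e₀}

/-- The values `g_{ve}` of a configuration at all half-edges. -/
def Config.full (x : Config K e₀) : K.D → SL2C := by
  classical
  exact fun d => if h : d ≠ e₀ (K.vert d) then x ⟨d, h⟩ else 1

/-- The values `g_{ve}`, `e ∈ E_int`, of an internal configuration. (The value `1` at half-edges
outside `E_int` is irrelevant: no internal face meets them.) -/
def IntConfig.full (x : IntConfig K e₀) : K.D → SL2C := by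
  classical
  exact fun d => if h : d ≠ e₀ (K.vert d) ∧ K.IsInt d then x ⟨d, h⟩ else 1

/-- The restriction of a configuration to the half-edges in `E_int`. -/
def Config.toInt (x : Config K e₀) : IntConfig K e₀ := fun d => x ⟨d.1, d.2.1⟩

end Holonomies

/-- The wedge holonomy `U = g_{ve}⁻¹ g_{ve'}` at the corner `c = (v; e, e')`. -/
def wedge {K : RootComplex} (g : K.D → SL2C) (c : K.D × K.D) : SL2C := (g c.1)⁻¹ * g c.2

/-! ### Face amplitudes -/

section Amplitudes

variable {K : RootComplex}

/-- The label `ρ = γ (k + 2)` that goes with `k` (`γ` is the Barbero-Immirzi parameter). -/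
def rhoOf (γ : ℝ) (k : ℕ) : ℝ := γ * ((k : ℝ) + 2)

/-- The amplitude `τ_k^{(h)} = d_k Tr_{(k,ρ)} [∏_{v ∈ ∂h} P_k g_{ve}⁻¹ g_{ve'} P_k]` of an internal
face with spin `k/2`. -/
def tauInt (γ : ℝ) (k : ℕ) (h : K.FInt) (g : K.D → SL2C) : ℂ :=
  ((k : ℂ) + 1) *
    Matrix.trace ((K.bdInt h).map fun c => compression k (rhoOf γ k) (wedge g c)).prod

/-- The amplitude `τ_k^{(b)} = d_k Tr_{(k,ρ)} [(∏_{v ∈ ∂b} P_k g_{ve}⁻¹ g_{ve'} P_k) H]` of a boundary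
face with spin `k/2`, where `H ∈ SU(2)` is the holonomy along its boundary link. -/
def tauBd (γ : ℝ) (k : ℕ) (b : K.FBd) (g : K.D → SL2C) (H : SU2) : ℂ :=
  ((k : ℂ) + 1) *
    Matrix.trace (((K.bdBd b).map fun c => compression k (rhoOf γ k) (wedge g c)).prod *
      compression k (rhoOf γ k) (ofSU2 H))

/-- The step function with `Θ(0) = 1/2`. -/
def stepTheta (x : ℝ) : ℝ := if 0 < x then 1 else if x = 0 then 1 / 2 else 0

/-- The sum over the faces stacked on one root face:
`∑_{p ≥ 1} λ^p ∑_{1 ≤ k_1 ≤ ⋯ ≤ k_p} ∏_i τ_i(k_i) Θ(A - ∑_i E_{k_i})`, where `τ_i(k)` is the amplitude of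
the `i`-th stacked face if it carries the spin `k/2`. (For a sequence `E` of positive integers that
tends to infinity only finitely many terms are nonzero.) -/
def stackSum (E : ℕ → ℕ) (A : ℝ) (lam : ℂ) (τ : ℕ → ℕ → ℂ) : ℂ :=
  ∑' p : ℕ, ∑' k : {k : Fin (p + 1) → ℕ // Monotone k ∧ ∀ i, 1 ≤ k i},
    lam ^ (p + 1) * (∏ i : Fin (p + 1), τ i (k.1 i)) *
      (stepTheta (A - ∑ i : Fin (p + 1), (E (k.1 i) : ℝ)) : ℂ)

/-- The amplitude `ω_h^bos` of the stack of an internal face. -/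
def omegaInt (γ : ℝ) (E : ℕ → ℕ) (A : ℝ) (lam : ℂ) (h : K.FInt) (g : K.D → SL2C) : ℂ :=
  stackSum E A lam fun _ k => tauInt γ k h g

/-- The amplitude `ω_b^bos` of the stack of a boundary face; `H i` is the holonomy along the `i`-th
stacked boundary link. -/
def omegaBd (γ : ℝ) (E : ℕ → ℕ) (A : ℝ) (lam : ℂ) (b : K.FBd) (H : ℕ → SU2)
    (g : K.D → SL2C) : ℂ :=
  stackSum E A lam fun i k => tauBd γ k b g (H i)

/-- The cut-offs and couplings of the stack amplitude, and its boundary holonomies. -/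
structure StackData (K : RootComplex) where
  cutInt : K.FInt → ℝ
  lamInt : K.FInt → ℂ
  cutBd : K.FBd → ℝ
  lamBd : K.FBd → ℂ
  hol : K.FBd → ℕ → SU2

/-- The integrand `∏_h ω_h^bos ∏_b ω_b^bos` of the stack amplitude. -/
def integrand (e₀ : K.V → K.D) (γ : ℝ) (E : ℕ → ℕ) (S : StackData K) (x : Config K e₀) : ℂ :=
  (∏ h, omegaInt γ E (S.cutInt h) (S.lamInt h) h x.full) *
    ∏ b, omegaBd γ E (S.cutBd b) (S.lamBd b) b (S.hol b) x.full

/-- The gauge fixed measure `dΩ(g) = ∏_{(v,e)} dg_{ve} ∏_v δ(g_{v,e₀(v)})`: the product of a Haar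
measure `μ` of `SL(2, ℂ)` over all half-edges that are not gauge fixed. -/
def measureOmega (e₀ : K.V → K.D) (μ : Measure SL2C) : Measure (Config K e₀) := by
  classical
  exact Measure.pi fun _ => μ

/-- The stack amplitude with the integral over the `g_{ve}`, `e ∈ E_int`, restricted to the region
`U` of `𝒢_int` (all other group variables are integrated over the whole group). -/
def amplitudeOn (e₀ : K.V → K.D) (μ : Measure SL2C) (γ : ℝ) (E : ℕ → ℕ) (S : StackData K)
    (U : Set (IntConfig K e₀)) : ℂ :=
  ∫ x in {x : Config K e₀ | x.toInt ∈ U}, integrand e₀ γ E S x ∂(measureOmega e₀ μ)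

/-- The stack amplitude `𝒜_𝒦`. -/
def amplitude (e₀ : K.V → K.D) (μ : Measure SL2C) (γ : ℝ) (E : ℕ → ℕ) (S : StackData K) : ℂ :=
  ∫ x, integrand e₀ γ E S x ∂(measureOmega e₀ μ)

end Amplitudes

/-! ### Condensation and the critical manifold -/

/-- The sequence `E_k`, `k ≥ 1`: positive integers, nondecreasing, growing like `k ^ N` for some
integer `N ≥ 1`. -/
structure IsEnergy (E : ℕ → ℕ) : Prop where
  pos : ∀ k, 1 ≤ k → 0 < E k
  mono : ∀ k l, 1 ≤ k → k ≤ l → E k ≤ E l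
  growth : ∃ N : ℕ, 1 ≤ N ∧ (fun k : ℕ => (E k : ℝ)) =Θ[atTop] fun k : ℕ => (k : ℝ) ^ N

/-- `β_k(λ) = ln(|λ| d_k²) / E_k`. -/
def beta (E : ℕ → ℕ) (lam : ℂ) (k : ℕ) : ℝ := Real.log (‖lam‖ * ((k : ℝ) + 1) ^ 2) / E k

/-- `k₀/2` is the unique condensation spin: `β_k(λ)`, `k ≥ 1`, has its maximum at `k₀` only. -/
def IsCondensationSpin (E : ℕ → ℕ) (lam : ℂ) (k₀ : ℕ) : Prop :=
  1 ≤ k₀ ∧ ∀ k, 1 ≤ k → k ≠ k₀ → beta E lam k < beta E lam k₀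

/-- `β^* = sup_{k ≠ k₀} β_k(λ)`. -/
def betaStar (E : ℕ → ℕ) (lam : ℂ) (k₀ : ℕ) : ℝ :=
  sSup (beta E lam '' {k | 1 ≤ k ∧ k ≠ k₀})

section Regions

variable {K : RootComplex}

/-- `g_h ∈ 𝒰_h`: `τ_{k₀}^{(h)}(g_h) ≠ 0` and
`R_h(k₀, g_h, λ_h) = ln |λ_h τ_{k₀}^{(h)}(g_h)| / E_{k₀} > β^*_h`. -/
def InUh (γ : ℝ) (E : ℕ → ℕ) (lam : ℂ) (k₀ : ℕ) (h : K.FInt) (g : K.D → SL2C) : Prop :=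
  tauInt γ k₀ h g ≠ 0 ∧
    betaStar E lam k₀ < Real.log ‖lam * tauInt γ k₀ h g‖ / E k₀

/-- `g_h ∈ 𝒞_h^ς`, `ς = ±1`: all wedge holonomies along `∂h` are in `SU(2)`, and their ordered product
is `ς` times the identity. -/
def InCh (h : K.FInt) (s : ℤˣ) (g : K.D → SL2C) : Prop :=
  (∀ c ∈ K.bdInt h,
    (wedge g c : Matrix (Fin 2) (Fin 2) ℂ) ∈ Matrix.specialUnitaryGroup (Fin 2) ℂ) ∧
  (((K.bdInt h).map (wedge g)).prod : Matrix (Fin 2) (Fin 2) ℂ) =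
    (((s : ℤ) : ℂ)) • (1 : Matrix (Fin 2) (Fin 2) ℂ)

/-- The region `𝒰_int`. -/
def UInt (e₀ : K.V → K.D) (γ : ℝ) (E : ℕ → ℕ) (lam : K.FInt → ℂ) (k₀ : K.FInt → ℕ) :
    Set (IntConfig K e₀) :=
  {x | ∀ h, InUh γ E (lam h) (k₀ h) h x.full}

/-- The sector `𝒞_int^S` of the critical manifold for a choice `S` of signs. -/
def CIntSector (e₀ : K.V → K.D) (S : K.FInt → ℤˣ) : Set (IntConfig K e₀) :=
  {x | ∀ h, InCh h (S h) x.full}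

/-- The critical manifold `𝒞_int`. -/
def CInt (e₀ : K.V → K.D) : Set (IntConfig K e₀) := ⋃ S : K.FInt → ℤˣ, CIntSector e₀ S

end Regions

end SpinfoamStack

end

open SpinfoamStack

noncomputable section

namespace SpinfoamStack

/-! ### The topology of `SL(2, ℂ)` and the Hilbert-Schmidt norm -/

/-! Everything rests on one decay estimate. A matrix element of a compression `P_k g P_k` is at most
`k + 1` times the spherical function `φ(g) = ∫ ‖w g‖⁻²` over the unit sphere of `ℂ²`, and `φ(g) =
O(‖g‖^{-s})` for every `s < 2` (`spherical_le`). With `s = 3/2`, a face amplitude is bounded by a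
polynomial in `k` times the product of `‖U_c‖^{-3/2}` over the corners of the face
(`exists_norm_tauInt_le`).

Compactness. If all wedge norms are bounded, a walk in the connected graph `Γ_{v,-}` from the gauge
fixed value `1` bounds every variable at `v` (`isCompact_boundedWedges`). Going to infinity
therefore makes some wedge norm diverge, and the decay estimate sends the amplitude of its face to
zero. On `𝒰_int` the positivity of `β*` forces `|λ τ| > 1`, hence bounded wedges; on `𝒞_int` all
wedge norms equal `√2`.

Absolute convergence. A kernel `∏ ‖gᵢ⁻¹ gⱼ‖^{-wᵢⱼ}` with one point fixed is integrable as soon as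
every cut of the weights exceeds `4`, because `‖g‖^{-q}` is Haar integrable for `q > 4`
(`lintegral_exp_neg_energy_lt_top`). The points are integrated out one at a time. A fractional form
of Lovász's splitting-off theorem replaces the edges at a point, in pairs, by edges between its
neighbours without spoiling the cuts (`exists_complete_splitting`), and the integral that remains is
a convolution of two kernels, controlled by `φ` (`lintegral_two_point`). In a 3-connected vertex
graph every cut is crossed by at least three corners, and `3 · 3/2 = 9/2 > 4`
(`le_cutWeight_cornerWeight`).

Localization. Compressions of unitaries are contractions, so `|τ_k| ≤ d_k²`; equality forces all
wedges into `SU(2)` and their product to be `±1` (`exists_inCh_of_le_norm_tauInt`). A stack sum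
whose face amplitudes satisfy `|λ τ_k| ≤ e^{b E_k}` grows no faster than `e^{(b+δ)A}`, and one
factor of each stack is kept aside to supply the integrable kernel
(`IsEnergy.exists_norm_stackSum_le`). Outside `𝒰_int` some face has rate at most `β* < β_{k₀}`; in
`𝒰_int` but away from `𝒞_int` a compactness argument gives a uniform deficit of some `|τ_{k₀}|`. In
both cases the rate `κ` drops by a fixed amount. -/

instance : LocallyCompactSpace SL2C :=
  have : LocallyCompactSpace (Matrix (Fin 2) (Fin 2) ℂ) :=
    inferInstanceAs (LocallyCompactSpace (Fin 2 → Fin 2 → ℂ))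
  (Matrix.SpecialLinearGroup.isClosedEmbedding_val (n := Fin 2) (R := ℂ)).locallyCompactSpace

instance : SecondCountableTopology SL2C := by
  have : SecondCountableTopology (Matrix (Fin 2) (Fin 2) ℂ) :=
    inferInstanceAs (SecondCountableTopology (Fin 2 → Fin 2 → ℂ))
  exact (Matrix.SpecialLinearGroup.isClosedEmbedding_val
    (n := Fin 2) (R := ℂ)).isInducing.secondCountableTopology

theorem hsNorm_eq (M : Matrix (Fin 2) (Fin 2) ℂ) :
    hsNorm M = √(‖M 0 0‖ ^ 2 + ‖M 0 1‖ ^ 2 + ‖M 1 0‖ ^ 2 + ‖M 1 1‖ ^ 2) := by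
  unfold hsNorm
  congr 1
  simp only [Matrix.trace_fin_two, Matrix.mul_apply, Fin.sum_univ_two, Matrix.conjTranspose_apply,
    Complex.star_def, Complex.mul_conj, Complex.normSq_eq_norm_sq]
  norm_cast
  ring

theorem hsNorm_sq (M : Matrix (Fin 2) (Fin 2) ℂ) :
    hsNorm M ^ 2 = ‖M 0 0‖ ^ 2 + ‖M 0 1‖ ^ 2 + ‖M 1 0‖ ^ 2 + ‖M 1 1‖ ^ 2 := by
  rw [hsNorm_eq, Real.sq_sqrt (by positivity)]

theorem hsNorm_nonneg (M : Matrix (Fin 2) (Fin 2) ℂ) : 0 ≤ hsNorm M := Real.sqrt_nonneg _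

theorem continuous_hsNorm : Continuous hsNorm := by
  simp_rw [funext hsNorm_eq]
  fun_prop

theorem norm_entry_le_hsNorm (M : Matrix (Fin 2) (Fin 2) ℂ) (i j : Fin 2) :
    ‖M i j‖ ≤ hsNorm M := by
  refine le_of_sq_le_sq ?_ (hsNorm_nonneg M)
  rw [hsNorm_sq]
  fin_cases i <;> fin_cases j <;> simp <;> nlinarith [sq_nonneg ‖M 0 0‖, sq_nonneg ‖M 0 1‖,
    sq_nonneg ‖M 1 0‖, sq_nonneg ‖M 1 1‖]

theorem norm_dot_sq_le (a b c d : ℂ) :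
    ‖a * c + b * d‖ ^ 2 ≤ (‖a‖ ^ 2 + ‖b‖ ^ 2) * (‖c‖ ^ 2 + ‖d‖ ^ 2) := by
  have h : ‖a * c + b * d‖ ≤ ‖a‖ * ‖c‖ + ‖b‖ * ‖d‖ := by
    simpa using norm_add_le (a * c) (b * d)
  have h2 : ‖a * c + b * d‖ ^ 2 ≤ (‖a‖ * ‖c‖ + ‖b‖ * ‖d‖) ^ 2 := by gcongr
  nlinarith [sq_nonneg (‖a‖ * ‖d‖ - ‖b‖ * ‖c‖)]

theorem hsNorm_mul_le (M L : Matrix (Fin 2) (Fin 2) ℂ) :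
    hsNorm (M * L) ≤ hsNorm M * hsNorm L := by
  refine le_of_sq_le_sq ?_ (mul_nonneg (hsNorm_nonneg _) (hsNorm_nonneg _))
  rw [mul_pow, hsNorm_sq, hsNorm_sq, hsNorm_sq]
  simp only [Matrix.mul_apply, Fin.sum_univ_two]
  linarith [norm_dot_sq_le (M 0 0) (M 0 1) (L 0 0) (L 1 0),
    norm_dot_sq_le (M 0 0) (M 0 1) (L 0 1) (L 1 1),
    norm_dot_sq_le (M 1 0) (M 1 1) (L 0 0) (L 1 0),
    norm_dot_sq_le (M 1 0) (M 1 1) (L 0 1) (L 1 1)]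

/-- The Hilbert-Schmidt norm of an element of `SL(2, ℂ)`. -/
def nrm (g : SL2C) : ℝ := hsNorm (g : Matrix (Fin 2) (Fin 2) ℂ)

theorem continuous_nrm : Continuous nrm :=
  continuous_hsNorm.comp Matrix.SpecialLinearGroup.isClosedEmbedding_val.continuous

theorem measurable_nrm : Measurable nrm := continuous_nrm.measurable

theorem det_eq_one (g : SL2C) :
    (g : Matrix (Fin 2) (Fin 2) ℂ) 0 0 * (g : Matrix (Fin 2) (Fin 2) ℂ) 1 1 -
      (g : Matrix (Fin 2) (Fin 2) ℂ) 0 1 * (g : Matrix (Fin 2) (Fin 2) ℂ) 1 0 = 1 := by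
  have h := g.2
  rwa [Matrix.det_fin_two] at h

/-- From `ad - bc = 1` and the AM-GM inequality, `1 ≤ |ad| + |bc| ≤ ‖g‖² / 2`. This makes `log (nrm
g)` nonnegative and `nrm g ^ (-p)` decreasing in `p`. -/
theorem one_le_nrm (g : SL2C) : 1 ≤ nrm g := by
  refine le_of_sq_le_sq ?_ (hsNorm_nonneg _)
  rw [nrm, hsNorm_sq]
  set M := (g : Matrix (Fin 2) (Fin 2) ℂ)
  have h : ‖M 0 0 * M 1 1 - M 0 1 * M 1 0‖ = 1 := by rw [det_eq_one g]; simp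
  have h2 := norm_sub_le (M 0 0 * M 1 1) (M 0 1 * M 1 0)
  rw [h, norm_mul, norm_mul] at h2
  nlinarith [sq_nonneg (‖M 0 0‖ - ‖M 1 1‖), sq_nonneg (‖M 0 1‖ - ‖M 1 0‖)]

theorem nrm_pos (g : SL2C) : 0 < nrm g := zero_lt_one.trans_le (one_le_nrm g)

theorem nrm_mul_le (g h : SL2C) : nrm (g * h) ≤ nrm g * nrm h := by
  simpa [nrm] using hsNorm_mul_le (g : Matrix (Fin 2) (Fin 2) ℂ) h

/-- The inverse is the adjugate, which only permutes the entries up to sign. -/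
theorem nrm_inv (g : SL2C) : nrm g⁻¹ = nrm g := by
  have h : nrm g⁻¹ ^ 2 = nrm g ^ 2 := by
    rw [nrm, nrm, hsNorm_sq, hsNorm_sq, Matrix.SpecialLinearGroup.SL2_inv_expl]
    simp
    ring
  exact (sq_eq_sq₀ (nrm_pos _).le (nrm_pos _).le).1 h

theorem nrm_one : nrm 1 = √2 := by
  rw [nrm, hsNorm_eq]
  norm_num

theorem nrm_inv_mul_comm (g h : SL2C) : nrm (g⁻¹ * h) = nrm (h⁻¹ * g) := by
  rw [← nrm_inv, mul_inv_rev, inv_inv]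

theorem nrm_inv_mul_le (a b c : SL2C) : nrm (a⁻¹ * c) ≤ nrm (a⁻¹ * b) * nrm (b⁻¹ * c) := by
  have := nrm_mul_le (a⁻¹ * b) (b⁻¹ * c)
  rwa [mul_assoc, mul_inv_cancel_left] at this

theorem conjTranspose_mul_self_of_su2 (u : SU2) :
    ((ofSU2 u : SL2C) : Matrix (Fin 2) (Fin 2) ℂ).conjTranspose * (ofSU2 u : SL2C) = 1 := by
  have := (Matrix.mem_specialUnitaryGroup_iff.1 u.2).1
  exact (Matrix.mem_unitaryGroup_iff'.1 this)

theorem nrm_ofSU2_mul (u : SU2) (g : SL2C) : nrm (ofSU2 u * g) = nrm g := by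
  unfold nrm hsNorm
  congr 2
  rw [Matrix.trace_mul_comm, Matrix.trace_mul_comm (g : Matrix (Fin 2) (Fin 2) ℂ)]
  congr 1
  rw [Matrix.SpecialLinearGroup.coe_mul, Matrix.conjTranspose_mul, Matrix.mul_assoc,
    ← Matrix.mul_assoc _ _ (g : Matrix (Fin 2) (Fin 2) ℂ), conjTranspose_mul_self_of_su2,
    Matrix.one_mul]

theorem isCompact_nrm_le (M : ℝ) : IsCompact {g : SL2C | nrm g ≤ M} := by
  have hK : IsCompact (Set.univ.pi fun _ : Fin 2 => Set.univ.pi fun _ : Fin 2 =>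
      Metric.closedBall (0 : ℂ) M) :=
    isCompact_univ_pi fun _ => isCompact_univ_pi fun _ => isCompact_closedBall _ _
  refine (Matrix.SpecialLinearGroup.isClosedEmbedding_val.isCompact_preimage
    (K := (Set.univ.pi fun _ : Fin 2 => Set.univ.pi fun _ : Fin 2 =>
      Metric.closedBall (0 : ℂ) M)) hK).of_isClosed_subset
    (isClosed_le continuous_nrm continuous_const) ?_
  intro g hg i _ j _
  simpa using (norm_entry_le_hsNorm _ i j).trans hg

/-! ### Spinors -/

theorem spinor_norm_sq (z : Spinor) : ‖z‖ ^ 2 = ‖z 0‖ ^ 2 + ‖z 1‖ ^ 2 := by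
  rw [EuclideanSpace.norm_sq_eq, Fin.sum_univ_two]

theorem rowMul_apply (z : Spinor) (g : SL2C) (j : Fin 2) :
    rowMul z g j = z 0 * (g : Matrix (Fin 2) (Fin 2) ℂ) 0 j +
      z 1 * (g : Matrix (Fin 2) (Fin 2) ℂ) 1 j := by
  simp [rowMul, Matrix.vecMul, dotProduct, Fin.sum_univ_two]

theorem norm_rowMul_le (z : Spinor) (g : SL2C) : ‖rowMul z g‖ ≤ ‖z‖ * nrm g := by
  refine le_of_sq_le_sq ?_ (mul_nonneg (norm_nonneg _) (nrm_pos g).le)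
  rw [mul_pow, spinor_norm_sq, spinor_norm_sq, nrm, hsNorm_sq]
  simp only [rowMul_apply]
  set M := (g : Matrix (Fin 2) (Fin 2) ℂ)
  linarith [norm_dot_sq_le (z 0) (z 1) (M 0 0) (M 1 0), norm_dot_sq_le (z 0) (z 1) (M 0 1) (M 1 1)]

theorem norm_le_norm_rowMul (z : Spinor) (g : SL2C) : ‖z‖ ≤ ‖rowMul z g‖ * nrm g := by
  have h := norm_rowMul_le (rowMul z g) g⁻¹
  rwa [rowMul_mul, mul_inv_cancel, rowMul_one, nrm_inv] at h

theorem norm_rowMul_ofSU2 (z : Spinor) (u : SU2) : ‖rowMul z (ofSU2 u)‖ = ‖z‖ := by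
  have h : ‖rowMul z (ofSU2 u)‖ ^ 2 = ‖z‖ ^ 2 := by
    have hu := (Matrix.mem_unitaryGroup_iff.1 (Matrix.mem_specialUnitaryGroup_iff.1 u.2).1)
    have key : ∀ y : Spinor, ((‖y‖ ^ 2 : ℝ) : ℂ) = dotProduct y.ofLp (star y.ofLp) := by
      intro y
      rw [spinor_norm_sq]
      simp [dotProduct, Fin.sum_univ_two, Complex.mul_conj, Complex.normSq_eq_norm_sq]
    have : ((‖rowMul z (ofSU2 u)‖ ^ 2 : ℝ) : ℂ) = ((‖z‖ ^ 2 : ℝ) : ℂ) := by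
      rw [key, key]
      simp only [rowMul, ofSU2, Matrix.star_vecMul]
      rw [Matrix.dotProduct_mulVec, Matrix.vecMul_vecMul, ← Matrix.star_eq_conjTranspose, hu,
        Matrix.vecMul_one]
    exact_mod_cast this
  exact (sq_eq_sq₀ (norm_nonneg _) (norm_nonneg _)).1 h

/-- The spinor `(1, 0)`. -/
def spinorUp : Spinor := WithLp.toLp 2 ![1, 0]

theorem exists_su2_rowMul_eq {z : Spinor} (hz : ‖z‖ = 1) :
    ∃ u : SU2, rowMul spinorUp (ofSU2 u) = z := by
  have h1 : ‖z 0‖ ^ 2 + ‖z 1‖ ^ 2 = 1 := by rw [← spinor_norm_sq, hz, one_pow]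
  have h2 : z 0 * (starRingEnd ℂ) (z 0) + z 1 * (starRingEnd ℂ) (z 1) = 1 := by
    rw [Complex.mul_conj, Complex.mul_conj, Complex.normSq_eq_norm_sq, Complex.normSq_eq_norm_sq]
    rw [← Complex.ofReal_add, h1, Complex.ofReal_one]
  refine ⟨⟨!![z 0, z 1; -(starRingEnd ℂ) (z 1), (starRingEnd ℂ) (z 0)], ?_⟩, ?_⟩
  · rw [Matrix.mem_specialUnitaryGroup_iff, Matrix.mem_unitaryGroup_iff]
    constructor
    · ext i j
      fin_cases i <;> fin_cases j <;>
        simp [Matrix.mul_apply, Fin.sum_univ_two, Matrix.star_eq_conjTranspose] <;>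
        first | ring1 | linear_combination h2
    · rw [Matrix.det_fin_two_of]
      linear_combination h2
  · ext j
    rw [rowMul_apply]
    fin_cases j <;> simp [spinorUp, ofSU2]

open scoped ENNReal

/-! ### Invariance of Lebesgue measure on spinors -/

/-- The right action of `SL(2, ℂ)` on spinors as a linear map. -/
def rowMulLin (g : SL2C) : Spinor →ₗ[ℂ] Spinor :=
  ((WithLp.linearEquiv 2 ℂ (Fin 2 → ℂ)).symm : (Fin 2 → ℂ) →ₗ[ℂ] Spinor) ∘ₗ
    (Matrix.vecMulLinear (g : Matrix (Fin 2) (Fin 2) ℂ)) ∘ₗ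
      ((WithLp.linearEquiv 2 ℂ (Fin 2 → ℂ)) : Spinor →ₗ[ℂ] (Fin 2 → ℂ))

theorem det_rowMulLin (g : SL2C) : LinearMap.det (rowMulLin g) = 1 := by
  have h := LinearMap.det_conj (Matrix.vecMulLinear (g : Matrix (Fin 2) (Fin 2) ℂ))
    (WithLp.linearEquiv 2 ℂ (Fin 2 → ℂ)).symm
  rw [LinearEquiv.symm_symm] at h
  rw [rowMulLin, h, ← Matrix.mulVecLin_transpose, ← Matrix.toLin'_apply', LinearMap.det_toLin',
    Matrix.det_transpose, g.2]

/-- The real determinant of a complex linear map is the field norm of its complex determinant, which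
is `1` here. -/
theorem measurePreserving_rowMul (g : SL2C) :
    MeasurePreserving (fun z : Spinor => rowMul z g) := by
  refine ⟨(continuous_rowMul g).measurable, ?_⟩
  have hdet : LinearMap.det ((rowMulLin g).restrictScalars ℝ) = 1 := by
    rw [LinearMap.det_restrictScalars, det_rowMulLin, map_one]
  have h := Measure.map_linearMap_addHaar_eq_smul_addHaar (volume : Measure Spinor)
    (f := (rowMulLin g).restrictScalars ℝ) (by rw [hdet]; exact one_ne_zero)
  rw [hdet] at h
  rw [inv_one, abs_one, ENNReal.ofReal_one, one_smul] at h
  exact h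

/-- Uniqueness of Haar measure suffices, so the relative normalisation stays unspecified:
integrability needs only its finiteness, and it cancels from the moment formula. -/
theorem exists_map_spinor_volume :
    ∃ c : ℝ≥0∞, c ≠ ∞ ∧ Measure.map (fun z : Spinor => (z 0, z 1)) volume =
      c • ((volume : Measure ℂ).prod (volume : Measure ℂ)) := by
  let e : Spinor ≃L[ℝ] ℂ × ℂ :=
    LinearEquiv.toContinuousLinearEquiv
      { toFun := fun z => (z 0, z 1)
        invFun := fun p => WithLp.toLp 2 ![p.1, p.2]
        map_add' := fun _ _ => rfl
        map_smul' := fun _ _ => rfl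
        left_inv := fun z => by ext j; fin_cases j <;> rfl
        right_inv := fun _ => rfl }
  have : (Measure.map e (volume : Measure Spinor)).IsAddHaarMeasure :=
    e.isAddHaarMeasure_map _
  refine ⟨_, ENNReal.coe_ne_top, Measure.isAddLeftInvariant_eq_smul (Measure.map e volume)
    ((volume : Measure ℂ).prod (volume : Measure ℂ))⟩

/-! ### A concrete Haar measure on `SL(2, ℂ)` -/

/-- The determinant of the matrix with columns `M.1` and `M.2`. -/
def colDet (M : Spinor × Spinor) : ℂ := M.1 0 * M.2 1 - M.2 0 * M.1 1

/-- Left multiplication of a pair of columns. -/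
def colMul (g : SL2C) (M : Spinor × Spinor) : Spinor × Spinor :=
  (rowMul M.1 g.transpose, rowMul M.2 g.transpose)

theorem colDet_colMul (g : SL2C) (M : Spinor × Spinor) : colDet (colMul g M) = colDet M := by
  simp only [colDet, colMul, rowMul_apply, Matrix.SpecialLinearGroup.coe_transpose,
    Matrix.transpose_apply]
  linear_combination (M.1 0 * M.2 1 - M.2 0 * M.1 1) * det_eq_one g

theorem measurePreserving_colMul (g : SL2C) : MeasurePreserving (colMul g) :=
  (measurePreserving_rowMul _).prod (measurePreserving_rowMul _)

/-- The rescaling of a pair of columns to unit determinant. -/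
def normalize (M : Spinor × Spinor) : SL2C :=
  if h : colDet M ≠ 0 then
    ⟨!![M.1 0 * (colDet M) ^ (-(1 / 2) : ℂ), M.2 0 * (colDet M) ^ (-(1 / 2) : ℂ);
        M.1 1 * (colDet M) ^ (-(1 / 2) : ℂ), M.2 1 * (colDet M) ^ (-(1 / 2) : ℂ)], by
      have h2 : (colDet M) ^ (-(1 / 2) : ℂ) * (colDet M) ^ (-(1 / 2) : ℂ) = (colDet M)⁻¹ := by
        rw [← Complex.cpow_add _ _ h, ← Complex.cpow_neg_one]
        norm_num
      rw [Matrix.det_fin_two_of]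
      calc _ = colDet M * ((colDet M) ^ (-(1 / 2) : ℂ) * (colDet M) ^ (-(1 / 2) : ℂ)) := by
            rw [colDet]; ring
        _ = 1 := by rw [h2, mul_inv_cancel₀ h]⟩
  else 1

theorem coe_normalize {M : Spinor × Spinor} (h : colDet M ≠ 0) :
    (normalize M : Matrix (Fin 2) (Fin 2) ℂ) =
      !![M.1 0 * (colDet M) ^ (-(1 / 2) : ℂ), M.2 0 * (colDet M) ^ (-(1 / 2) : ℂ);
        M.1 1 * (colDet M) ^ (-(1 / 2) : ℂ), M.2 1 * (colDet M) ^ (-(1 / 2) : ℂ)] := by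
  unfold normalize
  exact congrArg Subtype.val (dif_pos h)

/-- Left multiplication preserves the determinant, so the same value of the principal branch of `det
^ (-1/2)` occurs on both sides and its discontinuity plays no role. -/
theorem normalize_colMul (g : SL2C) {M : Spinor × Spinor} (h : colDet M ≠ 0) :
    normalize (colMul g M) = g * normalize M := by
  have h' : colDet (colMul g M) ≠ 0 := by rwa [colDet_colMul]
  ext i j
  rw [Matrix.SpecialLinearGroup.coe_mul, coe_normalize h, coe_normalize h',
    colDet_colMul]
  generalize (colDet M) ^ (-(1 / 2) : ℂ) = s
  fin_cases i <;> fin_cases j <;>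
    simp [Matrix.mul_apply, Fin.sum_univ_two, colMul, rowMul_apply] <;> ring

theorem measurable_normalize : Measurable normalize := by
  have hemb : IsClosedEmbedding (fun (g : SL2C) (i j : Fin 2) =>
      (g : Matrix (Fin 2) (Fin 2) ℂ) i j) :=
    Matrix.SpecialLinearGroup.isClosedEmbedding_val (n := Fin 2) (R := ℂ)
  rw [← hemb.measurableEmbedding.measurable_comp_iff]
  have hd : Measurable colDet := by unfold colDet; fun_prop
  have hs : MeasurableSet {M | colDet M ≠ 0} := (hd (measurableSet_singleton 0)).compl
  have hp : Measurable fun M => (colDet M) ^ (-(1 / 2) : ℂ) := hd.pow_const _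
  refine measurable_pi_lambda _ fun i => measurable_pi_lambda _ fun j => ?_
  have : (fun M => (normalize M : Matrix (Fin 2) (Fin 2) ℂ) i j) = fun M =>
      if colDet M ≠ 0 then ((if j = 0 then M.1 i else M.2 i) * (colDet M) ^ (-(1 / 2) : ℂ))
      else (1 : Matrix (Fin 2) (Fin 2) ℂ) i j := by
    ext M
    by_cases h : colDet M ≠ 0
    · rw [coe_normalize h]
      fin_cases i <;> fin_cases j <;> simp [h]
    · have h1 : normalize M = 1 := dif_neg h
      rw [h1, if_neg h, Matrix.SpecialLinearGroup.coe_one]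
  change Measurable (fun M => (normalize M : Matrix (Fin 2) (Fin 2) ℂ) i j)
  rw [this]
  refine Measurable.ite hs (Measurable.mul ?_ hp) measurable_const
  split_ifs <;> fun_prop

/-- The shell of pairs of columns whose determinant has modulus between `1` and `2`. -/
def detShell : Set (Spinor × Spinor) := {M | 1 ≤ ‖colDet M‖ ∧ ‖colDet M‖ ≤ 2}

theorem continuous_colDet : Continuous colDet := by
  unfold colDet
  fun_prop

theorem measurableSet_detShell : MeasurableSet detShell := by
  have h : IsClosed detShell := (isClosed_le continuous_const continuous_colDet.norm).inter
    (isClosed_le continuous_colDet.norm continuous_const)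
  exact h.measurableSet

theorem colDet_ne_zero {M : Spinor × Spinor} (h : M ∈ detShell) : colDet M ≠ 0 := by
  intro h0
  have := h.1
  rw [h0, norm_zero] at this
  linarith

/-- The image of Lebesgue measure on `detShell` under the rescaling to unit determinant. -/
def shellHaar : Measure SL2C := ((volume : Measure (Spinor × Spinor)).restrict detShell).map normalize

/-- Left multiplication preserves Lebesgue measure on pairs of columns, maps the shell to itself and
commutes with the rescaling. -/
instance : shellHaar.IsMulLeftInvariant where
  map_mul_left_eq_self g := by
    have hpre : colMul g ⁻¹' detShell = detShell := by
      ext M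
      simp [detShell, colDet_colMul]
    have h := (measurePreserving_colMul g).restrict_preimage measurableSet_detShell
    rw [hpre] at h
    unfold shellHaar
    rw [Measure.map_map (measurable_const_mul g) measurable_normalize]
    conv_rhs => rw [← h.map_eq, Measure.map_map measurable_normalize h.measurable]
    refine Measure.map_congr ?_
    filter_upwards [ae_restrict_mem measurableSet_detShell] with M hM
    simp [normalize_colMul g (colDet_ne_zero hM)]

theorem shellHaar_ne_zero : shellHaar ≠ 0 := by
  intro h
  have h1 : shellHaar Set.univ = 0 := by rw [h]; simp
  rw [shellHaar, Measure.map_apply measurable_normalize .univ, Set.preimage_univ,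
    Measure.restrict_apply_univ] at h1
  let U : Set (Spinor × Spinor) := {M | 1 < ‖colDet M‖} ∩ {M | ‖colDet M‖ < 2}
  have hU : IsOpen U := (isOpen_lt continuous_const continuous_colDet.norm).inter
    (isOpen_lt continuous_colDet.norm continuous_const)
  have hne : U.Nonempty := by
    refine ⟨(WithLp.toLp 2 ![3 / 2, 0], WithLp.toLp 2 ![0, 1]), ?_⟩
    constructor <;> simp [colDet] <;> norm_num
  have hsub : U ⊆ detShell := fun M hM => ⟨hM.1.le, hM.2.le⟩
  exact (hU.measure_pos volume hne).ne' (measure_mono_null hsub h1)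

/-- The weight `(1 + ‖a‖)^{-q}` on the complex numbers `a` with `‖a‖ ≥ 1/√2`. -/
def entryWeight (q : ℝ) (a : ℂ) : ℝ≥0∞ :=
  Set.indicator {a : ℂ | 1 ≤ 2 * ‖a‖ ^ 2} (fun a => ENNReal.ofReal ((1 + ‖a‖) ^ (-q))) a

/-- The weight `(1 + ‖a‖)^{-q}` on the matrices `(a, b; c, d)` with `|ad - bc| ≤ 2`,
`‖a‖ ≥ 1/√2`, and `‖b‖, ‖c‖ ≤ ‖a‖`. -/
def dominantWeight (q : ℝ) (p : (ℂ × ℂ) × (ℂ × ℂ)) : ℝ≥0∞ :=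
  entryWeight q p.1.1 * Set.indicator {c : ℂ | ‖c‖ ≤ ‖p.1.1‖} 1 p.1.2 *
    Set.indicator {b : ℂ | ‖b‖ ≤ ‖p.1.1‖} 1 p.2.1 *
      Set.indicator {d : ℂ | ‖p.1.1 * d - p.2.1 * p.1.2‖ ≤ 2} 1 p.2.2

theorem measurable_entryWeight (q : ℝ) : Measurable (entryWeight q) := by
  refine Measurable.indicator ?_ ?_
  · exact Measurable.ennreal_ofReal (Measurable.pow_const (by fun_prop) _)
  · exact (isClosed_le continuous_const (by fun_prop)).measurableSet

theorem measurable_dominantWeight (q : ℝ) : Measurable (dominantWeight q) := by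
  refine Measurable.mul (Measurable.mul (Measurable.mul ?_ ?_) ?_) ?_
  · exact (measurable_entryWeight q).comp (by fun_prop)
  · have h : MeasurableSet {p : (ℂ × ℂ) × (ℂ × ℂ) | ‖p.1.2‖ ≤ ‖p.1.1‖} :=
      measurableSet_le (by fun_prop) (by fun_prop)
    exact measurable_one.indicator h
  · have h : MeasurableSet {p : (ℂ × ℂ) × (ℂ × ℂ) | ‖p.2.1‖ ≤ ‖p.1.1‖} :=
      measurableSet_le (by fun_prop) (by fun_prop)
    exact measurable_one.indicator h
  · have h : MeasurableSet {p : (ℂ × ℂ) × (ℂ × ℂ) | ‖p.1.1 * p.2.2 - p.2.1 * p.1.2‖ ≤ 2} :=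
      measurableSet_le (by fun_prop) (by fun_prop)
    exact measurable_one.indicator h

theorem volume_dist_mul_le {a x : ℂ} (ha : a ≠ 0) :
    (volume : Measure ℂ) {d | ‖a * d - x‖ ≤ 2} = ENNReal.ofReal (4 * Real.pi / ‖a‖ ^ 2) := by
  have : {d | ‖a * d - x‖ ≤ 2} = Metric.closedBall (x / a) (2 / ‖a‖) := by
    ext d
    have h1 : a * d - x = a * (d - x / a) := by field_simp
    rw [Set.mem_ofPred_eq, Metric.mem_closedBall, dist_eq_norm, h1, norm_mul,
      le_div_iff₀ (norm_pos_iff.2 ha), mul_comm]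
  rw [this, Complex.volume_closedBall, ← ENNReal.ofReal_pow (by positivity),
    ← ENNReal.ofReal_coe_nnreal, ← ENNReal.ofReal_mul (by positivity)]
  congr 1
  simp
  field_simp
  norm_num

theorem volume_norm_le (r : ℝ) (hr : 0 ≤ r) :
    (volume : Measure ℂ) {b | ‖b‖ ≤ r} = ENNReal.ofReal (Real.pi * r ^ 2) := by
  have : {b : ℂ | ‖b‖ ≤ r} = Metric.closedBall 0 r := by
    ext d; simp
  rw [this, Complex.volume_closedBall, ← ENNReal.ofReal_pow hr,
    ← ENNReal.ofReal_coe_nnreal, ← ENNReal.ofReal_mul (by positivity)]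
  congr 1
  simp
  ring

theorem lintegral_entryWeight_mul_lt_top {q : ℝ} (hq : 4 < q) :
    ∫⁻ a, entryWeight q a * ENNReal.ofReal (4 * Real.pi ^ 3 * ‖a‖ ^ 2) < ∞ := by
  have h := (integrable_one_add_norm (E := ℂ) (μ := volume) (r := q - 2)
    (by rw [Complex.finrank_real_complex]; norm_num; linarith)).const_mul (4 * Real.pi ^ 3)
  refine lt_of_le_of_lt (lintegral_mono fun a => ?_) h.lintegral_lt_top
  unfold entryWeight
  refine (mul_le_mul_left (Set.indicator_le_self _ _ a) _).trans ?_
  rw [← ENNReal.ofReal_mul (by positivity)]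
  refine ENNReal.ofReal_le_ofReal ?_
  have h1 : (1 + ‖a‖) ^ (-(q - 2)) = (1 + ‖a‖) ^ (-q) * (1 + ‖a‖) ^ 2 := by
    rw [← Real.rpow_natCast, ← Real.rpow_add (by positivity)]
    congr 1
    push_cast
    ring
  rw [h1]
  have h2 : ‖a‖ ^ 2 ≤ (1 + ‖a‖) ^ 2 := by gcongr; linarith
  have h3 : 0 ≤ 4 * Real.pi ^ 3 * (1 + ‖a‖) ^ (-q) := by positivity
  nlinarith [mul_le_mul_of_nonneg_left h2 h3]

/-- For a fixed largest entry `a`, the entries `b` and `c` range over discs of area `π‖a‖²`, and `d`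
over a disc of area `4π/‖a‖²`. What remains is the integral of `4π³ ‖a‖² (1 + ‖a‖)^{-q}` over the
plane, which needs `q > 4`. -/
theorem lintegral_dominantWeight_lt_top {q : ℝ} (hq : 4 < q) :
    ∫⁻ p, dominantWeight q p ∂(((volume : Measure ℂ).prod (volume : Measure ℂ)).prod
      ((volume : Measure ℂ).prod (volume : Measure ℂ))) < ∞ := by
  have hm := measurable_dominantWeight q
  have key : ∀ a : ℂ, ∫⁻ c, ∫⁻ y, dominantWeight q ((a, c), y) ∂((volume : Measure ℂ).prod volume)
      ≤ entryWeight q a * ENNReal.ofReal (4 * Real.pi ^ 3 * ‖a‖ ^ 2) := by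
    intro a
    by_cases ha : 1 ≤ 2 * ‖a‖ ^ 2
    swap
    · have h0 : entryWeight q a = 0 := Set.indicator_of_notMem (by exact ha) _
      simp [dominantWeight, h0]
    have ha0 : a ≠ 0 := by
      rintro rfl
      norm_num at ha
    have hball : MeasurableSet {b : ℂ | ‖b‖ ≤ ‖a‖} := measurableSet_le (by fun_prop) (by fun_prop)
    have h1 : ∀ c, ∫⁻ y, dominantWeight q ((a, c), y) ∂((volume : Measure ℂ).prod volume) =
        entryWeight q a * (ENNReal.ofReal (4 * Real.pi / ‖a‖ ^ 2) *
          ENNReal.ofReal (Real.pi * ‖a‖ ^ 2)) * Set.indicator {c : ℂ | ‖c‖ ≤ ‖a‖} 1 c := by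
      intro c
      have hma : Measurable fun y => dominantWeight q ((a, c), y) := hm.comp (by fun_prop)
      rw [lintegral_prod _ hma.aemeasurable]
      have h2 : ∀ b, ∫⁻ d, dominantWeight q ((a, c), (b, d)) =
          entryWeight q a * Set.indicator {c : ℂ | ‖c‖ ≤ ‖a‖} 1 c *
            ENNReal.ofReal (4 * Real.pi / ‖a‖ ^ 2) * Set.indicator {b : ℂ | ‖b‖ ≤ ‖a‖} 1 b := by
        intro b
        have hset : MeasurableSet {d : ℂ | ‖a * d - b * c‖ ≤ 2} :=
          measurableSet_le (by fun_prop) (by fun_prop)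
        unfold dominantWeight
        simp only
        rw [lintegral_const_mul _ (measurable_one.indicator hset), lintegral_indicator_one hset,
          volume_dist_mul_le ha0]
        ring
      simp_rw [h2]
      rw [lintegral_const_mul _ (measurable_one.indicator hball), lintegral_indicator_one hball,
        volume_norm_le _ (norm_nonneg _)]
      ring
    simp_rw [h1]
    rw [lintegral_const_mul _ (measurable_one.indicator hball), lintegral_indicator_one hball,
        volume_norm_le _ (norm_nonneg _), mul_assoc]
    refine mul_le_mul_right (le_of_eq ?_) _
    rw [← ENNReal.ofReal_mul (by positivity), ← ENNReal.ofReal_mul (by positivity)]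
    congr 1
    have : ‖a‖ ≠ 0 := norm_ne_zero_iff.2 ha0
    field_simp
  rw [lintegral_prod _ hm.aemeasurable, lintegral_prod]
  · exact (lintegral_mono key).trans_lt (lintegral_entryWeight_mul_lt_top hq)
  · exact (Measurable.lintegral_prod_right' hm).aemeasurable

theorem dominantWeight_eq (q : ℝ) {p : (ℂ × ℂ) × (ℂ × ℂ)} (h1 : ‖p.1.2‖ ≤ ‖p.1.1‖)
    (h2 : ‖p.2.1‖ ≤ ‖p.1.1‖) (h3 : ‖p.1.1 * p.2.2 - p.2.1 * p.1.2‖ ≤ 2) :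
    dominantWeight q p = entryWeight q p.1.1 := by
  rw [dominantWeight, Set.indicator_of_mem (by exact h1), Set.indicator_of_mem (by exact h2),
    Set.indicator_of_mem (by exact h3)]
  simp

/-- The entries of a pair of columns. -/
def colEntries (M : Spinor × Spinor) : (ℂ × ℂ) × (ℂ × ℂ) := ((M.1 0, M.1 1), (M.2 0, M.2 1))

theorem measurable_colEntries : Measurable colEntries := by
  unfold colEntries
  fun_prop

theorem lintegral_dominantWeight_comp_lt_top {q : ℝ} (hq : 4 < q) {e : (ℂ × ℂ) × (ℂ × ℂ) →
    (ℂ × ℂ) × (ℂ × ℂ)} (he : MeasurePreserving e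
      (((volume : Measure ℂ).prod (volume : Measure ℂ)).prod
        ((volume : Measure ℂ).prod (volume : Measure ℂ)))
      (((volume : Measure ℂ).prod (volume : Measure ℂ)).prod
        ((volume : Measure ℂ).prod (volume : Measure ℂ)))) :
    ∫⁻ M, dominantWeight q (e (colEntries M)) ∂(volume : Measure (Spinor × Spinor)) < ∞ := by
  obtain ⟨c, hc, hmap⟩ := exists_map_spinor_volume
  have hms : Measurable fun z : Spinor => (z 0, z 1) := by fun_prop
  have h : Measure.map colEntries (volume : Measure (Spinor × Spinor)) =
      (c * c) • (((volume : Measure ℂ).prod (volume : Measure ℂ)).prod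
        ((volume : Measure ℂ).prod (volume : Measure ℂ))) := by
    have hs : SFinite (Measure.map (fun z : Spinor => (z 0, z 1)) volume) := inferInstance
    have h2 := Measure.map_prod_map (volume : Measure Spinor) (volume : Measure Spinor) hms hms
    rw [hmap, Measure.prod_smul_left, Measure.prod_smul_right, smul_smul] at h2
    exact h2.symm
  have hm := measurable_dominantWeight q
  rw [← lintegral_map (f := fun p => dominantWeight q (e p)) (hm.comp he.measurable)
    measurable_colEntries, h, lintegral_smul_measure, he.lintegral_comp hm]
  exact ENNReal.mul_lt_top (ENNReal.mul_lt_top hc.lt_top hc.lt_top)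
    (lintegral_dominantWeight_lt_top hq)

theorem nrm_normalize_sq {M : Spinor × Spinor} (h : colDet M ≠ 0) :
    nrm (normalize M) ^ 2 =
      (‖M.1 0‖ ^ 2 + ‖M.2 0‖ ^ 2 + ‖M.1 1‖ ^ 2 + ‖M.2 1‖ ^ 2) / ‖colDet M‖ := by
  have hs : ‖(colDet M) ^ (-(1 / 2) : ℂ)‖ ^ 2 = ‖colDet M‖⁻¹ := by
    have h2 : (colDet M) ^ (-(1 / 2) : ℂ) * (colDet M) ^ (-(1 / 2) : ℂ) = (colDet M)⁻¹ := by
      rw [← Complex.cpow_add _ _ h, ← Complex.cpow_neg_one]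
      norm_num
    rw [sq, ← norm_mul, h2, norm_inv]
  rw [nrm, hsNorm_sq, coe_normalize h]
  simp only [Matrix.of_apply, Matrix.cons_val', Matrix.cons_val_zero, Matrix.cons_val_one,
    Matrix.cons_val_fin_one, norm_mul, mul_pow, hs]
  rw [div_eq_mul_inv]
  ring

/-- On the shell the determinant is at most `2`, so the rescaled matrix has squared norm at least
`‖a‖² / 2`. Since `1 ≤ 2‖a‖²`, also `(1 + ‖a‖)² ≤ 6‖a‖² ≤ 16 · ‖a‖² / 2`, whence the factor `4`. -/
theorem nrm_normalize_rpow_le {q : ℝ} (hq : 0 ≤ q) {M : Spinor × Spinor} (hM : M ∈ detShell)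
    {a : ℂ} (ha : 1 ≤ 2 * ‖a‖ ^ 2)
    (hle : ‖a‖ ^ 2 ≤ ‖M.1 0‖ ^ 2 + ‖M.2 0‖ ^ 2 + ‖M.1 1‖ ^ 2 + ‖M.2 1‖ ^ 2) :
    ENNReal.ofReal (nrm (normalize M) ^ (-q)) ≤
      ENNReal.ofReal (4 ^ q) * entryWeight q a := by
  rw [entryWeight, Set.indicator_of_mem (by exact ha), ← ENNReal.ofReal_mul (by positivity)]
  refine ENNReal.ofReal_le_ofReal ?_
  have h1 : 1 + ‖a‖ ≤ 4 * nrm (normalize M) := by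
    refine le_of_sq_le_sq ?_ (by linarith [nrm_pos (normalize M)])
    rw [mul_pow, nrm_normalize_sq (colDet_ne_zero hM)]
    have h2 : (‖a‖ ^ 2) / 2 ≤
        (‖M.1 0‖ ^ 2 + ‖M.2 0‖ ^ 2 + ‖M.1 1‖ ^ 2 + ‖M.2 1‖ ^ 2) / ‖colDet M‖ :=
      div_le_div₀ (by positivity) hle (by linarith [hM.1]) hM.2
    nlinarith [sq_nonneg (‖a‖ - 1), norm_nonneg a]
  have h3 : (4 * nrm (normalize M)) ^ (-q) ≤ (1 + ‖a‖) ^ (-q) :=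
    Real.rpow_le_rpow_of_nonpos (by positivity) h1 (by linarith)
  rw [Real.mul_rpow (by norm_num) (nrm_pos _).le] at h3
  calc nrm (normalize M) ^ (-q) = 4 ^ q * (4 ^ (-q) * nrm (normalize M) ^ (-q)) := by
        rw [← mul_assoc, ← Real.rpow_add (by norm_num)]
        simp
    _ ≤ _ := by gcongr

/-- Exchanges of rows and columns move the largest entry to the upper left corner; they preserve
Lebesgue measure and change the determinant at most by a sign. Four copies of the dominant weight
thus cover the shell. The largest entry satisfies `1 ≤ 2‖a‖²` because the determinant has modulus at
least `1`. -/
theorem lintegral_nrm_rpow_shellHaar_lt_top {q : ℝ} (hq : 4 < q) :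
    ∫⁻ g, ENNReal.ofReal (nrm g ^ (-q)) ∂shellHaar < ∞ := by
  have hf : Measurable fun g => ENNReal.ofReal (nrm g ^ (-q)) :=
    (measurable_nrm.pow_const _).ennreal_ofReal
  rw [shellHaar, lintegral_map hf measurable_normalize]
  set m2 := (volume : Measure ℂ).prod (volume : Measure ℂ)
  have e0 : MeasurePreserving (id : (ℂ × ℂ) × (ℂ × ℂ) → _) (m2.prod m2) (m2.prod m2) :=
    MeasurePreserving.id _
  have ec : MeasurePreserving (Prod.swap : (ℂ × ℂ) × (ℂ × ℂ) → _) (m2.prod m2) (m2.prod m2) :=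
    Measure.measurePreserving_swap
  have er : MeasurePreserving (Prod.map Prod.swap Prod.swap : (ℂ × ℂ) × (ℂ × ℂ) → _)
      (m2.prod m2) (m2.prod m2) :=
    Measure.measurePreserving_swap.prod Measure.measurePreserving_swap
  have hm := measurable_dominantWeight q
  have hmeas : ∀ {e : (ℂ × ℂ) × (ℂ × ℂ) → (ℂ × ℂ) × (ℂ × ℂ)},
      MeasurePreserving e (m2.prod m2) (m2.prod m2) →
        Measurable fun M => dominantWeight q (e (colEntries M)) :=
    fun he => hm.comp (he.measurable.comp measurable_colEntries)
  have hbound : ∀ M ∈ detShell, ENNReal.ofReal (nrm (normalize M) ^ (-q)) ≤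
      ENNReal.ofReal (4 ^ q) * (dominantWeight q (id (colEntries M)) +
        dominantWeight q (Prod.swap (colEntries M)) +
        dominantWeight q (Prod.map Prod.swap Prod.swap (colEntries M)) +
        dominantWeight q ((Prod.swap ∘ Prod.map Prod.swap Prod.swap) (colEntries M))) := by
    intro M hM
    have hd : ‖M.1 0 * M.2 1 - M.2 0 * M.1 1‖ ≤ 2 := hM.2
    have hd1 : 1 ≤ ‖M.1 0 * M.2 1 - M.2 0 * M.1 1‖ := hM.1
    have hd2 : 1 ≤ ‖M.1 0‖ * ‖M.2 1‖ + ‖M.2 0‖ * ‖M.1 1‖ := by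
      refine hd1.trans ((norm_sub_le _ _).trans ?_)
      rw [norm_mul, norm_mul]
    have hq0 : 0 ≤ q := by linarith
    set a := ‖M.1 0‖
    set b := ‖M.2 0‖
    set c := ‖M.1 1‖
    set d := ‖M.2 1‖
    have na : 0 ≤ a := norm_nonneg _
    have nb : 0 ≤ b := norm_nonneg _
    have nc : 0 ≤ c := norm_nonneg _
    have nd : 0 ≤ d := norm_nonneg _
    have cases4 : (b ≤ a ∧ c ≤ a ∧ d ≤ a) ∨ (a ≤ b ∧ c ≤ b ∧ d ≤ b) ∨ (a ≤ c ∧ b ≤ c ∧ d ≤ c) ∨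
        (a ≤ d ∧ b ≤ d ∧ c ≤ d) := by
      clear * -
      grind
    rcases cases4 with ⟨h1, h2, h3⟩ | ⟨h1, h2, h3⟩ | ⟨h1, h2, h3⟩ | ⟨h1, h2, h3⟩
    · refine (nrm_normalize_rpow_le hq0 hM (a := M.1 0) (by nlinarith) (by nlinarith)).trans
        (mul_le_mul_right ?_ _)
      exact (dominantWeight_eq q (p := id (colEntries M)) (by assumption) (by assumption)
        (hd)).ge.trans (le_add_right (le_add_right le_self_add))
    · refine (nrm_normalize_rpow_le hq0 hM (a := M.2 0) (by nlinarith) (by nlinarith)).trans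
        (mul_le_mul_right ?_ _)
      exact (dominantWeight_eq q (p := Prod.swap (colEntries M)) (by assumption) (by assumption)
        (by rw [norm_sub_rev]; exact hd)).ge.trans (le_add_right (le_add_right le_add_self))
    · refine (nrm_normalize_rpow_le hq0 hM (a := M.1 1) (by nlinarith) (by nlinarith)).trans
        (mul_le_mul_right ?_ _)
      exact (dominantWeight_eq q (p := Prod.map Prod.swap Prod.swap (colEntries M)) (by assumption) (by assumption)
        (by
          have h := hd
          rw [norm_sub_rev, mul_comm (M.1 0), mul_comm (M.2 0)] at h
          exact h)).ge.trans (le_add_right le_add_self)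
    · refine (nrm_normalize_rpow_le hq0 hM (a := M.2 1) (by nlinarith) (by nlinarith)).trans
        (mul_le_mul_right ?_ _)
      exact (dominantWeight_eq q (p := (Prod.swap ∘ Prod.map Prod.swap Prod.swap) (colEntries M)) (by assumption) (by assumption)
        (by
          have h := hd
          rw [mul_comm (M.1 0), mul_comm (M.2 0)] at h
          exact h)).ge.trans (le_add_self)
  refine lt_of_le_of_lt (setLIntegral_mono ?_ hbound) ?_
  · exact (((((hmeas e0).add (hmeas ec)).add (hmeas er)).add (hmeas (ec.comp er)))).const_mul _
  refine lt_of_le_of_lt (setLIntegral_le_lintegral _ _) ?_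
  rw [lintegral_const_mul, lintegral_add_left, lintegral_add_left, lintegral_add_left]
  · refine ENNReal.mul_lt_top ENNReal.ofReal_lt_top ?_
    simp only [ENNReal.add_lt_top]
    exact ⟨⟨⟨lintegral_dominantWeight_comp_lt_top hq e0, lintegral_dominantWeight_comp_lt_top hq ec⟩,
      lintegral_dominantWeight_comp_lt_top hq er⟩,
      lintegral_dominantWeight_comp_lt_top hq (ec.comp er)⟩
  · exact hmeas e0
  · exact (hmeas e0).add (hmeas ec)
  · exact ((hmeas e0).add (hmeas ec)).add (hmeas er)
  · exact (((hmeas e0).add (hmeas ec)).add (hmeas er)).add (hmeas (ec.comp er))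

/-- Chebyshev's inequality for the integrable function `nrm ^ (-5)`, which is bounded below on
compact sets. -/
instance : IsFiniteMeasureOnCompacts shellHaar where
  lt_top_of_isCompact := by
    intro S hS
    obtain ⟨R, hR⟩ := hS.exists_bound_of_continuousOn continuous_nrm.continuousOn
    have hR' : ∀ g ∈ S, nrm g ≤ |R| + 1 := fun g hg =>
      ((le_abs_self _).trans (hR g hg)).trans ((le_abs_self R).trans (by linarith))
    have hpos : 0 < |R| + 1 := by positivity
    have h1 : ENNReal.ofReal ((|R| + 1) ^ (-5 : ℝ)) * shellHaar S ≤
        ∫⁻ g, ENNReal.ofReal (nrm g ^ (-5 : ℝ)) ∂shellHaar := by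
      rw [← setLIntegral_const]
      refine (setLIntegral_mono (measurable_nrm.pow_const _).ennreal_ofReal fun g hg => ?_).trans
        (setLIntegral_le_lintegral _ _)
      exact ENNReal.ofReal_le_ofReal
        (Real.rpow_le_rpow_of_nonpos (nrm_pos g) (hR' g hg) (by norm_num))
    refine ENNReal.lt_top_of_mul_ne_top_right
      (h1.trans_lt (lintegral_nrm_rpow_shellHaar_lt_top (by norm_num))).ne ?_
    exact (ENNReal.ofReal_pos.2 (by positivity)).ne'

theorem lintegral_nrm_rpow_lt_top (μ : Measure SL2C) [μ.IsHaarMeasure] {q : ℝ} (hq : 4 < q) :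
    ∫⁻ g, ENNReal.ofReal (nrm g ^ (-q)) ∂μ < ∞ := by
  have h := Measure.isMulLeftInvariant_eq_smul shellHaar μ
  have hc : shellHaar.haarScalarFactor μ ≠ 0 := by
    intro h0
    rw [h0, zero_smul] at h
    exact shellHaar_ne_zero h
  have h1 := lintegral_nrm_rpow_shellHaar_lt_top hq
  rw [h, lintegral_smul_measure] at h1
  exact ENNReal.lt_top_of_mul_ne_top_right h1.ne (by simpa using hc)

/-! ### Polar coordinates and invariance of the sphere integral -/

theorem finrank_spinor : Module.finrank ℝ Spinor = 4 := by
  have h := Module.finrank_mul_finrank ℝ ℂ Spinor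
  rw [Complex.finrank_real_complex, finrank_euclideanSpace, Fintype.card_fin] at h
  omega

/-- The normalised rotation invariant measure on the unit sphere of `ℂ²`. -/
def sphereMeasure : Measure (Metric.sphere (0 : Spinor) 1) :=
  ((volume : Measure Spinor).toSphere Set.univ)⁻¹ • (volume : Measure Spinor).toSphere

theorem toSphere_univ_ne_zero : (volume : Measure Spinor).toSphere Set.univ ≠ 0 := by
  rw [Ne, Measure.measure_univ_eq_zero]
  exact Measure.toSphere_ne_zero _

instance : IsProbabilityMeasure sphereMeasure where
  measure_univ := by
    rw [sphereMeasure, Measure.smul_apply, smul_eq_mul,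
      ENNReal.inv_mul_cancel toSphere_univ_ne_zero (measure_ne_top _ _)]

instance : sphereMeasure.IsOpenPosMeasure where
  open_pos U hU hne := by
    rw [sphereMeasure, Measure.smul_apply, smul_eq_mul]
    exact mul_ne_zero (ENNReal.inv_ne_zero.2 (measure_ne_top _ _)) (hU.measure_ne_zero _ hne)

theorem lintegral_polar {f : Spinor → ℝ≥0∞} (hf : Measurable f) :
    ∫⁻ z, f z = ∫⁻ w, (∫⁻ r in Set.Ioi (0 : ℝ), ENNReal.ofReal (r ^ 3) *
      f (r • (w : Spinor))) ∂(volume : Measure Spinor).toSphere := by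
  have h1 : ∫⁻ z, f z = ∫⁻ z : ({0}ᶜ : Set Spinor), f z ∂(volume.comap Subtype.val) := by
    rw [lintegral_subtype_comap (measurableSet_singleton _).compl, restrict_compl_singleton]
  have hp := (volume : Measure Spinor).measurePreserving_homeomorphUnitSphereProd
  have h2 := hp.lintegral_comp (f := fun p : Metric.sphere (0 : Spinor) 1 × Set.Ioi (0 : ℝ) =>
    f ((p.2 : ℝ) • (p.1 : Spinor))) (by fun_prop)
  rw [h1]
  have h3 : ∀ z : ({0}ᶜ : Set Spinor), f (((homeomorphUnitSphereProd Spinor z).2 : ℝ) •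
      ((homeomorphUnitSphereProd Spinor z).1 : Spinor)) = f z := by
    intro z
    have := (homeomorphUnitSphereProd Spinor).symm_apply_apply z
    conv_rhs => rw [← this]
    rfl
  simp_rw [h3] at h2
  rw [h2, lintegral_prod _ (by fun_prop)]
  refine lintegral_congr fun w => ?_
  rw [finrank_spinor, Measure.volumeIoiPow, lintegral_withDensity_eq_lintegral_mul _ (by fun_prop)
    (by fun_prop)]
  exact lintegral_subtype_comap measurableSet_Ioi
    (fun r : ℝ => ENNReal.ofReal (r ^ 3) * f (r • (w : Spinor)))

/-- Homogeneity of degree `-4` under positive real scalars. -/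
def IsHomogNegFour (f : Spinor → ℝ≥0∞) : Prop :=
  ∀ r : ℝ, 0 < r → ∀ z, f (r • z) = ENNReal.ofReal (r ^ 4)⁻¹ * f z

theorem rowMul_real_smul (r : ℝ) (z : Spinor) (g : SL2C) :
    rowMul (r • z) g = r • rowMul z g := by
  have := rowMul_smul (r : ℂ) z g
  simpa using this

/-- The logarithmic length of `[1/c, e/c]` is `1` whatever `c` is; the ratio `e` of the shell is
chosen for this. -/
theorem lintegral_log_shell {c : ℝ} (hc : 0 < c) :
    ∫⁻ r in Set.Ioi (0 : ℝ), Set.indicator {r : ℝ | 1 ≤ r * c ∧ r * c ≤ Real.exp 1}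
      (fun r => ENNReal.ofReal r⁻¹) r = 1 := by
  have hS : {r : ℝ | 1 ≤ r * c ∧ r * c ≤ Real.exp 1} = Set.Icc c⁻¹ (Real.exp 1 / c) := by
    ext r
    rw [Set.mem_ofPred_eq, Set.mem_Icc, inv_le_iff_one_le_mul₀ hc, le_div_iff₀ hc]
  have hle : c⁻¹ ≤ Real.exp 1 / c := by
    rw [div_eq_mul_inv]
    have : 1 ≤ Real.exp 1 := Real.one_le_exp zero_le_one
    nlinarith [inv_pos.2 hc]
  have hcpos : 0 < c⁻¹ := inv_pos.2 hc
  have hsub : Set.Icc c⁻¹ (Real.exp 1 / c) ⊆ Set.Ioi 0 := fun r hr => hcpos.trans_le hr.1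
  rw [hS, lintegral_indicator measurableSet_Icc, Measure.restrict_restrict measurableSet_Icc,
    Set.inter_eq_left.2 hsub, Measure.restrict_congr_set Ioc_ae_eq_Icc.symm,
    ← ofReal_integral_eq_lintegral_ofReal]
  · rw [← intervalIntegral.integral_of_le hle, integral_inv_of_pos hcpos (by positivity)]
    have : Real.exp 1 / c / c⁻¹ = Real.exp 1 := by field_simp
    rw [this, Real.log_exp, ENNReal.ofReal_one]
  · have := intervalIntegral.intervalIntegrable_inv (f := fun x : ℝ => x) (μ := volume) (a := c⁻¹)
      (b := Real.exp 1 / c) (fun x hx => by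
        rw [Set.uIcc_of_le hle] at hx
        exact (hcpos.trans_le hx.1).ne') continuousOn_id
    rwa [intervalIntegrable_iff_integrableOn_Ioc_of_le hle] at this
  · filter_upwards [ae_restrict_mem measurableSet_Ioc] with r hr
    exact inv_nonneg.2 (hcpos.trans hr.1).le

/-- In degree `-4` the radial density `r³ f(r w)` equals `f(w)/r`, so each ray contributes `f(w)`
times the logarithmic length of its part of the shell, which does not depend on `g`. A sphere
integral becomes an integral over spinor space, where Lebesgue measure is `SL(2, ℂ)` invariant. -/
theorem lintegral_shell_eq {f : Spinor → ℝ≥0∞} (hf : Measurable f) (hh : IsHomogNegFour f)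
    (g : SL2C) :
    ∫⁻ z, Set.indicator {z | 1 ≤ ‖rowMul z g‖ ∧ ‖rowMul z g‖ ≤ Real.exp 1} f z =
      ∫⁻ w, f w ∂(volume : Measure Spinor).toSphere := by
  have hn : Continuous fun z : Spinor => ‖rowMul z g‖ := (continuous_rowMul g).norm
  have hset : MeasurableSet {z : Spinor | 1 ≤ ‖rowMul z g‖ ∧ ‖rowMul z g‖ ≤ Real.exp 1} :=
    ((isClosed_le continuous_const hn).inter (isClosed_le hn continuous_const)).measurableSet
  rw [lintegral_polar (hf.indicator hset)]
  refine lintegral_congr fun w => ?_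
  have hw : (w : Spinor) ≠ 0 := by
    intro h0
    have := w.2
    rw [h0] at this
    simp at this
  have hc : 0 < ‖rowMul (w : Spinor) g‖ := norm_pos_iff.2 (rowMul_ne_zero hw g)
  have hrad : Measurable fun r : ℝ => Set.indicator {r : ℝ | 1 ≤ r * ‖rowMul (w : Spinor) g‖ ∧
      r * ‖rowMul (w : Spinor) g‖ ≤ Real.exp 1} (fun r => ENNReal.ofReal r⁻¹) r := by
    refine Measurable.indicator (by fun_prop) ?_
    have hs1 : MeasurableSet {r : ℝ | 1 ≤ r * ‖rowMul (w : Spinor) g‖} :=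
      measurableSet_le measurable_const (by fun_prop)
    have hs2 : MeasurableSet {r : ℝ | r * ‖rowMul (w : Spinor) g‖ ≤ Real.exp 1} :=
      measurableSet_le (by fun_prop) measurable_const
    exact hs1.inter hs2
  calc _ = ∫⁻ r in Set.Ioi (0 : ℝ), f w * Set.indicator {r : ℝ | 1 ≤ r * ‖rowMul (w : Spinor) g‖ ∧
      r * ‖rowMul (w : Spinor) g‖ ≤ Real.exp 1} (fun r => ENNReal.ofReal r⁻¹) r := by
        refine setLIntegral_congr_fun measurableSet_Ioi fun r hr => ?_
        have hr0 : 0 < r := hr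
        have h1 : ‖rowMul (r • (w : Spinor)) g‖ = r * ‖rowMul (w : Spinor) g‖ := by
          rw [rowMul_real_smul, norm_smul, Real.norm_of_nonneg hr0.le]
        by_cases hmem : 1 ≤ r * ‖rowMul (w : Spinor) g‖ ∧ r * ‖rowMul (w : Spinor) g‖ ≤ Real.exp 1
        · rw [Set.indicator_of_mem (by rw [Set.mem_ofPred_eq, h1]; exact hmem),
            Set.indicator_of_mem (by exact hmem), hh r hr0, ← mul_assoc,
            ← ENNReal.ofReal_mul (by positivity), mul_comm]
          congr 2
          field_simp
        · rw [Set.indicator_of_notMem (by rw [Set.mem_ofPred_eq, h1]; exact hmem),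
            Set.indicator_of_notMem (by exact hmem), mul_zero, mul_zero]
    _ = f w := by rw [lintegral_const_mul _ hrad, lintegral_log_shell hc, mul_one]

/-- The integral over the sphere of a function homogeneous of degree `-4` is invariant under
`SL(2, ℂ)`. -/
theorem lintegral_sphere_rowMul {f : Spinor → ℝ≥0∞} (hf : Measurable f) (hh : IsHomogNegFour f)
    (g : SL2C) :
    ∫⁻ w, f (rowMul w g) ∂sphereMeasure = ∫⁻ w, f w ∂sphereMeasure := by
  rw [sphereMeasure, lintegral_smul_measure, lintegral_smul_measure]
  congr 1
  have hfg : IsHomogNegFour fun z => f (rowMul z g) := by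
    intro r hr z
    change f (rowMul (r • z) g) = _
    rw [rowMul_real_smul, hh r hr]
  have hm : Measurable fun z : Spinor => rowMul z g := (continuous_rowMul g).measurable
  have h1 := lintegral_shell_eq (hf.comp hm) hfg 1
  simp only [Function.comp_apply] at h1
  have hn : Continuous fun z : Spinor => ‖rowMul z g⁻¹‖ := (continuous_rowMul _).norm
  have hF : Measurable (Set.indicator {z | 1 ≤ ‖rowMul z g⁻¹‖ ∧ ‖rowMul z g⁻¹‖ ≤ Real.exp 1} f) :=
    hf.indicator ((isClosed_le continuous_const hn).inter
      (isClosed_le hn continuous_const)).measurableSet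
  -- The substitution `z ↦ z g` pulls the shell `1 ≤ ‖z g⁻¹‖ ≤ e` back to the round shell.
  rw [← h1, ← lintegral_shell_eq hf hh g⁻¹, ← (measurePreserving_rowMul g).lintegral_comp hF]
  refine lintegral_congr fun z => ?_
  simp only [Set.indicator, Set.mem_ofPred_eq, rowMul_mul, mul_inv_cancel, rowMul_one,
    Function.comp_apply]

/-! ### The spherical function -/

/-- The spherical function `∫ ‖z g‖⁻²` over the unit sphere of `ℂ²`. -/
def spherical (g : SL2C) : ℝ≥0∞ := ∫⁻ w, ‖rowMul (w : Spinor) g‖ₑ ^ (-2 : ℝ) ∂sphereMeasure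

theorem continuous_rowMul_uncurry : Continuous fun p : Spinor × SL2C => rowMul p.1 p.2 := by
  unfold rowMul
  refine (PiLp.continuous_toLp 2 _).comp ?_
  exact Continuous.matrix_vecMul ((PiLp.continuous_ofLp 2 _).comp continuous_fst)
    (Matrix.SpecialLinearGroup.isClosedEmbedding_val.continuous.comp continuous_snd)

theorem enorm_sphere (w : Metric.sphere (0 : Spinor) 1) : ‖(w : Spinor)‖ₑ = 1 := by
  have h : ‖(w : Spinor)‖ = 1 := by simp
  rw [← ofReal_norm, h, ENNReal.ofReal_one]

theorem enorm_rowMul_le (z : Spinor) (g : SL2C) :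
    ‖rowMul z g‖ₑ ≤ ‖z‖ₑ * ENNReal.ofReal (nrm g) := by
  rw [← ofReal_norm, ← ofReal_norm, ← ENNReal.ofReal_mul (norm_nonneg _)]
  exact ENNReal.ofReal_le_ofReal (norm_rowMul_le z g)

theorem enorm_le_enorm_rowMul (z : Spinor) (g : SL2C) :
    ‖z‖ₑ ≤ ‖rowMul z g‖ₑ * ENNReal.ofReal (nrm g) := by
  rw [← ofReal_norm, ← ofReal_norm, ← ENNReal.ofReal_mul (norm_nonneg _)]
  exact ENNReal.ofReal_le_ofReal (norm_le_norm_rowMul z g)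

theorem ennreal_rpow_neg_anti {x y : ℝ≥0∞} (h : x ≤ y) {s : ℝ} (hs : 0 ≤ s) :
    y ^ (-s) ≤ x ^ (-s) := by
  rw [ENNReal.rpow_neg, ENNReal.rpow_neg, ENNReal.inv_le_inv]
  exact ENNReal.rpow_le_rpow h hs

/-- On the unit sphere `‖w g‖ ≤ nrm g`. The bound serves to replace a kernel by `spherical`, whose
convolutions are explicit (`lintegral_nrm_mul_spherical`). -/
theorem nrm_rpow_le_spherical (g : SL2C) : ENNReal.ofReal (nrm g ^ (-2 : ℝ)) ≤ spherical g := by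
  have h : ∀ w : Metric.sphere (0 : Spinor) 1,
      ENNReal.ofReal (nrm g ^ (-2 : ℝ)) ≤ ‖rowMul (w : Spinor) g‖ₑ ^ (-2 : ℝ) := by
    intro w
    rw [← ENNReal.ofReal_rpow_of_pos (nrm_pos g)]
    refine ennreal_rpow_neg_anti ?_ (by norm_num)
    simpa [enorm_sphere] using enorm_rowMul_le (w : Spinor) g
  calc _ = ∫⁻ _w, ENNReal.ofReal (nrm g ^ (-2 : ℝ)) ∂sphereMeasure := by simp
    _ ≤ _ := lintegral_mono h

theorem lintegral_ball_enorm_rpow_lt_top {s : ℝ} (hs : s < 2) :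
    ∫⁻ a in Metric.ball (0 : ℂ) 1, ‖a‖ₑ ^ (-s) < ∞ := by
  have h := (integrableOn_fun_norm_addHaar (volume : Measure ℂ) (f := fun r : ℝ => r ^ (-s))
    (r := 1)).2 (by
      rw [Complex.finrank_real_complex]
      have h1 : IntegrableOn (fun r : ℝ => r ^ (1 - s)) (Set.Ioo 0 1) :=
        (intervalIntegral.integrableOn_Ioo_rpow_iff zero_lt_one).2 (by linarith)
      refine h1.congr_fun (fun r hr => ?_) measurableSet_Ioo
      have hr0 : 0 < r := hr.1
      simp only [Nat.add_one_sub_one, pow_one, smul_eq_mul]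
      rw [sub_eq_add_neg, Real.rpow_add hr0, Real.rpow_one])
  refine lt_of_le_of_lt (le_of_eq ?_) h.lintegral_lt_top
  refine lintegral_congr_ae ?_
  filter_upwards [ae_restrict_of_ae (Measure.ae_ne volume (0 : ℂ))] with a ha
  rw [← ofReal_norm, ENNReal.ofReal_rpow_of_pos (norm_pos_iff.2 ha)]

theorem lintegral_ball_spinor_coord_lt_top {s : ℝ} (hs : s < 2) :
    ∫⁻ z, Set.indicator (Metric.ball (0 : Spinor) 1) (fun z => ‖z 0‖ₑ ^ (-s)) z < ∞ := by
  obtain ⟨c, hc, hmap⟩ := exists_map_spinor_volume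
  have hms : Measurable fun z : Spinor => (z 0, z 1) := by fun_prop
  have hF : Measurable fun a : ℂ => Set.indicator (Metric.ball (0 : ℂ) 1)
      (fun a => ‖a‖ₑ ^ (-s)) a :=
    Measurable.indicator (by fun_prop) Metric.isOpen_ball.measurableSet
  have hG : Measurable fun a : ℂ => Set.indicator (Metric.ball (0 : ℂ) 1)
      (1 : ℂ → ℝ≥0∞) a := measurable_one.indicator Metric.isOpen_ball.measurableSet
  have hle : ∀ z : Spinor, Set.indicator (Metric.ball (0 : Spinor) 1) (fun z => ‖z 0‖ₑ ^ (-s)) z ≤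
      Set.indicator (Metric.ball (0 : ℂ) 1) (fun a => ‖a‖ₑ ^ (-s)) (z 0) *
        Set.indicator (Metric.ball (0 : ℂ) 1) (1 : ℂ → ℝ≥0∞) (z 1) := by
    intro z
    by_cases hz : z ∈ Metric.ball (0 : Spinor) 1
    · have hz1 : ‖z‖ < 1 := by simpa using hz
      have h0 : z 0 ∈ Metric.ball (0 : ℂ) 1 := by
        simpa using (PiLp.norm_apply_le z 0).trans_lt hz1
      have h1 : z 1 ∈ Metric.ball (0 : ℂ) 1 := by
        simpa using (PiLp.norm_apply_le z 1).trans_lt hz1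
      rw [Set.indicator_of_mem hz, Set.indicator_of_mem h0, Set.indicator_of_mem h1]
      simp
    · rw [Set.indicator_of_notMem hz]
      exact zero_le
  refine (lintegral_mono hle).trans_lt ?_
  have h2 := lintegral_map (μ := (volume : Measure Spinor)) (f := fun p : ℂ × ℂ =>
    Set.indicator (Metric.ball (0 : ℂ) 1) (fun a => ‖a‖ₑ ^ (-s)) p.1 *
        Set.indicator (Metric.ball (0 : ℂ) 1) (1 : ℂ → ℝ≥0∞) p.2)
    ((hF.comp measurable_fst).mul (hG.comp measurable_snd)) hms
  simp only at h2
  rw [← h2, hmap, lintegral_smul_measure, lintegral_prod_mul hF.aemeasurable hG.aemeasurable,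
    lintegral_indicator Metric.isOpen_ball.measurableSet,
    lintegral_indicator_one Metric.isOpen_ball.measurableSet]
  exact ENNReal.mul_lt_top hc.lt_top (ENNReal.mul_lt_top (lintegral_ball_enorm_rpow_lt_top hs)
    measure_ball_lt_top)

/-- The zero set of a coordinate has real codimension two, hence `s < 2`. The sphere integral is
compared with the integral over the unit ball: the radii in `(1/2, 1)` alone, where `r³ ≥ 1/8`,
contribute the fraction `1/16`. -/
theorem lintegral_sphere_coord_lt_top {s : ℝ} (hs0 : 0 ≤ s) (hs : s < 2) :
    ∫⁻ w, ‖(w : Spinor) 0‖ₑ ^ (-s) ∂sphereMeasure < ∞ := by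
  rw [sphereMeasure, lintegral_smul_measure]
  refine ENNReal.mul_lt_top (ENNReal.inv_lt_top.2 (pos_iff_ne_zero.2 toSphere_univ_ne_zero)) ?_
  have hF : Measurable fun z : Spinor => Set.indicator (Metric.ball (0 : Spinor) 1)
      (fun z => ‖z 0‖ₑ ^ (-s)) z :=
    Measurable.indicator (by fun_prop) Metric.isOpen_ball.measurableSet
  have h := lintegral_ball_spinor_coord_lt_top hs
  rw [lintegral_polar hF] at h
  have hm : Measurable fun w : Metric.sphere (0 : Spinor) 1 => ‖(w : Spinor) 0‖ₑ ^ (-s) := by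
    fun_prop
  have hle : ∀ w : Metric.sphere (0 : Spinor) 1,
      ENNReal.ofReal (1 / 16) * ‖(w : Spinor) 0‖ₑ ^ (-s) ≤
      ∫⁻ r in Set.Ioi (0 : ℝ), ENNReal.ofReal (r ^ 3) * Set.indicator (Metric.ball (0 : Spinor) 1)
        (fun z => ‖z 0‖ₑ ^ (-s)) (r • (w : Spinor)) := by
    intro w
    have hsub : Set.Ioo (1 / 2 : ℝ) 1 ⊆ Set.Ioi 0 := fun r hr => by
      have := hr.1
      exact lt_trans (by norm_num) this
    refine le_trans ?_ (lintegral_mono_set hsub)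
    have h3 : ∫⁻ _r in Set.Ioo (1 / 2 : ℝ) 1, ENNReal.ofReal (1 / 8) * ‖(w : Spinor) 0‖ₑ ^ (-s) =
        ENNReal.ofReal (1 / 16) * ‖(w : Spinor) 0‖ₑ ^ (-s) := by
      rw [setLIntegral_const, Real.volume_Ioo, mul_right_comm, ← ENNReal.ofReal_mul (by norm_num)]
      norm_num
    rw [← h3]
    refine setLIntegral_mono' measurableSet_Ioo fun r hr => ?_
    have hr0 : 0 < r := hsub hr
    have hmem : r • (w : Spinor) ∈ Metric.ball (0 : Spinor) 1 := by
      rw [mem_ball_zero_iff, norm_smul, Real.norm_of_nonneg hr0.le, norm_eq_of_mem_sphere, mul_one]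
      exact hr.2
    rw [Set.indicator_of_mem hmem]
    have hr3 : (1 / 8 : ℝ) ≤ r ^ 3 := by
      calc (1 / 8 : ℝ) = (1 / 2) ^ 3 := by norm_num
        _ ≤ r ^ 3 := by gcongr; exact hr.1.le
    refine mul_le_mul' (ENNReal.ofReal_le_ofReal hr3) (ennreal_rpow_neg_anti ?_ hs0)
    rw [PiLp.smul_apply, enorm_smul]
    refine mul_le_of_le_one_left' ?_
    rw [Real.enorm_of_nonneg hr0.le]
    exact ENNReal.ofReal_le_one.2 hr.2.le
  have h4 := (lintegral_mono hle).trans_lt h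
  rw [lintegral_const_mul _ hm] at h4
  exact ENNReal.lt_top_of_mul_ne_top_right h4.ne (by simp)

/-- A unit functional is the first coordinate after a rotation in `SU(2)`. Extending `‖w 0‖^{-s}`
from the sphere with degree `-4` makes `lintegral_sphere_rowMul` applicable. -/
theorem lintegral_sphere_functional {s : ℝ} {a b : ℂ}
    (hab : ‖a‖ ^ 2 + ‖b‖ ^ 2 = 1) :
    ∫⁻ w : Metric.sphere (0 : Spinor) 1, ‖(w : Spinor) 0 * a + (w : Spinor) 1 * b‖ₑ ^ (-s)
      ∂sphereMeasure = ∫⁻ w, ‖(w : Spinor) 0‖ₑ ^ (-s) ∂sphereMeasure := by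
  have h2 : a * (starRingEnd ℂ) a + b * (starRingEnd ℂ) b = 1 := by
    rw [Complex.mul_conj, Complex.mul_conj, Complex.normSq_eq_norm_sq, Complex.normSq_eq_norm_sq]
    rw [← Complex.ofReal_add, hab, Complex.ofReal_one]
  let u : SU2 := ⟨!![a, -(starRingEnd ℂ) b; b, (starRingEnd ℂ) a], by
    rw [Matrix.mem_specialUnitaryGroup_iff, Matrix.mem_unitaryGroup_iff']
    constructor
    · ext i j
      fin_cases i <;> fin_cases j <;>
        simp [Matrix.mul_apply, Fin.sum_univ_two, Matrix.star_eq_conjTranspose] <;>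
        first | ring1 | linear_combination h2
    · rw [Matrix.det_fin_two_of]
      linear_combination h2⟩
  have hu : ∀ z : Spinor, rowMul z (ofSU2 u) 0 = z 0 * a + z 1 * b := by
    intro z
    rw [rowMul_apply]
    rfl
  let f : Spinor → ℝ≥0∞ := fun z => ‖z 0‖ₑ ^ (-s) * ‖z‖ₑ ^ (s - 4)
  have hf : Measurable f := by fun_prop
  have hh : IsHomogNegFour f := by
    intro r hr z
    have hr' : ENNReal.ofReal r ≠ 0 := (ENNReal.ofReal_pos.2 hr).ne'
    simp only [f]
    rw [PiLp.smul_apply, enorm_smul, enorm_smul, Real.enorm_of_nonneg hr.le,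
      ENNReal.mul_rpow_of_ne_top ENNReal.ofReal_ne_top enorm_ne_top,
      ENNReal.mul_rpow_of_ne_top ENNReal.ofReal_ne_top enorm_ne_top, mul_mul_mul_comm,
      ← ENNReal.rpow_add _ _ hr' ENNReal.ofReal_ne_top, ENNReal.ofReal_rpow_of_pos hr]
    congr 2
    rw [show -s + (s - 4) = -((4 : ℕ) : ℝ) by push_cast; ring, Real.rpow_neg hr.le,
      Real.rpow_natCast]
  have h := lintegral_sphere_rowMul hf hh (ofSU2 u)
  have e1 : ∀ w : Metric.sphere (0 : Spinor) 1, f w = ‖(w : Spinor) 0‖ₑ ^ (-s) := by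
    intro w
    simp only [f, enorm_sphere, ENNReal.one_rpow, mul_one]
  have e2 : ∀ w : Metric.sphere (0 : Spinor) 1, f (rowMul w (ofSU2 u)) =
      ‖(w : Spinor) 0 * a + (w : Spinor) 1 * b‖ₑ ^ (-s) := by
    intro w
    have : ‖rowMul (w : Spinor) (ofSU2 u)‖ₑ = 1 := by
      rw [← ofReal_norm, norm_rowMul_ofSU2, norm_eq_of_mem_sphere, ENNReal.ofReal_one]
    simp only [f, this, ENNReal.one_rpow, mul_one, hu]
  simp_rw [e1, e2] at h
  exact h

theorem exists_large_column (g : SL2C) : ∃ j : Fin 2,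
    (nrm g / 2) ^ 2 ≤ ‖(g : Matrix (Fin 2) (Fin 2) ℂ) 0 j‖ ^ 2 +
      ‖(g : Matrix (Fin 2) (Fin 2) ℂ) 1 j‖ ^ 2 := by
  by_contra! h
  have h0 := h 0
  have h1 := h 1
  have h2 : nrm g ^ 2 = _ := hsNorm_sq _
  nlinarith [nrm_pos g]

/-- Write `‖w g‖⁻² = ‖w g‖^{-e} ‖w g‖^{-(2-e)}`. The first factor is at most `nrm g ^ e`, since `‖w
g‖ ≥ 1 / nrm g`. In the second, `‖w g‖` is at least the modulus of one component, a linear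
functional given by a column of norm at least `nrm g / 2`, and its power `-(2-e)` is integrable over
the sphere. The loss `2e` in the exponent covers the logarithm in the true decay. -/
theorem spherical_le {e : ℝ} (he : 0 < e) (he2 : e < 2) :
    ∃ C : ℝ≥0∞, C ≠ ∞ ∧ ∀ g, spherical g ≤ C * ENNReal.ofReal (nrm g ^ (-2 + 2 * e)) := by
  have hI := lintegral_sphere_coord_lt_top (s := 2 - e) (by linarith) (by linarith)
  refine ⟨ENNReal.ofReal (2 ^ (2 - e)) * ∫⁻ w, ‖(w : Spinor) 0‖ₑ ^ (-(2 - e)) ∂sphereMeasure,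
    (ENNReal.mul_lt_top ENNReal.ofReal_lt_top hI).ne, fun g => ?_⟩
  obtain ⟨j, hj⟩ := exists_large_column g
  set a := (g : Matrix (Fin 2) (Fin 2) ℂ) 0 j
  set b := (g : Matrix (Fin 2) (Fin 2) ℂ) 1 j
  set t : ℝ := √(‖a‖ ^ 2 + ‖b‖ ^ 2) with ht
  have hN := nrm_pos g
  have htN : nrm g / 2 ≤ t := Real.le_sqrt_of_sq_le hj
  have ht0 : 0 < t := lt_of_lt_of_le (by positivity) htN
  have htsq : t ^ 2 = ‖a‖ ^ 2 + ‖b‖ ^ 2 := Real.sq_sqrt (by positivity)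
  have hab : ‖a / t‖ ^ 2 + ‖b / t‖ ^ 2 = 1 := by
    rw [norm_div, norm_div, Complex.norm_real, Real.norm_of_nonneg ht0.le, div_pow, div_pow,
      ← add_div, ← htsq, div_self (by positivity)]
  have hpt : ∀ w : Metric.sphere (0 : Spinor) 1, ‖rowMul (w : Spinor) g‖ₑ ^ (-2 : ℝ) ≤
      (ENNReal.ofReal (nrm g ^ e) * ENNReal.ofReal ((nrm g / 2) ^ (-(2 - e)))) *
        ‖(w : Spinor) 0 * (a / t) + (w : Spinor) 1 * (b / t)‖ₑ ^ (-(2 - e)) := by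
    intro w
    have hw : (w : Spinor) ≠ 0 := ne_zero_of_mem_unit_sphere w
    have hwg : ‖rowMul (w : Spinor) g‖ₑ ≠ 0 := by
      simpa using rowMul_ne_zero hw g
    rw [show (-2 : ℝ) = -e + -(2 - e) by ring, ENNReal.rpow_add _ _ hwg enorm_ne_top, mul_assoc]
    refine mul_le_mul' ?_ ?_
    · have h1 : (ENNReal.ofReal (nrm g))⁻¹ ≤ ‖rowMul (w : Spinor) g‖ₑ := by
        have h2 := enorm_le_enorm_rowMul (w : Spinor) g
        rw [enorm_sphere] at h2
        rw [← one_div]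
        exact ENNReal.div_le_of_le_mul h2
      refine (ennreal_rpow_neg_anti h1 he.le).trans (le_of_eq ?_)
      rw [ENNReal.inv_rpow, ENNReal.rpow_neg, inv_inv, ENNReal.ofReal_rpow_of_pos hN]
    · have h1 : ENNReal.ofReal (nrm g / 2) *
          ‖(w : Spinor) 0 * (a / t) + (w : Spinor) 1 * (b / t)‖ₑ ≤ ‖rowMul (w : Spinor) g‖ₑ := by
        have h2 : ‖rowMul (w : Spinor) g j‖ ≤ ‖rowMul (w : Spinor) g‖ := PiLp.norm_apply_le _ _
        rw [rowMul_apply] at h2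
        have h3 : (w : Spinor) 0 * (a / t) + (w : Spinor) 1 * (b / t) =
            ((w : Spinor) 0 * a + (w : Spinor) 1 * b) / t := by ring
        rw [h3, ← ofReal_norm, ← ofReal_norm, ← ENNReal.ofReal_mul (by positivity), norm_div,
          Complex.norm_real, Real.norm_of_nonneg ht0.le]
        refine ENNReal.ofReal_le_ofReal (le_trans ?_ h2)
        rw [mul_div_assoc', div_le_iff₀ ht0, mul_comm]
        exact mul_le_mul_of_nonneg_left htN (norm_nonneg _)
      refine (ennreal_rpow_neg_anti h1 (by linarith)).trans (le_of_eq ?_)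
      rw [ENNReal.mul_rpow_of_ne_top ENNReal.ofReal_ne_top enorm_ne_top,
        ENNReal.ofReal_rpow_of_pos (by positivity)]
  refine (lintegral_mono hpt).trans (le_of_eq ?_)
  rw [lintegral_const_mul _ (by fun_prop), lintegral_sphere_functional
    hab, ← ENNReal.ofReal_mul (by positivity), mul_right_comm,
    ← ENNReal.ofReal_mul (by positivity)]
  congr 2
  rw [div_eq_mul_inv, Real.mul_rpow hN.le (by norm_num), Real.inv_rpow (by norm_num),
    Real.rpow_neg (show (0 : ℝ) ≤ 2 by norm_num), inv_inv, show -2 + 2 * e = e + -(2 - e) by ring,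
    Real.rpow_add hN]
  ring

/-! ### The two-point integral -/

/-- `SU(2)` acts transitively on the sphere, and left translation by it preserves both `nrm` and
`μ`. -/
theorem lintegral_nrm_mul_enorm_rowMul (μ : Measure SL2C) [μ.IsMulLeftInvariant] (p : ℝ)
    (w : Metric.sphere (0 : Spinor) 1) :
    ∫⁻ g, ENNReal.ofReal (nrm g ^ (-p)) * ‖rowMul (w : Spinor) g‖ₑ ^ (-2 : ℝ) ∂μ =
      ∫⁻ g, ENNReal.ofReal (nrm g ^ (-p)) * ‖rowMul spinorUp g‖ₑ ^ (-2 : ℝ) ∂μ := by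
  obtain ⟨u, hu⟩ := exists_su2_rowMul_eq (z := (w : Spinor)) (norm_eq_of_mem_sphere w)
  conv_rhs => rw [← lintegral_mul_left_eq_self _ (ofSU2 u)]
  refine lintegral_congr fun g => ?_
  rw [nrm_ofSU2_mul, ← hu, rowMul_mul]

theorem continuous_rowMul_right (z : Spinor) : Continuous fun g : SL2C => rowMul z g :=
  continuous_rowMul_uncurry.comp (continuous_const.prodMk continuous_id)

theorem measurable_spherical : Measurable spherical := by
  refine Measurable.lintegral_prod_right' (f := fun q : SL2C × Metric.sphere (0 : Spinor) 1 =>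
    ‖rowMul (q.2 : Spinor) q.1‖ₑ ^ (-2 : ℝ)) ?_
  refine Measurable.pow_const (Measurable.enorm ?_) _
  exact (continuous_rowMul_uncurry.comp
      ((continuous_subtype_val.comp continuous_snd).prodMk continuous_fst)).measurable

theorem spherical_one : spherical 1 = 1 := by
  simp [spherical, rowMul_one, enorm_sphere]

/-- The spherical function is an eigenfunction of convolution with functions of `nrm`. After
Tonelli's theorem `w b` is `‖w b‖` times a unit spinor; the factor `‖w b‖⁻²` comes out, and the
remaining integral over `g` does not depend on the direction. -/
theorem lintegral_nrm_mul_spherical (μ : Measure SL2C) [μ.IsMulLeftInvariant] [SFinite μ]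
    (p : ℝ) (b : SL2C) :
    ∫⁻ g, ENNReal.ofReal (nrm g ^ (-p)) * spherical (b * g) ∂μ =
      (∫⁻ g, ENNReal.ofReal (nrm g ^ (-p)) * ‖rowMul spinorUp g‖ₑ ^ (-2 : ℝ) ∂μ) *
        spherical b := by
  have hm1 : ∀ g : SL2C, Measurable fun w : Metric.sphere (0 : Spinor) 1 =>
      ‖rowMul (w : Spinor) g‖ₑ ^ (-2 : ℝ) := fun g =>
    (((continuous_rowMul g).comp continuous_subtype_val).measurable.enorm).pow_const _
  simp_rw [spherical, ← lintegral_const_mul _ (hm1 _)]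
  rw [lintegral_lintegral_swap]
  · refine lintegral_congr fun w => ?_
    have hwb : rowMul (w : Spinor) b ≠ 0 := rowMul_ne_zero (ne_zero_of_mem_unit_sphere w) b
    have hpos : 0 < ‖rowMul (w : Spinor) b‖ := norm_pos_iff.2 hwb
    let v : Metric.sphere (0 : Spinor) 1 :=
      ⟨‖rowMul (w : Spinor) b‖⁻¹ • rowMul (w : Spinor) b, by
        rw [mem_sphere_zero_iff_norm, norm_smul, norm_inv, norm_norm, inv_mul_cancel₀ hpos.ne']⟩
    have hv : rowMul (w : Spinor) b = ‖rowMul (w : Spinor) b‖ • (v : Spinor) := by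
      simp only [v]
      rw [smul_smul, mul_inv_cancel₀ hpos.ne', one_smul]
    rw [← lintegral_nrm_mul_enorm_rowMul μ p v, ← lintegral_mul_const]
    · refine lintegral_congr fun g => ?_
      rw [← rowMul_mul, hv, rowMul_real_smul, enorm_smul, enorm_smul, enorm_sphere, mul_one,
        ENNReal.mul_rpow_of_ne_top enorm_ne_top enorm_ne_top]
      ring
    · exact (measurable_nrm.pow_const _).ennreal_ofReal.mul
        ((continuous_rowMul_right _).measurable.enorm.pow_const _)
  · refine Measurable.aemeasurable ?_
    refine Measurable.mul ?_ ?_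
    · exact ((measurable_nrm.comp measurable_fst).pow_const _).ennreal_ofReal
    · refine Measurable.pow_const (Measurable.enorm ?_) _
      exact (continuous_rowMul_uncurry.comp ((continuous_subtype_val.comp continuous_snd).prodMk
        (continuous_const.mul continuous_fst))).measurable

/-- At `b = 1` this eigenvalue is the integral of `nrm ^ (-p)` times `spherical`. The latter decays
almost like `nrm ^ (-2)`, so `p > 2` brings the total exponent above `4`. -/
theorem lintegral_nrm_mul_rowMul_lt_top (μ : Measure SL2C) [μ.IsHaarMeasure] {p : ℝ}
    (hp : 2 < p) :
    ∫⁻ g, ENNReal.ofReal (nrm g ^ (-p)) * ‖rowMul spinorUp g‖ₑ ^ (-2 : ℝ) ∂μ < ∞ := by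
  have h := lintegral_nrm_mul_spherical μ p 1
  rw [spherical_one, mul_one] at h
  rw [← h]
  simp_rw [one_mul]
  obtain ⟨e, he0, he2, hep⟩ : ∃ e : ℝ, 0 < e ∧ e < 2 ∧ 4 < p + 2 - 2 * e := by
    refine ⟨min 1 ((p - 2) / 4), lt_min one_pos (by linarith), by linarith [min_le_left 1 ((p - 2) / 4)],
      by linarith [min_le_right 1 ((p - 2) / 4)]⟩
  obtain ⟨C, hC, hle⟩ := spherical_le he0 he2
  have hpt : ∀ g, ENNReal.ofReal (nrm g ^ (-p)) * spherical g ≤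
      C * ENNReal.ofReal (nrm g ^ (-(p + 2 - 2 * e))) := by
    intro g
    refine (mul_le_mul_right (hle g) _).trans (le_of_eq ?_)
    rw [mul_left_comm, ← ENNReal.ofReal_mul (Real.rpow_nonneg (nrm_pos g).le _),
      ← Real.rpow_add (nrm_pos g)]
    congr 3
    ring
  refine (lintegral_mono hpt).trans_lt ?_
  rw [lintegral_const_mul _ (measurable_nrm.pow_const _).ennreal_ofReal]
  exact ENNReal.mul_lt_top hC.lt_top (lintegral_nrm_rpow_lt_top μ hep)

theorem one_le_nrm_mul_div (c g : SL2C) : 1 ≤ nrm g * nrm (c * g) / nrm c := by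
  rw [one_le_div (nrm_pos c)]
  have h := nrm_mul_le (c * g) g⁻¹
  rwa [mul_inv_cancel_right, nrm_inv, mul_comm] at h

/-- The base is at least `1`, so `p` can be lowered to some `p'` slightly above `2`. Then `nrm (c g)
^ (-p') ≤ spherical (c g)`, and the eigenfunction property turns the integral into `J · nrm c ^ p' ·
spherical c`. With `spherical_le` the exponent of `nrm c` becomes `p' - 2 + 2e`; of the allowed `δ`,
one half goes to `p' - 2` and one half to `2e`. -/
theorem lintegral_two_point_aux (μ : Measure SL2C) [μ.IsHaarMeasure] {p δ : ℝ} (hp : 2 < p)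
    (hδ : 0 < δ) :
    ∃ C : ℝ≥0∞, C ≠ ∞ ∧ ∀ c : SL2C,
      ∫⁻ g, ENNReal.ofReal ((nrm g * nrm (c * g) / nrm c) ^ (-p)) ∂μ ≤
        C * ENNReal.ofReal (nrm c ^ δ) := by
  set p' := min p (2 + δ / 2) with hp'
  have hp'2 : 2 < p' := lt_min hp (by linarith)
  have hp'p : p' ≤ p := min_le_left _ _
  have hp'd : p' ≤ 2 + δ / 2 := min_le_right _ _
  obtain ⟨e, he0, he2, hed⟩ : ∃ e : ℝ, 0 < e ∧ e < 2 ∧ 2 * e ≤ δ / 2 :=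
    ⟨min 1 (δ / 4), lt_min one_pos (by linarith), by linarith [min_le_left 1 (δ / 4)],
      by linarith [min_le_right 1 (δ / 4)]⟩
  obtain ⟨C, hC, hle⟩ := spherical_le he0 he2
  set J := ∫⁻ g, ENNReal.ofReal (nrm g ^ (-p')) * ‖rowMul spinorUp g‖ₑ ^ (-2 : ℝ) ∂μ with hJ
  have hJt : J < ∞ := lintegral_nrm_mul_rowMul_lt_top μ hp'2
  refine ⟨J * C, (ENNReal.mul_lt_top hJt hC.lt_top).ne, fun c => ?_⟩
  have hpt : ∀ g, ENNReal.ofReal ((nrm g * nrm (c * g) / nrm c) ^ (-p)) ≤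
      ENNReal.ofReal (nrm c ^ p') * (ENNReal.ofReal (nrm g ^ (-p')) * spherical (c * g)) := by
    intro g
    have hg := nrm_pos g
    have hcg := nrm_pos (c * g)
    have hc := nrm_pos c
    refine le_trans ?_ (mul_le_mul_right (mul_le_mul_right (nrm_rpow_le_spherical (c * g)) _) _)
    rw [← ENNReal.ofReal_mul (by positivity), ← ENNReal.ofReal_mul (by positivity)]
    refine ENNReal.ofReal_le_ofReal ?_
    calc (nrm g * nrm (c * g) / nrm c) ^ (-p) ≤ (nrm g * nrm (c * g) / nrm c) ^ (-p') :=
          Real.rpow_le_rpow_of_exponent_le (one_le_nrm_mul_div c g) (by linarith)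
      _ = nrm c ^ p' * (nrm g ^ (-p') * nrm (c * g) ^ (-p')) := by
          rw [Real.div_rpow (by positivity) hc.le, Real.mul_rpow hg.le hcg.le,
            Real.rpow_neg hc.le p', div_inv_eq_mul, mul_comm]
      _ ≤ _ := by
          refine mul_le_mul_of_nonneg_left (mul_le_mul_of_nonneg_left ?_ (by positivity))
            (by positivity)
          exact Real.rpow_le_rpow_of_exponent_le (one_le_nrm _) (by linarith)
  refine (lintegral_mono hpt).trans ?_
  rw [lintegral_const_mul, lintegral_nrm_mul_spherical]
  · calc _ ≤ ENNReal.ofReal (nrm c ^ p') *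
          (J * (C * ENNReal.ofReal (nrm c ^ (-2 + 2 * e)))) := by gcongr; exact hle c
      _ = J * C * ENNReal.ofReal (nrm c ^ (p' + (-2 + 2 * e))) := by
          rw [Real.rpow_add (nrm_pos c) p', ENNReal.ofReal_mul (Real.rpow_nonneg (nrm_pos c).le _)]
          ring
      _ ≤ _ := by
          gcongr
          · exact one_le_nrm c
          · linarith
  · exact (measurable_nrm.pow_const _).ennreal_ofReal.mul
      (measurable_spherical.comp (measurable_const_mul c))

/-- The integral over one group variable of a product of two kernels. -/
theorem lintegral_two_point (μ : Measure SL2C) [μ.IsHaarMeasure] {p δ : ℝ} (hp : 2 < p)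
    (hδ : 0 < δ) :
    ∃ C : ℝ≥0∞, C ≠ ∞ ∧ ∀ a b : SL2C,
      ∫⁻ g, ENNReal.ofReal ((nrm (a⁻¹ * g) * nrm (b⁻¹ * g) / nrm (a⁻¹ * b)) ^ (-p)) ∂μ ≤
        C * ENNReal.ofReal (nrm (a⁻¹ * b) ^ δ) := by
  obtain ⟨C, hC, hle⟩ := lintegral_two_point_aux μ hp hδ
  refine ⟨C, hC, fun a b => ?_⟩
  have h := hle (b⁻¹ * a)
  rw [nrm_inv_mul_comm b a] at h
  rw [← lintegral_mul_left_eq_self _ a]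
  simpa only [inv_mul_cancel_left, mul_assoc] using h

/-! ### Weighted cuts and splitting off a vertex -/

section Splitting

variable {ι : Type*} [Fintype ι] [DecidableEq ι]

/-- The total weight of the ordered pairs separated by `X`. -/
def cutWeight (w : ι → ι → ℝ) (X : Finset ι) : ℝ :=
  ∑ i, ∑ j, if (i ∈ X ↔ j ∈ X) then 0 else w i j

theorem cutWeight_compl (w : ι → ι → ℝ) (X : Finset ι) : cutWeight w Xᶜ = cutWeight w X := by
  simp only [cutWeight, Finset.mem_compl, not_iff_not]

theorem cutWeight_submodular {w : ι → ι → ℝ} (hw : ∀ i j, 0 ≤ w i j) (X Y : Finset ι) :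
    cutWeight w (X ∩ Y) + cutWeight w (X ∪ Y) ≤ cutWeight w X + cutWeight w Y := by
  simp only [cutWeight, ← Finset.sum_add_distrib]
  refine Finset.sum_le_sum fun i _ => Finset.sum_le_sum fun j _ => ?_
  have := hw i j
  by_cases h1 : i ∈ X <;> by_cases h2 : i ∈ Y <;> by_cases h3 : j ∈ X <;> by_cases h4 : j ∈ Y <;>
    simp [h1, h2, h3, h4] <;> linarith

/-- The inequality holds pair by pair. The pair `(u, z)` is separated by both sets on the right and
by neither on the left, which leaves room for the extra `2 * w u z`. -/
theorem cutWeight_posimodular {w : ι → ι → ℝ} (hw : ∀ i j, 0 ≤ w i j) {X Y : Finset ι} {u z : ι}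
    (huX : u ∈ X) (huY : u ∈ Y) (hzX : z ∉ X) (hzY : z ∉ Y) :
    cutWeight w (X \ Y) + cutWeight w (Y \ X) + 2 * w u z ≤ cutWeight w X + cutWeight w Y := by
  have h1 : 2 * w u z = ∑ i, ∑ j, if i = u ∧ j = z then 2 * w i j else 0 := by
    rw [Finset.sum_eq_single u (fun i _ hi => by simp [hi]) (by simp),
      Finset.sum_eq_single z (fun j _ hj => by simp [hj]) (by simp)]
    simp
  rw [h1]
  simp only [cutWeight, ← Finset.sum_add_distrib]
  refine Finset.sum_le_sum fun i _ => Finset.sum_le_sum fun j _ => ?_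
  have := hw i j
  by_cases h : i = u ∧ j = z
  · obtain ⟨rfl, rfl⟩ := h
    simp [huX, huY, hzX, hzY]
    linarith
  · rw [if_neg h]
    by_cases h1 : i ∈ X <;> by_cases h2 : i ∈ Y <;> by_cases h3 : j ∈ X <;> by_cases h4 : j ∈ Y <;>
      simp [h1, h2, h3, h4] <;> linarith

/-- The weights after the pairs `{i, z}`, `{j, z}` have been replaced by `{i, j}` with
multiplicity `t i j`. -/
def splitWeight (w t : ι → ι → ℝ) (z : ι) (i j : ι) : ℝ :=
  w i j + t i j - (if j = z then ∑ k, t i k else 0) - (if i = z then ∑ k, t j k else 0)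

/-- Replacing `{i, z}` and `{j, z}` by `{i, j}` changes a cut `X` that misses `z` only if `i` and
`j` both lie in `X`: then the removed pairs crossed it and the new one does not. The factor `2`
appears because a cut counts each pair in both orders. -/
theorem cutWeight_splitWeight (w : ι → ι → ℝ) {t : ι → ι → ℝ} {z : ι}
    (ht : ∀ i j, t i j = t j i) {X : Finset ι} (hz : z ∉ X) :
    cutWeight (splitWeight w t z) X = cutWeight w X - 2 * ∑ i ∈ X, ∑ j ∈ X, t i j := by
  have hA : ∀ f : ι → ι → ℝ, (∑ i, ∑ j, if (i ∈ X ↔ j ∈ X) then 0 else f i j) =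
      ∑ i ∈ X, ∑ j ∈ Xᶜ, f i j + ∑ j ∈ X, ∑ i ∈ Xᶜ, f i j := by
    intro f
    have h1 : ∀ i j, (if (i ∈ X ↔ j ∈ X) then 0 else f i j) =
        (if i ∈ X then (if j ∈ Xᶜ then f i j else 0) else 0) +
          (if j ∈ X then (if i ∈ Xᶜ then f i j else 0) else 0) := by
      intro i j
      by_cases h1 : i ∈ X <;> by_cases h2 : j ∈ X <;> simp [h1, h2]
    simp_rw [h1, Finset.sum_add_distrib]
    congr 1
    · rw [← Finset.sum_filter_add_sum_filter_not Finset.univ (· ∈ X)]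
      simp [Finset.sum_ite, Finset.filter_notMem_eq_sdiff, Finset.compl_eq_univ_sdiff]
    · rw [Finset.sum_comm]
      simp [Finset.sum_ite, Finset.filter_notMem_eq_sdiff, Finset.compl_eq_univ_sdiff]
  have hrow : ∀ i ∈ X, ∑ j ∈ Xᶜ, (splitWeight w t z i j) = ∑ j ∈ Xᶜ, w i j - ∑ j ∈ X, t i j := by
    intro i hi
    have hiz : i ≠ z := fun h => hz (h ▸ hi)
    have hzc : z ∈ Xᶜ := by simpa using hz
    simp only [splitWeight, if_neg hiz, sub_zero, Finset.sum_sub_distrib, Finset.sum_add_distrib,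
      Finset.sum_ite_eq', hzc, if_true]
    rw [← Finset.sum_add_sum_compl X (fun k => t i k)]
    ring
  have hcol : ∀ j ∈ X, ∑ i ∈ Xᶜ, (splitWeight w t z i j) = ∑ i ∈ Xᶜ, w i j - ∑ i ∈ X, t j i := by
    intro j hj
    have hjz : j ≠ z := fun h => hz (h ▸ hj)
    have hzc : z ∈ Xᶜ := by simpa using hz
    simp only [splitWeight, if_neg hjz, sub_zero, Finset.sum_sub_distrib, Finset.sum_add_distrib,
      Finset.sum_ite_eq', hzc, if_true]
    rw [← Finset.sum_add_sum_compl X (fun k => t j k)]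
    simp_rw [fun i => ht i j]
    ring
  unfold cutWeight
  rw [hA, hA, Finset.sum_congr rfl hrow, Finset.sum_congr rfl hcol, Finset.sum_sub_distrib,
    Finset.sum_sub_distrib]
  ring

/-- The set of admissible partial splittings at `z`: all cuts `X ∌ z` that do not separate the
points outside `s` keep weight at least `q`. -/
def splittings (w : ι → ι → ℝ) (s : Finset ι) (z : ι) (q : ℝ) : Set (ι → ι → ℝ) :=
  {t | (∀ i j, t i j = t j i) ∧ (∀ i j, 0 ≤ t i j) ∧ (∀ j, t z j = 0) ∧
    (∀ i, i ≠ z → ∑ j, t i j ≤ w i z) ∧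
    ∀ X : Finset ι, X.Nonempty → z ∉ X → insert z X ≠ Finset.univ → (sᶜ ⊆ X ∨ X ⊆ s) →
      q ≤ cutWeight (splitWeight w t z) X}

/-- The row constraints bound the entries and all conditions are closed. Compactness supplies an
admissible splitting of maximal total weight. -/
theorem isCompact_splittings (w : ι → ι → ℝ) (s : Finset ι) (z : ι) (q : ℝ) :
    IsCompact (splittings w s z q) := by
  have hK : IsCompact (Set.univ.pi fun i : ι => Set.univ.pi fun _ : ι =>
      Set.Icc (0 : ℝ) (if i = z then 0 else w i z)) :=
    isCompact_univ_pi fun _ => isCompact_univ_pi fun _ => isCompact_Icc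
  refine hK.of_isClosed_subset ?_ ?_
  · have hcont : ∀ X : Finset ι, Continuous fun t : ι → ι → ℝ =>
        cutWeight (splitWeight w t z) X := by
      intro X
      unfold cutWeight
      refine continuous_finsetSum _ fun i _ => continuous_finsetSum _ fun j _ => ?_
      split_ifs
      · exact continuous_const
      · unfold splitWeight
        split_ifs <;> fun_prop
    simp only [splittings, Set.ofPred_and, Set.ofPred_forall]
    refine IsClosed.inter ?_ (IsClosed.inter ?_ (IsClosed.inter ?_ (IsClosed.inter ?_ ?_)))
    · exact isClosed_iInter fun i => isClosed_iInter fun j =>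
        isClosed_eq (by fun_prop) (by fun_prop)
    · exact isClosed_iInter fun i => isClosed_iInter fun j =>
        isClosed_le (by fun_prop) (by fun_prop)
    · exact isClosed_iInter fun j => isClosed_eq (by fun_prop) (by fun_prop)
    · exact isClosed_iInter fun i => isClosed_iInter fun _ =>
        isClosed_le (by fun_prop) (by fun_prop)
    · exact isClosed_iInter fun X => isClosed_iInter fun _ => isClosed_iInter fun _ =>
        isClosed_iInter fun _ => isClosed_iInter fun _ => isClosed_le continuous_const (hcont X)
  · rintro t ⟨hsym, hnn, hz, hrow, -⟩ i _ j _
    refine ⟨hnn i j, ?_⟩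
    split_ifs with h
    · rw [h, hz]
    · exact (Finset.single_le_sum (f := fun j => t i j) (fun k _ => hnn i k)
        (Finset.mem_univ j)).trans (hrow i h)

/-- Without a tight set through `u` and `v`, a small multiple `ε χ` of the symmetric unit at `{u,
v}` could be added to `t`, against maximality. It costs `4 ε` in the cuts that contain both points.
The case `u = v`, the creation of a loop, is included; there the row sum grows by `2 ε`. -/
theorem exists_tight_of_isMaxOn {w t : ι → ι → ℝ} {s : Finset ι} {z : ι} {q : ℝ}
    (ht : t ∈ splittings w s z q)
    (hmax : ∀ t' ∈ splittings w s z q, ∑ i, ∑ j, t' i j ≤ ∑ i, ∑ j, t i j) {u v : ι}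
    (hu : u ≠ z) (hv : v ≠ z) (hru : ∑ j, t u j < w u z) (hrv : ∑ j, t v j < w v z) :
    ∃ X : Finset ι, u ∈ X ∧ v ∈ X ∧ z ∉ X ∧ insert z X ≠ Finset.univ ∧ (sᶜ ⊆ X ∨ X ⊆ s) ∧
      cutWeight (splitWeight w t z) X ≤ q := by
  by_contra! hno
  obtain ⟨hsym, hnn, hz, hrow, hcut⟩ := ht
  let χ : ι → ι → ℝ := fun i j => (if i = u ∧ j = v then 1 else 0) + (if i = v ∧ j = u then 1 else 0)
  have hχrow : ∀ i, ∑ j, χ i j = (if i = u then 1 else 0) + (if i = v then 1 else 0) := by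
    intro i
    simp only [χ, Finset.sum_add_distrib, ite_and]
    by_cases h1 : i = u <;> by_cases h2 : i = v <;> simp [h1, h2]
  have hχX : ∀ X : Finset ι, ∑ i ∈ X, ∑ j ∈ X, χ i j = if u ∈ X ∧ v ∈ X then 2 else 0 := by
    intro X
    simp only [χ, Finset.sum_add_distrib, ite_and]
    by_cases h1 : u ∈ X <;> by_cases h2 : v ∈ X <;> simp [h1, h2] <;> norm_num
  have hev : ∀ᶠ ε in 𝓝[>] (0 : ℝ), 0 < ε ∧ 2 * ε ≤ w u z - ∑ j, t u j ∧
      2 * ε ≤ w v z - ∑ j, t v j ∧ ∀ X ∈ (Finset.univ : Finset (Finset ι)), u ∈ X → v ∈ X → z ∉ X →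
        insert z X ≠ Finset.univ → (sᶜ ⊆ X ∨ X ⊆ s) →
        4 * ε ≤ cutWeight (splitWeight w t z) X - q := by
    have hsmall : ∀ {c : ℝ} (k : ℝ), 0 < c → ∀ᶠ ε in 𝓝[>] (0 : ℝ), k * ε ≤ c := by
      intro c k hc
      have : Tendsto (fun ε : ℝ => k * ε) (𝓝 0) (𝓝 (k * 0)) := by
        exact (continuous_const.mul continuous_id).tendsto 0
      rw [mul_zero] at this
      exact ((this.mono_left nhdsWithin_le_nhds).eventually (gt_mem_nhds hc)).mono fun _ h => h.le
    refine (eventually_mem_nhdsWithin.mono fun ε hε => hε).and ((hsmall 2 (by linarith)).and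
      ((hsmall 2 (by linarith)).and ?_))
    rw [Filter.eventually_all_finset]
    intro X _
    by_cases hX : u ∈ X ∧ v ∈ X ∧ z ∉ X ∧ insert z X ≠ Finset.univ ∧ (sᶜ ⊆ X ∨ X ⊆ s)
    · obtain ⟨h1, h2, h3, h4, h5⟩ := hX
      exact (hsmall 4 (sub_pos.2 (hno X h1 h2 h3 h4 h5))).mono fun _ h _ _ _ _ _ => h
    · exact Filter.Eventually.of_forall fun ε h1 h2 h3 h4 h5 => absurd ⟨h1, h2, h3, h4, h5⟩ hX
  obtain ⟨ε, hε, hεu, hεv, hεX⟩ := hev.exists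
  have hχnn : ∀ i j, 0 ≤ χ i j := fun i j => by
    simp only [χ]
    positivity
  have hχsym : ∀ i j, χ i j = χ j i := fun i j => by
    simp only [χ]
    rw [add_comm]
    simp only [and_comm]
  have hsym' : ∀ i j, t i j + ε * χ i j = t j i + ε * χ j i := fun i j => by rw [hsym, hχsym]
  have hmem : (fun i j => t i j + ε * χ i j) ∈ splittings w s z q := by
    refine ⟨hsym', fun i j => add_nonneg (hnn i j) (mul_nonneg hε.le (hχnn i j)), fun j => ?_,
      fun i hi => ?_, fun X hX hzX hXu hXs => ?_⟩
    · simp [χ, hz, hu.symm, hv.symm]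
    · rw [Finset.sum_add_distrib, ← Finset.mul_sum, hχrow]
      have := hrow i hi
      by_cases h1 : i = u <;> by_cases h2 : i = v
      · subst h1; subst h2; simp; linarith
      · subst h1; simp [h2]; linarith
      · subst h2; simp [h1]; linarith
      · simp [h1, h2, this]
    · rw [cutWeight_splitWeight w hsym' hzX]
      have h0 := hcut X hX hzX hXu hXs
      have h1 := hεX X (Finset.mem_univ _)
      rw [cutWeight_splitWeight w hsym hzX] at h0 h1
      simp_rw [Finset.sum_add_distrib, ← Finset.mul_sum]
      rw [hχX]
      split_ifs with h2
      · have := h1 h2.1 h2.2 hzX hXu hXs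
        linarith
      · linarith
  have h := hmax _ hmem
  simp_rw [Finset.sum_add_distrib, ← Finset.mul_sum] at h
  have h2 := hχX Finset.univ
  simp only [Finset.mem_univ, and_self, if_true] at h2
  rw [h2] at h
  linarith

/-- Splitting off: the edges at `z` can be replaced, in pairs, by edges between the other points
without decreasing the capacity of the cuts below `q`. -/
theorem exists_complete_splitting {w : ι → ι → ℝ} (hsym : ∀ i j, w i j = w j i)
    (hnn : ∀ i j, 0 ≤ w i j) {s : Finset ι} {o z : ι} (ho : o ∉ s) (hz : z ∈ s) {q : ℝ}
    (hcut : ∀ A ⊆ s, A.Nonempty → q ≤ cutWeight w A) :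
    ∃ t : ι → ι → ℝ, (∀ i j, 0 ≤ t i j) ∧ (∀ i j, t i j = t j i) ∧ (∀ j, t z j = 0) ∧
      (∀ i, i ≠ z → ∑ j, t i j = w i z) ∧
      ∀ A ⊆ s.erase z, A.Nonempty →
        q ≤ cutWeight (fun i j => if i = z ∨ j = z then 0 else w i j + t i j) A := by
  have hzero : (fun _ _ => 0 : ι → ι → ℝ) ∈ splittings w s z q := by
    refine ⟨fun _ _ => rfl, fun _ _ => le_rfl, fun _ => rfl, fun i _ => by simpa using hnn i z, ?_⟩
    intro X hX hzX hXu hXs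
    have h0 : splitWeight w (fun _ _ => 0) z = w := by
      ext i j
      simp [splitWeight]
    rw [h0]
    -- A set that contains `sᶜ` is replaced by its complement, which lies in `s` and contains `z`.
    rcases hXs with h | h
    · rw [← cutWeight_compl]
      refine hcut _ ?_ ⟨z, by simpa using hzX⟩
      intro i hi
      by_contra his
      exact (Finset.mem_compl.1 hi) (h (by simpa using his))
    · exact hcut X h hX
  have hcont : Continuous fun t : ι → ι → ℝ => ∑ i, ∑ j, t i j := by fun_prop
  obtain ⟨t, ht, htmax⟩ := (isCompact_splittings w s z q).exists_isMaxOn ⟨_, hzero⟩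
    hcont.continuousOn
  have hmax : ∀ t' ∈ splittings w s z q, ∑ i, ∑ j, t' i j ≤ ∑ i, ∑ j, t i j := fun t' h => htmax h
  have htight := fun {u v : ι} => exists_tight_of_isMaxOn ht hmax (u := u) (v := v)
  obtain ⟨tsym, tnn, tz, trow, tcut⟩ := ht
  have tz' : ∀ i, t i z = 0 := fun i => by rw [tsym, tz]
  have hSz : ∀ i, i ≠ z → splitWeight w t z i z = w i z - ∑ j, t i j := by
    intro i hi
    simp [splitWeight, hi, tz']
  have hzS : ∀ i, i ≠ z → splitWeight w t z z i = w i z - ∑ j, t i j := by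
    intro i hi
    simp [splitWeight, hi, tz, hsym z i]
  have hSnn : ∀ i j, 0 ≤ splitWeight w t z i j := by
    intro i j
    by_cases hi : i = z
    · subst hi
      by_cases hj : j = i
      · subst hj
        simpa [splitWeight, tz] using hnn j j
      · rw [hzS j hj]
        linarith [trow j hj]
    · by_cases hj : j = z
      · subst hj
        rw [hSz i hi]
        linarith [trow i hi]
      · simpa [splitWeight, hi, hj] using add_nonneg (hnn i j) (tnn i j)
  have hfull : ∀ u, u ≠ z → ∑ j, t u j = w u z := by
    intro u hu
    by_contra hne
    have hru : ∑ j, t u j < w u z := lt_of_le_of_ne (trow u hu) hne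
    -- Uncrossing argument: if weight is left between `u` and `z`, a tight set `M` through `u` of
    -- maximal cardinality contains every point with weight left towards `z`.
    let 𝒯 : Finset (Finset ι) := Finset.univ.filter fun X => u ∈ X ∧ z ∉ X ∧
      insert z X ≠ Finset.univ ∧ (sᶜ ⊆ X ∨ X ⊆ s) ∧ cutWeight (splitWeight w t z) X ≤ q
    have h𝒯 : ∀ X, X ∈ 𝒯 ↔ u ∈ X ∧ z ∉ X ∧
      insert z X ≠ Finset.univ ∧ (sᶜ ⊆ X ∨ X ⊆ s) ∧ cutWeight (splitWeight w t z) X ≤ q := by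
      intro X
      simp [𝒯]
    obtain ⟨X₀, hX₀, -, hX₀'⟩ := htight hu hu hru hru
    obtain ⟨M, hM, hMmax⟩ := Finset.exists_max_image 𝒯 Finset.card ⟨X₀, (h𝒯 _).2 ⟨hX₀, hX₀'⟩⟩
    obtain ⟨huM, hzM, hMu, hMs, hMq⟩ := (h𝒯 _).1 hM
    have hcov : ∀ v, v ≠ z → ∑ j, t v j < w v z → v ∈ M := by
      intro v hv hrv
      obtain ⟨Y, huY, hvY, hzY, hYu, hYs, hYq⟩ := htight hu hv hru hrv
      -- If `M`, `Y` and `z` covered everything, posimodularity would bound two cuts of weight at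
      -- least `q`, plus twice the positive weight left at `u`, by `2q`.
      have hXY : insert z (M ∪ Y) ≠ Finset.univ := by
        intro hun
        have hMY : (M \ Y).Nonempty := by
          rw [Finset.nonempty_iff_ne_empty]
          intro h0
          apply hYu
          rwa [Finset.union_eq_right.2 (Finset.sdiff_eq_empty_iff_subset.1 h0)] at hun
        have hYM : (Y \ M).Nonempty := by
          rw [Finset.nonempty_iff_ne_empty]
          intro h0
          apply hMu
          rwa [Finset.union_eq_left.2 (Finset.sdiff_eq_empty_iff_subset.1 h0)] at hun
        have key := cutWeight_posimodular hSnn huM huY hzM hzY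
        have hgood : ∀ P Q : Finset ι, u ∈ P → u ∈ Q → z ∉ P → (P \ Q).Nonempty →
            (sᶜ ⊆ P ∨ P ⊆ s) → (sᶜ ⊆ Q ∨ Q ⊆ s) →
            q ≤ cutWeight (splitWeight w t z) (P \ Q) := by
          intro P Q huP huQ hzP hne hP hQ
          refine tcut _ hne (fun h => hzP (Finset.mem_sdiff.1 h).1) ?_ ?_
          · intro h
            have := h.symm ▸ Finset.mem_univ u
            rcases Finset.mem_insert.1 this with h | h
            · exact hu h
            · exact (Finset.mem_sdiff.1 h).2 huQ
          · rcases hP with hP | hP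
            · rcases hQ with hQ | hQ
              · right
                intro i hi
                by_contra his
                exact (Finset.mem_sdiff.1 hi).2 (hQ (by simpa using his))
              · left
                intro i hi
                exact Finset.mem_sdiff.2 ⟨hP hi, fun h => (Finset.mem_compl.1 hi) (hQ h)⟩
            · right
              exact Finset.sdiff_subset.trans hP
        have k1 := hgood M Y huM huY hzM hMY hMs hYs
        have k2 := hgood Y M huY huM hzY hYM hYs hMs
        rw [hSz u hu] at key
        linarith
      -- The intersection has weight at least `q`, so submodularity makes the union tight, and
      -- maximality of `M` gives `Y ⊆ M`.
      have hmem : M ∪ Y ∈ 𝒯 := by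
        rw [h𝒯]
        refine ⟨Finset.mem_union_left _ huM, by simp [hzM, hzY], hXY, ?_, ?_⟩
        · rcases hMs with h | h
          · exact Or.inl (h.trans Finset.subset_union_left)
          · rcases hYs with h' | h'
            · exact Or.inl (h'.trans Finset.subset_union_right)
            · exact Or.inr (Finset.union_subset h h')
        · have key := cutWeight_submodular hSnn M Y
          have k1 : q ≤ cutWeight (splitWeight w t z) (M ∩ Y) := by
            refine tcut _ ⟨u, Finset.mem_inter.2 ⟨huM, huY⟩⟩ (fun h => hzM (Finset.mem_inter.1 h).1)
              ?_ ?_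
            · intro h
              apply hMu
              rw [Finset.eq_univ_iff_forall] at h ⊢
              intro i
              exact Finset.insert_subset_insert z Finset.inter_subset_left (h i)
            · rcases hMs with h | h
              · rcases hYs with h' | h'
                · exact Or.inl (Finset.subset_inter h h')
                · exact Or.inr (Finset.inter_subset_right.trans h')
              · exact Or.inr (Finset.inter_subset_left.trans h)
          linarith
      have hcard := hMmax _ hmem
      have : M = M ∪ Y := Finset.eq_of_subset_of_card_le Finset.subset_union_left hcard
      rw [this]
      exact Finset.mem_union_right _ hvY
    have hB : q ≤ cutWeight (splitWeight w t z) (insert z M)ᶜ := by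
      refine tcut _ ?_ (by simp) ?_ ?_
      · rw [Finset.nonempty_iff_ne_empty, Ne, Finset.compl_eq_empty_iff]
        exact hMu
      · intro h
        have := h.symm ▸ Finset.mem_univ u
        simp [hu, huM] at this
      · rcases hMs with h | h
        · right
          intro i hi
          by_contra his
          exact (Finset.mem_compl.1 hi) (Finset.mem_insert_of_mem (h (by simpa using his)))
        · left
          refine Finset.compl_subset_compl.2 (Finset.insert_subset hz h)
    -- All weight left at `z` leads into `M`, so moving `z` to the side of `M` lowers the cut by at
    -- least the weight left at `u`. The result lies below `q`, against `hB`.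
    have hlt : cutWeight (splitWeight w t z) (insert z M)ᶜ + splitWeight w t z u z ≤
        cutWeight (splitWeight w t z) M := by
      have h1 : splitWeight w t z u z =
          ∑ i, ∑ j, if i = u ∧ j = z then splitWeight w t z i j else 0 := by
        rw [Finset.sum_eq_single u (fun i _ hi => by simp [hi]) (by simp),
          Finset.sum_eq_single z (fun j _ hj => by simp [hj]) (by simp)]
        simp
      rw [h1]
      simp only [cutWeight, ← Finset.sum_add_distrib]
      refine Finset.sum_le_sum fun i _ => Finset.sum_le_sum fun j _ => ?_
      have hnonneg := hSnn i j
      by_cases h : i = u ∧ j = z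
      · obtain ⟨rfl, rfl⟩ := h
        simp [huM, hzM]
      · rw [if_neg h, add_zero]
        by_cases hi : i = z
        · subst hi
          by_cases hj : j = i
          · subst hj; simp
          · by_cases hjM : j ∈ M
            · simpa [hjM, hzM] using hnonneg
            · have h0 : splitWeight w t i i j = 0 := by
                rw [hzS j hj]
                by_contra h0
                exact hjM (hcov j hj (lt_of_le_of_ne (trow j hj) fun h' => h0 (by rw [h', sub_self])))
              simp [h0]
        · by_cases hj : j = z
          · subst hj
            by_cases hiM : i ∈ M
            · simpa [hiM, hzM] using hnonneg
            · have h0 : splitWeight w t j i j = 0 := by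
                rw [hSz i hi]
                by_contra h0
                exact hiM (hcov i hi (lt_of_le_of_ne (trow i hi) fun h' => h0 (by rw [h', sub_self])))
              simp [h0]
          · simp [hi, hj, not_iff_not]
    rw [hSz u hu] at hlt
    linarith
  refine ⟨t, tnn, tsym, tz, hfull, fun A hA hne => ?_⟩
  have hzA : z ∉ A := fun h => by simpa using hA h
  have hoz : o ≠ z := fun h => ho (h ▸ hz)
  have hAs : A ⊆ s := hA.trans (Finset.erase_subset _ _)
  have h1 := tcut A hne hzA (fun h => by
    have := h.symm ▸ Finset.mem_univ o
    rcases Finset.mem_insert.1 this with h | h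
    · exact hoz h
    · exact ho (hAs h)) (Or.inr hAs)
  refine h1.trans (le_of_eq ?_)
  unfold cutWeight
  refine Finset.sum_congr rfl fun i _ => Finset.sum_congr rfl fun j _ => ?_
  by_cases hi : i = z
  · subst hi
    by_cases hj : j = i
    · subst hj; simp
    · rw [hzS j hj, hfull j hj]; simp
  · by_cases hj : j = z
    · subst hj
      rw [hSz i hi, hfull i hi]; simp
    · simp [splitWeight, hi, hj]

end Splitting

/-! ### Integrability of kernels on highly connected graphs -/

section Kernel

variable {I : Type}

/-- The group variables with the root `none` fixed at `1`. -/
def rooted (y : I → SL2C) (o : Option I) : SL2C := o.elim 1 y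

/-- The logarithm of the norm of the relative holonomy of two points. -/
def logDist (y : I → SL2C) (a b : Option I) : ℝ := Real.log (nrm ((rooted y a)⁻¹ * rooted y b))

variable [DecidableEq I] in
theorem rooted_update (y : I → SL2C) (i : I) (g : SL2C) {a : Option I} (ha : a ≠ some i) :
    rooted (Function.update y i g) a = rooted y a := by
  rcases a with _ | j
  · rfl
  · exact Function.update_of_ne (fun h => ha (congrArg some h)) _ _

variable [DecidableEq I] in
theorem rooted_update_self (y : I → SL2C) (i : I) (g : SL2C) :
    rooted (Function.update y i g) (some i) = g := Function.update_self _ _ _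

theorem logDist_nonneg (y : I → SL2C) (a b : Option I) : 0 ≤ logDist y a b :=
  Real.log_nonneg (one_le_nrm _)

theorem logDist_comm (y : I → SL2C) (a b : Option I) : logDist y a b = logDist y b a := by
  rw [logDist, nrm_inv_mul_comm, logDist]

theorem logDist_triangle (y : I → SL2C) (a b c : Option I) :
    logDist y a c ≤ logDist y a b + logDist y b c := by
  unfold logDist
  rw [← Real.log_mul (nrm_pos _).ne' (nrm_pos _).ne']
  exact Real.log_le_log (nrm_pos _) (nrm_inv_mul_le _ _ _)

theorem continuous_logDist (a b : Option I) : Continuous fun y : I → SL2C => logDist y a b := by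
  have h : ∀ o : Option I, Continuous fun y : I → SL2C => rooted y o := by
    rintro (_ | i)
    · exact continuous_const
    · exact continuous_apply i
  unfold logDist
  exact (continuous_nrm.comp ((h a).inv.mul (h b))).log fun y => (nrm_pos _).ne'

variable [Fintype I]

/-- The energy `∑ w a b * logDist a b`. -/
def energy (w : Option I → Option I → ℝ) (y : I → SL2C) : ℝ := ∑ a, ∑ b, w a b * logDist y a b

theorem continuous_energy (w : Option I → Option I → ℝ) : Continuous (energy w) := by
  unfold energy
  exact continuous_finsetSum _ fun a _ => continuous_finsetSum _ fun b _ =>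
    continuous_const.mul (continuous_logDist a b)

theorem energy_nonneg {w : Option I → Option I → ℝ} (hw : ∀ a b, 0 ≤ w a b) (y : I → SL2C) :
    0 ≤ energy w y :=
  Finset.sum_nonneg fun a _ => Finset.sum_nonneg fun b _ => mul_nonneg (hw a b) (logDist_nonneg y a b)

theorem term_le_energy {w : Option I → Option I → ℝ} (hw : ∀ a b, 0 ≤ w a b) (y : I → SL2C)
    (a b : Option I) : w a b * logDist y a b ≤ energy w y :=
  (Finset.single_le_sum (f := fun b => w a b * logDist y a b)
    (fun c _ => mul_nonneg (hw a c) (logDist_nonneg y a c)) (Finset.mem_univ b)).trans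
  (Finset.single_le_sum (f := fun a => ∑ b, w a b * logDist y a b)
    (fun c _ => Finset.sum_nonneg fun b _ => mul_nonneg (hw c b) (logDist_nonneg y c b))
      (Finset.mem_univ a))

variable [DecidableEq I]

/-- The points in play while the variables in `s` are integrated. -/
def activePoints (s : Finset I) : Finset (Option I) := Finset.insertNone s

/-- If all cuts are positive, the energy controls every distance. -/
theorem exists_logDist_le_energy {w : Option I → Option I → ℝ} (hsym : ∀ a b, w a b = w b a)
    (hw : ∀ a b, 0 ≤ w a b) {s : Finset I} {q : ℝ} (hq : 0 < q)
    (hcut : ∀ A ⊆ s.map Function.Embedding.some, A.Nonempty → q ≤ cutWeight w A)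
    (hsupp : ∀ i ∉ s, ∀ b, w (some i) b = 0) :
    ∃ c : ℝ, 0 < c ∧ ∀ y, ∀ a ∈ activePoints s, ∀ b ∈ activePoints s,
      logDist y a b ≤ c * (energy w y + 1) := by
  classical
  have hsupp' : ∀ a ∉ activePoints s, ∀ b, w a b = 0 := by
    rintro (_ | i) ha b
    · exact absurd (by simp [activePoints]) ha
    · exact hsupp i (fun h => ha (by simpa [activePoints] using h)) b
  -- `P` collects the points whose distance from the root is controlled by the energy. It spreads
  -- along positive weights, so active points outside `P` would form a cut of weight zero. The `+ 1`
  -- is needed because `logDist y a a` is `log √2`, not `0`.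
  let P : Option I → Prop := fun a => ∃ c : ℝ, 0 ≤ c ∧ ∀ y, logDist y none a ≤ c * (energy w y + 1)
  have hP0 : P none := by
    refine ⟨logDist (fun _ : I => (1 : SL2C)) none none, logDist_nonneg _ _ _, fun y => ?_⟩
    have h1 : logDist y none none = logDist (fun _ : I => (1 : SL2C)) none none := rfl
    rw [h1]
    have := energy_nonneg hw y
    nlinarith [logDist_nonneg (fun _ : I => (1 : SL2C)) none none]
  have hPstep : ∀ a b, P a → 0 < w a b → P b := by
    rintro a b ⟨c, hc, h⟩ hab
    refine ⟨c + (w a b)⁻¹, by positivity, fun y => ?_⟩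
    have h1 := term_le_energy hw y a b
    have h2 : logDist y a b ≤ (w a b)⁻¹ * energy w y := by
      rw [← div_eq_inv_mul, le_div_iff₀ hab, mul_comm]
      exact h1
    have h3 := logDist_triangle y none a b
    have h4 := h y
    have h5 : 0 < (w a b)⁻¹ := inv_pos.2 hab
    nlinarith
  have hPall : ∀ a ∈ activePoints s, P a := by
    by_contra! hno
    obtain ⟨a₀, ha₀, hPa₀⟩ := hno
    let A : Finset (Option I) := (activePoints s).filter fun a => ¬ P a
    have hA : A ⊆ s.map Function.Embedding.some := by
      intro a ha
      obtain ⟨ha1, ha2⟩ := Finset.mem_filter.1 ha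
      rcases a with _ | i
      · exact absurd hP0 ha2
      · simpa [activePoints] using ha1
    have h1 := hcut A hA ⟨a₀, Finset.mem_filter.2 ⟨ha₀, hPa₀⟩⟩
    have h2 : cutWeight w A = 0 := by
      refine Finset.sum_eq_zero fun a _ => Finset.sum_eq_zero fun b _ => ?_
      have key : ∀ a b, a ∈ A → b ∉ A → w a b = 0 := by
        intro a b ha hb
        by_contra hne
        have hpos : 0 < w a b := lt_of_le_of_ne (hw a b) (Ne.symm hne)
        have hbact : b ∈ activePoints s := by
          by_contra hb'
          exact hne (by rw [hsym, hsupp' b hb' a])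
        have hPb : P b := by
          by_contra hPb
          exact hb (Finset.mem_filter.2 ⟨hbact, hPb⟩)
        exact (Finset.mem_filter.1 ha).2 (hPstep b a hPb (by rwa [hsym]))
      split_ifs with h
      · rfl
      · by_cases ha : a ∈ A
        · exact key a b ha fun hb => h ⟨fun _ => hb, fun _ => ha⟩
        · have hb : b ∈ A := by
            by_contra hb
            exact h ⟨fun h' => absurd h' ha, fun h' => absurd h' hb⟩
          rw [hsym]
          exact key b a hb ha
    linarith
  choose! c hc hle using hPall
  refine ⟨2 * ∑ a ∈ activePoints s, c a + 1, ?_, fun y a ha b hb => ?_⟩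
  · have : 0 ≤ ∑ a ∈ activePoints s, c a := Finset.sum_nonneg fun a ha => hc a ha
    linarith
  · have h1 := logDist_triangle y a none b
    rw [logDist_comm y a none] at h1
    have hE : 0 ≤ energy w y + 1 := by linarith [energy_nonneg hw y]
    have h2 : ∀ a ∈ activePoints s,
        logDist y none a ≤ (∑ a ∈ activePoints s, c a) * (energy w y + 1) := fun a ha =>
      (hle a ha y).trans (mul_le_mul_of_nonneg_right
        (Finset.single_le_sum (f := c) (fun a ha => hc a ha) ha) hE)
    have h3 := h2 a ha
    have h4 := h2 b hb
    nlinarith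

/-- Elimination of the point `some i` in the energy. -/
theorem energy_ge_of_splitting {w t : Option I → Option I → ℝ} (hsym : ∀ a b, w a b = w b a)
    (hw : ∀ a b, 0 ≤ w a b) {i : I} (ht : ∀ a b, t a b = t b a) (htz : ∀ b, t (some i) b = 0)
    (hrow : ∀ a, a ≠ some i → ∑ b, t a b = w a (some i)) (y : I → SL2C) (g : SL2C) :
    energy (fun a b => if a = some i ∨ b = some i then 0 else w a b + t a b) y +
      ∑ a, ∑ b, t a b * (logDist (Function.update y i g) a (some i) +
        logDist (Function.update y i g) b (some i) - logDist (Function.update y i g) a b) ≤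
      energy w (Function.update y i g) := by
  set y' := Function.update y i g
  set z : Option I := some i
  have htz' : ∀ a, t a z = 0 := fun a => by rw [ht, htz]
  have hL : ∀ a b, a ≠ z → b ≠ z → logDist y a b = logDist y' a b := by
    intro a b ha hb
    rw [logDist, logDist, rooted_update y i g ha, rooted_update y i g hb]
  have e1 : energy (fun a b => if a = z ∨ b = z then 0 else w a b + t a b) y =
      ∑ a, ∑ b, (if a = z ∨ b = z then 0 else w a b * logDist y' a b) +
        ∑ a, ∑ b, t a b * logDist y' a b := by
    simp only [energy, ← Finset.sum_add_distrib]
    refine Finset.sum_congr rfl fun a _ => Finset.sum_congr rfl fun b _ => ?_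
    by_cases ha : a = z
    · simp [ha, htz]
    · by_cases hb : b = z
      · simp [hb, htz']
      · simp only [ha, hb, or_self, if_false]
        rw [hL a b ha hb]
        ring
  have hrow' : ∀ a, (∑ b, t a b) = if a = z then 0 else w a z := by
    intro a
    split_ifs with ha
    · simp [ha, htz]
    · exact hrow a ha
  have e2 : ∑ a, ∑ b, t a b * (logDist y' a z + logDist y' b z - logDist y' a b) =
      ∑ a, (if a = z then 0 else w a z * logDist y' a z) +
        ∑ b, (if b = z then 0 else w b z * logDist y' b z) -
          ∑ a, ∑ b, t a b * logDist y' a b := by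
    have h1 : ∑ a, ∑ b, t a b * logDist y' a z =
        ∑ a, (if a = z then 0 else w a z * logDist y' a z) := by
      refine Finset.sum_congr rfl fun a _ => ?_
      rw [← Finset.sum_mul, hrow']
      split_ifs <;> simp
    have h2 : ∑ a, ∑ b, t a b * logDist y' b z =
        ∑ b, (if b = z then 0 else w b z * logDist y' b z) := by
      rw [Finset.sum_comm, ← h1]
      refine Finset.sum_congr rfl fun a _ => Finset.sum_congr rfl fun b _ => ?_
      rw [ht]
    simp only [mul_sub, mul_add, Finset.sum_sub_distrib, Finset.sum_add_distrib]
    rw [h1, h2]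
  rw [e1, e2]
  have e3 : ∑ a, (if a = z then 0 else w a z * logDist y' a z) =
      ∑ a, ∑ b, (if a ≠ z ∧ b = z then w a b * logDist y' a b else 0) := by
    refine Finset.sum_congr rfl fun a _ => ?_
    rw [Finset.sum_eq_single z (fun b _ hb => by simp [hb]) (by simp)]
    by_cases ha : a = z <;> simp [ha]
  have e4 : ∑ b, (if b = z then 0 else w b z * logDist y' b z) =
      ∑ a, ∑ b, (if a = z ∧ b ≠ z then w a b * logDist y' a b else 0) := by
    rw [Finset.sum_comm]
    refine Finset.sum_congr rfl fun b _ => ?_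
    rw [Finset.sum_eq_single z (fun a _ ha => by simp [ha]) (by simp)]
    by_cases hb : b = z
    · simp [hb]
    · simp only [hb, if_false, ne_eq, not_false_eq_true, and_self, if_true]
      rw [hsym, logDist_comm]
  -- Only the diagonal term at `z` is dropped; it is the sole reason for an inequality.
  have e5 : ∑ a, ∑ b, (if a = z ∨ b = z then 0 else w a b * logDist y' a b) +
      (∑ a, ∑ b, (if a ≠ z ∧ b = z then w a b * logDist y' a b else 0) +
        ∑ a, ∑ b, (if a = z ∧ b ≠ z then w a b * logDist y' a b else 0)) ≤ energy w y' := by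
    simp only [energy, ← Finset.sum_add_distrib]
    refine Finset.sum_le_sum fun a _ => Finset.sum_le_sum fun b _ => ?_
    have := mul_nonneg (hw a b) (logDist_nonneg y' a b)
    by_cases ha : a = z <;> by_cases hb : b = z <;> simp [ha, hb] <;> simp_all
  linarith [e3, e4, e5]

end Kernel

/-! ### Elimination of one group variable from a kernel -/

theorem nrm_mul_div_nonneg (a b c : SL2C) : 0 ≤ nrm a * nrm b / nrm c :=
  div_nonneg (mul_nonneg (nrm_pos a).le (nrm_pos b).le) (nrm_pos c).le

section Kernel

variable {I : Type} [Fintype I] [DecidableEq I]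

theorem cutWeight_smul (κ : ℝ) (w : Option I → Option I → ℝ) (A : Finset (Option I)) :
    cutWeight (fun a b => κ * w a b) A = κ * cutWeight w A := by
  simp only [cutWeight, Finset.mul_sum, mul_ite, mul_zero]

theorem cutWeight_singleton {w : Option I → Option I → ℝ} (hsym : ∀ a b, w a b = w b a)
    (z : Option I) : cutWeight w {z} = 2 * ∑ a, if a = z then 0 else w a z := by
  have h1 : cutWeight w {z} = ∑ a, ∑ b, ((if b = z then (if a = z then 0 else w a b) else 0) +
      (if a = z then (if b = z then 0 else w a b) else 0)) := by
    refine Finset.sum_congr rfl fun a _ => Finset.sum_congr rfl fun b _ => ?_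
    by_cases ha : a = z <;> by_cases hb : b = z <;> simp [ha, hb]
  rw [h1]
  simp only [Finset.sum_add_distrib, Finset.sum_ite_eq', Finset.mem_univ, if_true]
  rw [Finset.sum_comm (f := fun a b => if a = z then (if b = z then 0 else w a b) else 0)]
  simp only [Finset.sum_ite_eq', Finset.mem_univ, if_true, hsym z]
  ring

theorem exp_neg_logDist_defect (y : I → SL2C) (i : I) (g : SL2C) {a b : Option I}
    (ha : a ≠ some i) (hb : b ≠ some i) (p : ℝ) :
    Real.exp (-(p * (logDist (Function.update y i g) a (some i) +
        logDist (Function.update y i g) b (some i) - logDist (Function.update y i g) a b))) =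
      (nrm ((rooted y a)⁻¹ * g) * nrm ((rooted y b)⁻¹ * g) /
        nrm ((rooted y a)⁻¹ * rooted y b)) ^ (-p) := by
  have e1 : ∀ c, c ≠ some i → logDist (Function.update y i g) c (some i) =
      Real.log (nrm ((rooted y c)⁻¹ * g)) := fun c hc => by
    rw [logDist, rooted_update y i g hc, rooted_update_self]
  have e2 : logDist (Function.update y i g) a b =
      Real.log (nrm ((rooted y a)⁻¹ * rooted y b)) := by
    rw [logDist, rooted_update y i g ha, rooted_update y i g hb]
  rw [e1 a ha, e1 b hb, e2]
  have h1 := nrm_pos ((rooted y a)⁻¹ * g)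
  have h2 := nrm_pos ((rooted y b)⁻¹ * g)
  have h3 := nrm_pos ((rooted y a)⁻¹ * rooted y b)
  revert h1 h2 h3
  generalize nrm ((rooted y a)⁻¹ * g) = r₁
  generalize nrm ((rooted y b)⁻¹ * g) = r₂
  generalize nrm ((rooted y a)⁻¹ * rooted y b) = r₃
  intro h1 h2 h3
  rw [Real.rpow_def_of_pos (by positivity), Real.log_div (by positivity) h3.ne',
    Real.log_mul h1.ne' h2.ne']
  congr 1
  ring

/-- The smallest `x a` satisfies `p * x a ≤ ∑ t x`. A product of many two-point kernels of total
exponent at least `p` is thereby bounded by a sum of single kernels of exponent `p`. -/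
theorem exp_neg_sum_le {α : Type*} (u : Finset α) (t x : α → ℝ) {p : ℝ} (hp : 0 < p)
    (ht : ∀ a ∈ u, 0 ≤ t a) (hx : ∀ a ∈ u, 0 ≤ x a) (hsum : p ≤ ∑ a ∈ u, t a) :
    Real.exp (-∑ a ∈ u, t a * x a) ≤ ∑ a ∈ u, Real.exp (-(p * x a)) := by
  have hne : u.Nonempty := by
    by_contra h
    rw [Finset.not_nonempty_iff_eq_empty.1 h, Finset.sum_empty] at hsum
    linarith
  obtain ⟨a₀, ha₀, hmin⟩ := u.exists_min_image x hne
  have h1 : p * x a₀ ≤ ∑ a ∈ u, t a * x a := by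
    calc p * x a₀ ≤ (∑ a ∈ u, t a) * x a₀ := mul_le_mul_of_nonneg_right hsum (hx a₀ ha₀)
      _ = ∑ a ∈ u, t a * x a₀ := Finset.sum_mul _ _ _
      _ ≤ _ := Finset.sum_le_sum fun a ha => mul_le_mul_of_nonneg_left (hmin a ha) (ht a ha)
  exact (Real.exp_le_exp.2 (neg_le_neg h1)).trans
    (Finset.single_le_sum (f := fun a => Real.exp (-(p * x a))) (fun _ _ => (Real.exp_pos _).le) ha₀)

/-- Integrating out one point of a kernel all of whose cuts are larger than `4`. -/
theorem lintegral_exp_neg_energy_update (μ : Measure SL2C) [μ.IsHaarMeasure]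
    {w : Option I → Option I → ℝ} (hsym : ∀ a b, w a b = w b a) (hw : ∀ a b, 0 ≤ w a b)
    {s : Finset I} {i : I} (hi : i ∈ s) {q : ℝ} (hq : 4 < q)
    (hcut : ∀ A ⊆ s.map Function.Embedding.some, A.Nonempty → q ≤ cutWeight w A)
    (hsupp : ∀ i ∉ s, ∀ b, w (some i) b = 0) :
    ∃ (w' : Option I → Option I → ℝ) (q' : ℝ) (C : ℝ≥0∞), (∀ a b, w' a b = w' b a) ∧
      (∀ a b, 0 ≤ w' a b) ∧ 4 < q' ∧
      (∀ A ⊆ (s.erase i).map Function.Embedding.some, A.Nonempty → q' ≤ cutWeight w' A) ∧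
      (∀ j ∉ s.erase i, ∀ b, w' (some j) b = 0) ∧ C ≠ ∞ ∧
      ∀ y, ∫⁻ g, ENNReal.ofReal (Real.exp (-energy w (Function.update y i g))) ∂μ ≤
        C * ENNReal.ofReal (Real.exp (-energy w' y)) := by
  obtain ⟨c, hc, hdist⟩ := exists_logDist_le_energy hsym hw (by linarith : 0 < q) hcut hsupp
  set z : Option I := some i with hz
  -- A fraction `κ` of the energy is set aside to pay for the loss `nrm ^ δ` in the two-point
  -- estimate. The cuts of the remaining weights are at least `(1 - κ) q = (q + 4)/2`, still above
  -- `4`.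
  set κ : ℝ := (q - 4) / (2 * q) with hκdef
  have hq0 : 0 < q := by linarith
  have hκ : 0 < κ := div_pos (by linarith) (by linarith)
  have hκq : (1 - κ) * q = (q + 4) / 2 := by
    rw [hκdef]
    field_simp
    ring
  have hκ1 : 0 < 1 - κ := by
    by_contra h
    nlinarith
  set q₁ : ℝ := (q + 4) / 2
  have hq₁ : 4 < q₁ := by simp only [q₁]; linarith
  set w₁ : Option I → Option I → ℝ := fun a b => (1 - κ) * w a b with hw₁
  have hsym₁ : ∀ a b, w₁ a b = w₁ b a := fun a b => by simp only [hw₁, hsym a b]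
  have hnn₁ : ∀ a b, 0 ≤ w₁ a b := fun a b => mul_nonneg hκ1.le (hw a b)
  have hcut₁ : ∀ A ⊆ s.map Function.Embedding.some, A.Nonempty → q₁ ≤ cutWeight w₁ A := by
    intro A hA hA'
    rw [hw₁, cutWeight_smul, ← hκq]
    exact mul_le_mul_of_nonneg_left (hcut A hA hA') hκ1.le
  have hzs : z ∈ s.map Function.Embedding.some := by simpa [hz] using hi
  obtain ⟨t, ht0, hts, htz, hrow, htcut⟩ :=
    exists_complete_splitting hsym₁ hnn₁ (o := none) (by simp) hzs hcut₁
  have hrow' : ∀ a, (∑ b, t a b) = if a = z then 0 else w₁ a z := by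
    intro a
    split_ifs with ha
    · simp [ha, htz]
    · exact hrow a ha
  set p := q₁ / 2
  have hp2 : 2 < p := by simp only [p]; linarith
  -- The cut `{z}` counts each edge at `z` twice, so the new edges have total weight at least `q₁ /
  -- 2 > 2`, the exponent that `lintegral_two_point` requires.
  have hpT : p ≤ ∑ a, ∑ b, t a b := by
    have h1 := hcut₁ {z} (by simpa using hzs) ⟨z, by simp⟩
    rw [cutWeight_singleton hsym₁] at h1
    simp only [hrow', p]
    linarith
  have htsupp : ∀ j ∉ s, ∀ b, t (some j) b = 0 := by
    intro j hj b
    have h1 : ∑ b, t (some j) b = 0 := by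
      rw [hrow']
      split_ifs
      · rfl
      · simp [hw₁, hsupp j hj]
    exact (Finset.sum_eq_zero_iff_of_nonneg fun b _ => ht0 _ b).1 h1 b (Finset.mem_univ b)
  -- With this choice the distance bound gives `exp (-κ energy) ≤ exp κ * nrm (a⁻¹ b) ^ (-δ)`, which
  -- cancels the growth in the two-point estimate.
  set δ := κ / c with hδ
  have hδ0 : 0 < δ := div_pos hκ hc
  obtain ⟨C, hC, hCle⟩ := lintegral_two_point μ hp2 hδ0
  set P : Finset (Option I × Option I) :=
    ((activePoints s).erase z) ×ˢ ((activePoints s).erase z) with hP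
  refine ⟨fun a b => if a = z ∨ b = z then 0 else w₁ a b + t a b, q₁,
    (P.card : ℝ≥0∞) * (ENNReal.ofReal (Real.exp κ) * C), ?_, ?_, hq₁, ?_, ?_, ?_, fun y => ?_⟩
  · intro a b
    simp only [hsym₁ a b, hts a b, or_comm]
  · intro a b
    dsimp only
    split_ifs
    · exact le_rfl
    · exact add_nonneg (hnn₁ _ _) (ht0 _ _)
  · intro A hA hA'
    refine htcut A ?_ hA'
    rwa [Finset.map_erase] at hA
  · intro j hj b
    dsimp only
    split_ifs with h
    · rfl
    · have hjs : j ∉ s := fun h' => hj (Finset.mem_erase.2 ⟨fun h2 => h (Or.inl (by rw [h2])), h'⟩)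
      rw [htsupp j hjs b]
      simp [hw₁, hsupp j hjs]
  · exact ENNReal.mul_ne_top (ENNReal.natCast_ne_top _) (ENNReal.mul_ne_top ENNReal.ofReal_ne_top hC)
  set w' : Option I → Option I → ℝ := fun a b => if a = z ∨ b = z then 0 else w₁ a b + t a b
  have hPne : ∀ ab ∈ P, ab.1 ≠ z ∧ ab.2 ≠ z ∧ ab.1 ∈ activePoints s ∧ ab.2 ∈ activePoints s := by
    intro ab hab
    simp only [hP, Finset.mem_product, Finset.mem_erase] at hab
    tauto
  have htP : ∀ ab ∉ P, t ab.1 ab.2 = 0 := by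
    have h0 : ∀ a b, a ∉ (activePoints s).erase z → t a b = 0 := by
      rintro (_ | j) b ha
      · exact absurd (by simp [activePoints, hz]) ha
      · by_cases hj : j ∈ s
        · have : some j = z := by
            by_contra h
            exact ha (Finset.mem_erase.2 ⟨h, by simpa [activePoints] using hj⟩)
          rw [this, htz]
        · exact htsupp j hj b
    rintro ⟨a, b⟩ hab
    by_cases ha : a ∈ (activePoints s).erase z
    · have hb : b ∉ (activePoints s).erase z := fun hb => hab (Finset.mem_product.2 ⟨ha, hb⟩)
      rw [hts]
      exact h0 b a hb
    · exact h0 a b ha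
  have hconv : ∀ f : Option I → Option I → ℝ,
      ∑ a, ∑ b, t a b * f a b = ∑ ab ∈ P, t ab.1 ab.2 * f ab.1 ab.2 := by
    intro f
    rw [← Finset.sum_product' (f := fun a b => t a b * f a b), Finset.univ_product_univ]
    refine (Finset.sum_subset (Finset.subset_univ P) fun ab _ hab => ?_).symm
    rw [htP ab hab, zero_mul]
  have hpT' : p ≤ ∑ ab ∈ P, t ab.1 ab.2 := by
    have := hconv fun _ _ => 1
    simp only [mul_one] at this
    rwa [← this]
  have hpt : ∀ g, Real.exp (-energy w (Function.update y i g)) ≤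
      Real.exp (-energy w' y) * ∑ ab ∈ P, Real.exp κ *
        (nrm ((rooted y ab.1)⁻¹ * rooted y ab.2) ^ (-δ) *
        (nrm ((rooted y ab.1)⁻¹ * g) * nrm ((rooted y ab.2)⁻¹ * g) /
          nrm ((rooted y ab.1)⁻¹ * rooted y ab.2)) ^ (-p)) := by
    intro g
    set y' := Function.update y i g with hy'
    have h1 := energy_ge_of_splitting hsym₁ hnn₁ (i := i) hts htz hrow y g
    rw [hconv (fun a b => logDist (Function.update y i g) a (some i) +
        logDist (Function.update y i g) b (some i) - logDist (Function.update y i g) a b)] at h1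
    have h2 : energy w₁ y' = (1 - κ) * energy w y' := by
      simp only [energy, hw₁, Finset.mul_sum, mul_assoc]
    have h3 := exp_neg_sum_le P (fun ab => t ab.1 ab.2)
      (fun ab => logDist y' ab.1 z + logDist y' ab.2 z - logDist y' ab.1 ab.2) (by linarith : 0 < p)
      (fun ab _ => ht0 _ _) (fun ab _ => by
        have := logDist_triangle y' ab.1 z ab.2
        rw [logDist_comm y' z ab.2] at this
        linarith) hpT'
    have h4 : Real.exp (-energy w y') ≤ Real.exp (-energy w' y) * (Real.exp (-(κ * energy w y')) *
        Real.exp (-∑ ab ∈ P, t ab.1 ab.2 *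
          (logDist y' ab.1 z + logDist y' ab.2 z - logDist y' ab.1 ab.2))) := by
      rw [← Real.exp_add, ← Real.exp_add]
      refine Real.exp_le_exp.2 ?_
      have h5 : energy w' y + ∑ ab ∈ P, t ab.1 ab.2 *
          (logDist y' ab.1 z + logDist y' ab.2 z - logDist y' ab.1 ab.2) ≤ energy w₁ y' := h1
      rw [h2] at h5
      linarith
    refine h4.trans (mul_le_mul_of_nonneg_left ?_ (Real.exp_pos _).le)
    refine (mul_le_mul_of_nonneg_left h3 (Real.exp_pos _).le).trans ?_
    rw [Finset.mul_sum]
    refine Finset.sum_le_sum fun ab hab => ?_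
    obtain ⟨ha, hb, ha', hb'⟩ := hPne ab hab
    rw [exp_neg_logDist_defect y i g ha hb p, ← mul_assoc]
    refine mul_le_mul_of_nonneg_right ?_ (Real.rpow_nonneg (nrm_mul_div_nonneg _ _ _) _)
    rw [Real.rpow_def_of_pos (nrm_pos _), ← Real.exp_add]
    refine Real.exp_le_exp.2 ?_
    have h6 := hdist y' _ ha' _ hb'
    have h7 : logDist y' ab.1 ab.2 = Real.log (nrm ((rooted y ab.1)⁻¹ * rooted y ab.2)) := by
      rw [logDist, rooted_update y i g ha, rooted_update y i g hb]
    rw [h7] at h6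
    have h8 : δ * Real.log (nrm ((rooted y ab.1)⁻¹ * rooted y ab.2)) ≤
        κ * (energy w y' + 1) := by
      rw [hδ, div_mul_eq_mul_div, div_le_iff₀ hc]
      nlinarith
    linarith
  have hmeas : ∀ ab : Option I × Option I, Measurable fun g : SL2C =>
      (nrm ((rooted y ab.1)⁻¹ * g) * nrm ((rooted y ab.2)⁻¹ * g) /
          nrm ((rooted y ab.1)⁻¹ * rooted y ab.2)) ^ (-p) := by
    intro ab
    have h1 : ∀ h : SL2C, Measurable fun g : SL2C => nrm (h * g) := fun h =>
      (continuous_nrm.comp (continuous_const.mul continuous_id)).measurable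
    exact (((h1 _).mul (h1 _)).div_const _).pow_const _
  calc ∫⁻ g, ENNReal.ofReal (Real.exp (-energy w (Function.update y i g))) ∂μ
      ≤ ∫⁻ g, ENNReal.ofReal (Real.exp (-energy w' y)) * ∑ ab ∈ P,
          ENNReal.ofReal (Real.exp κ) * (ENNReal.ofReal
          (nrm ((rooted y ab.1)⁻¹ * rooted y ab.2) ^ (-δ)) * ENNReal.ofReal
        ((nrm ((rooted y ab.1)⁻¹ * g) * nrm ((rooted y ab.2)⁻¹ * g) /
          nrm ((rooted y ab.1)⁻¹ * rooted y ab.2)) ^ (-p))) ∂μ := by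
        refine lintegral_mono fun g => (ENNReal.ofReal_le_ofReal (hpt g)).trans (le_of_eq ?_)
        have hn : ∀ h : SL2C, 0 ≤ nrm h ^ (-δ) := fun h => Real.rpow_nonneg (nrm_pos h).le _
        rw [ENNReal.ofReal_mul (Real.exp_pos _).le, ENNReal.ofReal_sum_of_nonneg]
        · simp only [ENNReal.ofReal_mul (Real.exp_pos κ).le, ENNReal.ofReal_mul (hn _)]
        · intro ab _
          exact mul_nonneg (Real.exp_pos _).le
            (mul_nonneg (hn _) (Real.rpow_nonneg (nrm_mul_div_nonneg _ _ _) _))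
    _ = ENNReal.ofReal (Real.exp (-energy w' y)) * ∑ ab ∈ P,
          ENNReal.ofReal (Real.exp κ) * (ENNReal.ofReal
          (nrm ((rooted y ab.1)⁻¹ * rooted y ab.2) ^ (-δ)) * ∫⁻ g, ENNReal.ofReal
        ((nrm ((rooted y ab.1)⁻¹ * g) * nrm ((rooted y ab.2)⁻¹ * g) /
          nrm ((rooted y ab.1)⁻¹ * rooted y ab.2)) ^ (-p)) ∂μ) := by
        rw [lintegral_const_mul' _ _ ENNReal.ofReal_ne_top, lintegral_finsetSum]
        · congr 1
          refine Finset.sum_congr rfl fun ab _ => ?_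
          rw [lintegral_const_mul' _ _ ENNReal.ofReal_ne_top,
            lintegral_const_mul' _ _ ENNReal.ofReal_ne_top]
        · exact fun ab _ => ((hmeas ab).ennreal_ofReal.const_mul _).const_mul _
    _ ≤ ENNReal.ofReal (Real.exp (-energy w' y)) * ∑ ab ∈ P,
          ENNReal.ofReal (Real.exp κ) * C := by
        gcongr with ab hab
        refine (mul_le_mul_right (hCle _ _) _).trans (le_of_eq ?_)
        rw [mul_left_comm, ← ENNReal.ofReal_mul (Real.rpow_nonneg (nrm_pos _).le _),
          ← Real.rpow_add (nrm_pos _), neg_add_cancel, Real.rpow_zero, ENNReal.ofReal_one, mul_one]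
    _ = _ := by
        rw [Finset.sum_const, nsmul_eq_mul, mul_comm]

/-- Induction over the variables still to be integrated. Weights and cut bound are quantified
inside, since each elimination changes both; the bound shrinks but stays above `4`. -/
theorem lmarginal_exp_neg_energy_lt_top (μ : Measure SL2C) [μ.IsHaarMeasure] [SigmaFinite μ]
    (s : Finset I) : ∀ (w : Option I → Option I → ℝ) (q : ℝ), (∀ a b, w a b = w b a) →
    (∀ a b, 0 ≤ w a b) → 4 < q →
    (∀ A ⊆ s.map Function.Embedding.some, A.Nonempty → q ≤ cutWeight w A) →
    (∀ i ∉ s, ∀ b, w (some i) b = 0) → ∀ x : I → SL2C,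
    (∫⋯∫⁻_s, (fun y => ENNReal.ofReal (Real.exp (-energy w y))) ∂fun _ => μ) x < ∞ := by
  induction s using Finset.induction_on with
  | empty =>
    intro w q _ _ _ _ _ x
    simp
  | insert i s hi ih =>
    intro w q hsym hw hq hcut hsupp x
    obtain ⟨w', q', C, hsym', hw', hq', hcut', hsupp', hC, hle⟩ :=
      lintegral_exp_neg_energy_update μ hsym hw (Finset.mem_insert_self i s) hq hcut hsupp
    rw [Finset.erase_insert hi] at hcut' hsupp'
    have hm : ∀ w : Option I → Option I → ℝ,
        Measurable fun y => ENNReal.ofReal (Real.exp (-energy w y)) := fun w =>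
      (Real.continuous_exp.comp (continuous_energy w).neg).measurable.ennreal_ofReal
    rw [lmarginal_insert' _ (hm w) hi]
    have h1 : (∫⋯∫⁻_s, (fun x => ∫⁻ g, ENNReal.ofReal
        (Real.exp (-energy w (Function.update x i g))) ∂μ) ∂fun _ => μ) x ≤
        (∫⋯∫⁻_s, (fun y => C * ENNReal.ofReal (Real.exp (-energy w' y))) ∂fun _ => μ) x :=
      lmarginal_mono (μ := fun _ => μ) (fun y => hle y) x
    refine h1.trans_lt ?_
    have h2 := ih w' q' hsym' hw' hq' hcut' hsupp' x
    rw [lmarginal] at h2 ⊢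
    rw [lintegral_const_mul' _ _ hC]
    exact ENNReal.mul_lt_top hC.lt_top h2

/-- The kernel `∏ nrm (gᵢ⁻¹ gⱼ) ^ (-wᵢⱼ)` is integrable over all points but the root if all cuts of
the weights are larger than `4`. -/
theorem lintegral_exp_neg_energy_lt_top (μ : Measure SL2C) [μ.IsHaarMeasure]
    {w : Option I → Option I → ℝ} (hsym : ∀ a b, w a b = w b a) (hw : ∀ a b, 0 ≤ w a b)
    {q : ℝ} (hq : 4 < q)
    (hcut : ∀ A : Finset (Option I), none ∉ A → A.Nonempty → q ≤ cutWeight w A) :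
    ∫⁻ y, ENNReal.ofReal (Real.exp (-energy w y)) ∂Measure.pi (fun _ : I => μ) < ∞ := by
  have h := lmarginal_exp_neg_energy_lt_top μ Finset.univ w q hsym hw hq
    (fun A hA => hcut A fun h => by simpa using hA h) (fun i hi => absurd (Finset.mem_univ i) hi)
    (fun _ => 1)
  rwa [lmarginal_univ] at h

end Kernel

/-! ### Vertex graphs and the corner kernel -/

theorem exists_adj_of_preconnected {W : Type*} {G : SimpleGraph W} (hG : G.Preconnected)
    {S : Set W} {a b : W} (ha : a ∈ S) (hb : b ∉ S) : ∃ u v, G.Adj u v ∧ u ∈ S ∧ v ∉ S := by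
  obtain ⟨p⟩ := hG a b
  obtain ⟨d, -, h1, h2⟩ := p.exists_boundary_dart S ha hb
  exact ⟨d.fst, d.snd, d.adj, h1, h2⟩

/-- A vertex cut of a 3-connected graph is crossed by at least three links. -/
theorem IsThreeConnected.three_le_card {W α : Type} [Fintype α] {G : SimpleGraph W}
    (hG : IsThreeConnected G) {S : Set W} (hS : S.Nonempty) (hS' : Sᶜ.Nonempty) (p q : α → W)
    (hp : ∀ c, p c ∈ S) (hq : ∀ c, q c ∉ S)
    (hcov : ∀ a ∈ S, ∀ b ∉ S, G.Adj a b → ∃ c, p c = a ∧ q c = b) : 3 ≤ Fintype.card α := by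
  classical
  by_contra! hcard
  have key : ∀ R : Set W, R.encard < 3 → (∃ a ∈ S, a ∉ R) → (∃ b ∉ S, b ∉ R) →
      ∃ c, p c ∉ R ∧ q c ∉ R := by
    rintro R hR ⟨a, ha, haR⟩ ⟨b, hb, hbR⟩
    obtain ⟨u, v, huv, hu, hv⟩ := exists_adj_of_preconnected (hG.2 R hR).preconnected
      (S := {x | x.1 ∈ S}) (a := ⟨a, haR⟩) (b := ⟨b, hbR⟩) ha hb
    obtain ⟨c, hc1, hc2⟩ := hcov u.1 hu v.1 hv huv
    exact ⟨c, by rw [hc1]; exact u.2, by rw [hc2]; exact v.2⟩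
  have hrange : ∀ f : α → W, (Set.range f).encard < 3 := by
    intro f
    have h1 : (Set.range f).encard ≤ (Set.univ : Set α).encard := by
      rw [← Set.image_univ]
      exact Set.encard_image_le _ _
    rw [Set.encard_univ, ENat.card_eq_coe_fintype_card] at h1
    refine h1.trans_lt ?_
    exact_mod_cast hcard
  -- Deleting the at most two ends in `S` of the crossing links leaves a connected graph without
  -- crossing links, so `S` has no further nodes. The same holds for the complement.
  by_cases h1 : ∃ a ∈ S, a ∉ Set.range p
  · obtain ⟨b, hb⟩ := hS'
    obtain ⟨c, hc, -⟩ := key (Set.range p) (hrange p) h1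
      ⟨b, hb, fun ⟨c, hc⟩ => hb (hc ▸ hp c)⟩
    exact hc ⟨c, rfl⟩
  by_cases h2 : ∃ b ∉ S, b ∉ Set.range q
  · obtain ⟨a, ha⟩ := hS
    obtain ⟨c, -, hc⟩ := key (Set.range q) (hrange q)
      ⟨a, ha, fun ⟨c, hc⟩ => hq c (hc ▸ ha)⟩ h2
    exact hc ⟨c, rfl⟩
  push Not at h1 h2
  have : Finite W := (Nat.finite_of_card_ne_zero (by have := hG.1; omega))
  have : Fintype W := Fintype.ofFinite W
  have hW := hG.1
  rw [Nat.card_eq_fintype_card] at hW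
  have hle : (Finset.univ : Finset W) ⊆ Finset.univ.image p ∪ Finset.univ.image q := by
    intro a _
    by_cases ha : a ∈ S
    · obtain ⟨c, hc⟩ := h1 a ha
      exact Finset.mem_union_left _ (Finset.mem_image.2 ⟨c, Finset.mem_univ _, hc⟩)
    · obtain ⟨c, hc⟩ := h2 a ha
      exact Finset.mem_union_right _ (Finset.mem_image.2 ⟨c, Finset.mem_univ _, hc⟩)
  have hle' := (Finset.card_le_card hle).trans (Finset.card_union_le _ _)
  rw [Finset.card_univ] at hle'
  have hpc : (Finset.univ.image p).card ≤ Fintype.card α := Finset.card_image_le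
  have hqc : (Finset.univ.image q).card ≤ Fintype.card α := Finset.card_image_le
  have hpi : Function.Injective p := by
    have := Finset.card_image_iff.1 (show (Finset.univ.image p).card = (Finset.univ : Finset α).card
      by rw [Finset.card_univ]; omega)
    simpa using this
  have hqi : Function.Injective q := by
    have := Finset.card_image_iff.1 (show (Finset.univ.image q).card = (Finset.univ : Finset α).card
      by rw [Finset.card_univ]; omega)
    simpa using this
  -- The graph has more than three nodes, so it consists of the four distinct ends of two crossing
  -- links. Deleting one end of each, on opposite sides, still leaves a node on either side but no
  -- link between them.
  obtain ⟨c, c', hcc, huniv⟩ := Finset.card_eq_two.1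
    (show (Finset.univ : Finset α).card = 2 by rw [Finset.card_univ]; omega)
  obtain ⟨e, he1, he2⟩ := key {p c, q c'} (by
      have hne : p c ≠ q c' := fun h => hq c' (h ▸ hp c)
      rw [Set.encard_pair hne]
      norm_num)
    ⟨p c', hp c', by
      simp only [Set.mem_insert_iff, Set.mem_singleton_iff, not_or]
      exact ⟨fun h => hcc (hpi h).symm, fun h => hq c' (h ▸ hp c')⟩⟩
    ⟨q c, hq c, by
      simp only [Set.mem_insert_iff, Set.mem_singleton_iff, not_or]
      exact ⟨fun h => hq c (h ▸ hp c), fun h => hcc (hqi h)⟩⟩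
  have he : e = c ∨ e = c' := by
    have : e ∈ ({c, c'} : Finset α) := huniv ▸ Finset.mem_univ e
    simpa using this
  rcases he with rfl | rfl
  · exact he1 (by simp)
  · exact he2 (by simp)

/-! ### The corner kernel of a 2-complex -/

section Corners

open scoped Classical in
/-- The corners of all faces. -/
def corners (K : RootComplex) : Finset (K.D × K.D) :=
  Finset.univ.filter fun c => (∃ h, c ∈ K.bdInt h) ∨ ∃ b, c ∈ K.bdBd b

variable {K : RootComplex}

theorem mem_corners {c : K.D × K.D} :
    c ∈ corners K ↔ (∃ h, c ∈ K.bdInt h) ∨ ∃ b, c ∈ K.bdBd b := by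
  simp [corners]

theorem vert_eq_of_mem_corners {c : K.D × K.D} (hc : c ∈ corners K) : K.vert c.1 = K.vert c.2 := by
  rcases mem_corners.1 hc with ⟨h, hc⟩ | ⟨b, hc⟩
  · exact K.bdInt_corner h c hc
  · exact K.bdBd_corner b c hc

variable {e₀ : K.V → K.D}

open scoped Classical in
/-- The integration variable at a half-edge, or the root if it is gauge fixed. -/
def anchor (e₀ : K.V → K.D) (d : K.D) : Option {d : K.D // d ≠ e₀ (K.vert d)} :=
  if h : d ≠ e₀ (K.vert d) then some ⟨d, h⟩ else none

theorem anchor_some {d : K.D} (h : d ≠ e₀ (K.vert d)) : anchor e₀ d = some ⟨d, h⟩ := dif_pos h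

theorem anchor_base {v : K.V} (h : K.vert (e₀ v) = v) : anchor e₀ (e₀ v) = none :=
  dif_neg (by rw [h]; simp)

theorem full_eq_rooted (x : Config K e₀) (d : K.D) : x.full d = rooted x (anchor e₀ d) := by
  by_cases h : d ≠ e₀ (K.vert d)
  · rw [anchor_some h, Config.full, dif_pos h]
    rfl
  · rw [anchor, dif_neg h, Config.full, dif_neg h]
    rfl

open scoped Classical in
/-- The weights on pairs of integration variables that come from the corners. -/
def cornerWeight (e₀ : K.V → K.D) (a b : Option {d : K.D // d ≠ e₀ (K.vert d)}) : ℝ :=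
  ∑ c ∈ corners K, (3 / 4 : ℝ) * ((if anchor e₀ c.1 = a ∧ anchor e₀ c.2 = b then 1 else 0) +
    (if anchor e₀ c.1 = b ∧ anchor e₀ c.2 = a then 1 else 0))

theorem cornerWeight_comm (a b : Option {d : K.D // d ≠ e₀ (K.vert d)}) :
    cornerWeight e₀ a b = cornerWeight e₀ b a := by
  simp only [cornerWeight, add_comm]

theorem cornerWeight_nonneg (a b : Option {d : K.D // d ≠ e₀ (K.vert d)}) :
    0 ≤ cornerWeight e₀ a b := by
  refine Finset.sum_nonneg fun c _ => ?_
  split_ifs <;> norm_num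

-- A corner enters with `3/4` for each order of its two ends, which gives it the exponent `3/2` of
-- `cornerKernel`.
open scoped Classical in
theorem sum_cornerWeight_mul (f : Option {d : K.D // d ≠ e₀ (K.vert d)} →
    Option {d : K.D // d ≠ e₀ (K.vert d)} → ℝ) (hf : ∀ a b, f a b = f b a) :
    ∑ a, ∑ b, cornerWeight e₀ a b * f a b =
      ∑ c ∈ corners K, (3 / 2 : ℝ) * f (anchor e₀ c.1) (anchor e₀ c.2) := by
  have h1 : ∀ p q : Option {d : K.D // d ≠ e₀ (K.vert d)},
      ∑ a, ∑ b, (if p = a ∧ q = b then (1 : ℝ) else 0) * f a b = f p q := by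
    intro p q
    simp [ite_and]
  have h2 : ∀ p q : Option {d : K.D // d ≠ e₀ (K.vert d)},
      ∑ a, ∑ b, (if p = b ∧ q = a then (1 : ℝ) else 0) * f a b = f p q := by
    intro p q
    rw [Finset.sum_comm, ← h1 p q]
    exact Finset.sum_congr rfl fun a _ => Finset.sum_congr rfl fun b _ => by rw [hf]
  calc ∑ a, ∑ b, cornerWeight e₀ a b * f a b
      = ∑ a, ∑ b, ∑ c ∈ corners K, ((3 / 4 : ℝ) *
          ((if anchor e₀ c.1 = a ∧ anchor e₀ c.2 = b then 1 else 0) * f a b) + (3 / 4 : ℝ) *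
          ((if anchor e₀ c.1 = b ∧ anchor e₀ c.2 = a then 1 else 0) * f a b)) := by
        refine Finset.sum_congr rfl fun a _ => Finset.sum_congr rfl fun b _ => ?_
        rw [cornerWeight, Finset.sum_mul]
        exact Finset.sum_congr rfl fun c _ => by ring
    _ = ∑ c ∈ corners K, ∑ a, ∑ b, ((3 / 4 : ℝ) *
          ((if anchor e₀ c.1 = a ∧ anchor e₀ c.2 = b then 1 else 0) * f a b) + (3 / 4 : ℝ) *
          ((if anchor e₀ c.1 = b ∧ anchor e₀ c.2 = a then 1 else 0) * f a b)) := by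
        refine (Finset.sum_congr rfl fun a _ => Finset.sum_comm).trans ?_
        exact Finset.sum_comm
    _ = _ := by
        refine Finset.sum_congr rfl fun c _ => ?_
        simp only [Finset.sum_add_distrib, ← Finset.mul_sum]
        rw [h1, h2]
        ring

/-- The kernel `∏_c ‖U_c‖ ^ (-3/2)` over all corners. -/
def cornerKernel (K : RootComplex) (g : K.D → SL2C) : ℝ :=
  ∏ c ∈ corners K, nrm (wedge g c) ^ (-(3 / 2 : ℝ))

open scoped Classical in
theorem exp_neg_energy_cornerWeight (x : Config K e₀) :
    Real.exp (-energy (cornerWeight e₀) x) = cornerKernel K x.full := by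
  rw [energy, sum_cornerWeight_mul _ (logDist_comm x), ← Finset.sum_neg_distrib, Real.exp_sum,
    cornerKernel]
  refine Finset.prod_congr rfl fun c _ => ?_
  rw [wedge, full_eq_rooted, full_eq_rooted, logDist, Real.rpow_def_of_pos (nrm_pos _)]
  congr 1
  ring

-- A nonempty set of integration variables contains a half-edge at some vertex `v`, while `e₀ v` is
-- the root and lies outside. It therefore cuts the 3-connected graph at `v`, separates at least
-- three corners, and has weight at least `3 · 3/2`. This exceeds the threshold `4`.
open scoped Classical in
theorem le_cutWeight_cornerWeight (he₀ : ∀ v, K.vert (e₀ v) = v)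
    (h3 : ∀ v, IsThreeConnected (K.vertexGraph v))
    (A : Finset (Option {d : K.D // d ≠ e₀ (K.vert d)})) (hnone : none ∉ A) (hA : A.Nonempty) :
    9 / 2 ≤ cutWeight (cornerWeight e₀) A := by
  let sep : Option {d : K.D // d ≠ e₀ (K.vert d)} → Option {d : K.D // d ≠ e₀ (K.vert d)} → ℝ :=
    fun a b => if (a ∈ A ↔ b ∈ A) then 0 else 1
  have hcw : cutWeight (cornerWeight e₀) A = ∑ a, ∑ b, cornerWeight e₀ a b * sep a b := by
    refine Finset.sum_congr rfl fun a _ => Finset.sum_congr rfl fun b _ => ?_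
    simp only [sep]
    split_ifs <;> simp
  rw [hcw, sum_cornerWeight_mul sep (fun a b => by simp only [sep, iff_comm]), ← Finset.mul_sum]
  obtain ⟨a, ha⟩ := hA
  obtain ⟨⟨d, hd⟩, rfl⟩ : ∃ d, a = some d := by
    rcases a with _ | d
    · exact absurd ha hnone
    · exact ⟨d, rfl⟩
  let X : Finset (K.D × K.D) := (corners K).filter fun c =>
    ¬ (anchor e₀ c.1 ∈ A ↔ anchor e₀ c.2 ∈ A)
  have hX : (X.card : ℝ) = ∑ c ∈ corners K, sep (anchor e₀ c.1) (anchor e₀ c.2) := by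
    simp only [sep, X, Finset.card_filter, Nat.cast_sum]
    exact Finset.sum_congr rfl fun c _ => by split_ifs <;> simp_all
  suffices h : 3 ≤ X.card by
    rw [← hX]
    have : (3 : ℝ) ≤ X.card := by exact_mod_cast h
    linarith
  let Y : Finset (K.D × K.D) := X.filter fun c => K.vert c.1 = K.vert d
  have hY : ∀ c : Y, c.1 ∈ corners K ∧ ¬ (anchor e₀ c.1.1 ∈ A ↔ anchor e₀ c.1.2 ∈ A) ∧
      K.vert c.1.1 = K.vert d := by
    rintro ⟨c, hc⟩
    simp only [Y, X, Finset.mem_filter] at hc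
    exact ⟨hc.1.1, hc.1.2, hc.2⟩
  have hY2 : ∀ c : Y, K.vert c.1.2 = K.vert d := fun c => by
    rw [← vert_eq_of_mem_corners (hY c).1, (hY c).2.2]
  have h := (h3 (K.vert d)).three_le_card (α := Y) (S := {e | anchor e₀ e.1 ∈ A})
    ⟨⟨d, rfl⟩, by rw [Set.mem_ofPred_eq, anchor_some hd]; exact ha⟩
    ⟨⟨e₀ (K.vert d), he₀ _⟩, by
      rw [Set.mem_compl_iff, Set.mem_ofPred_eq, anchor_base (he₀ _)]; exact hnone⟩
    (fun c => if anchor e₀ c.1.1 ∈ A then ⟨c.1.1, (hY c).2.2⟩ else ⟨c.1.2, hY2 c⟩)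
    (fun c => if anchor e₀ c.1.1 ∈ A then ⟨c.1.2, hY2 c⟩ else ⟨c.1.1, (hY c).2.2⟩)
    (fun c => by
      have := (hY c).2.1
      split_ifs with h1
      · exact h1
      · rw [Set.mem_ofPred_eq]
        tauto)
    (fun c => by
      have := (hY c).2.1
      split_ifs with h1
      · rw [Set.mem_ofPred_eq]
        tauto
      · exact h1)
    (fun a ha b hb hab => by
      rw [Set.mem_ofPred_eq] at ha hb
      rw [RootComplex.vertexGraph, SimpleGraph.fromRel_adj] at hab
      rcases hab.2 with h | h
      · have hc : (a.1, b.1) ∈ Y := by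
          simp only [Y, X, Finset.mem_filter]
          exact ⟨⟨mem_corners.2 h, by tauto⟩, a.2⟩
        exact ⟨⟨_, hc⟩, by simp [ha], by simp [ha]⟩
      · have hc : (b.1, a.1) ∈ Y := by
          simp only [Y, X, Finset.mem_filter]
          exact ⟨⟨mem_corners.2 h, by tauto⟩, b.2⟩
        exact ⟨⟨_, hc⟩, by simp [hb], by simp [hb]⟩)
  rw [Fintype.card_coe] at h
  exact h.trans (Finset.card_le_card (Finset.filter_subset _ _))

/-- The corner kernel is integrable if all vertex graphs are 3-connected. -/
theorem lintegral_cornerKernel_lt_top (he₀ : ∀ v, K.vert (e₀ v) = v)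
    (h3 : ∀ v, IsThreeConnected (K.vertexGraph v)) (μ : Measure SL2C) [μ.IsHaarMeasure] :
    ∫⁻ x, ENNReal.ofReal (cornerKernel K (Config.full x)) ∂measureOmega e₀ μ < ∞ := by
  classical
  have h := lintegral_exp_neg_energy_lt_top μ (w := cornerWeight e₀) cornerWeight_comm
    cornerWeight_nonneg (q := 9 / 2) (by norm_num) (le_cutWeight_cornerWeight he₀ h3)
  simp only [exp_neg_energy_cornerWeight] at h
  have hΩ : measureOmega e₀ μ = Measure.pi fun _ => μ := by
    unfold measureOmega
    congr!
  rwa [hΩ]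

/-- The kernel `∏_c ‖U_c‖ ^ (-3/2)` over the corners of one face. -/
def faceKernel (l : List (K.D × K.D)) (g : K.D → SL2C) : ℝ :=
  (l.map fun c => nrm (wedge g c) ^ (-(3 / 2 : ℝ))).prod

theorem nrm_rpow_nonneg (g : SL2C) (p : ℝ) : 0 ≤ nrm g ^ p := Real.rpow_nonneg (nrm_pos g).le p

theorem nrm_rpow_neg_le_one (g : SL2C) {p : ℝ} (hp : 0 ≤ p) : nrm g ^ (-p) ≤ 1 :=
  Real.rpow_le_one_of_one_le_of_nonpos (one_le_nrm g) (by linarith)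

theorem faceKernel_nonneg (l : List (K.D × K.D)) (g : K.D → SL2C) : 0 ≤ faceKernel l g :=
  List.prod_nonneg fun a ha => by
    obtain ⟨c, -, rfl⟩ := List.mem_map.1 ha
    exact nrm_rpow_nonneg _ _

/-- A corner may occur several times in the faces, while `corners` counts it once. Each factor is at
most `1`, so repetitions only help. -/
theorem prod_faceKernel_le (g : K.D → SL2C) :
    (∏ h, faceKernel (K.bdInt h) g) * ∏ b, faceKernel (K.bdBd b) g ≤ cornerKernel K g := by
  classical
  let f : K.D × K.D → ℝ := fun c => nrm (wedge g c) ^ (-(3 / 2 : ℝ))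
  let M : Multiset (K.D × K.D) :=
    ∑ h, (K.bdInt h : Multiset (K.D × K.D)) + ∑ b, (K.bdBd b : Multiset (K.D × K.D))
  have h1 : (∏ h, faceKernel (K.bdInt h) g) * ∏ b, faceKernel (K.bdBd b) g = (M.map f).prod := by
    have hs : ∀ {β : Type} (s : Finset β) (l : β → List (K.D × K.D)),
        ((∑ i ∈ s, (l i : Multiset (K.D × K.D))).map f).prod = ∏ i ∈ s, faceKernel (l i) g := by
      intro β s l
      induction s using Finset.induction_on with
      | empty => simp
      | insert i s hi ih =>
        rw [Finset.sum_insert hi, Finset.prod_insert hi, Multiset.map_add, Multiset.prod_add, ih]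
        simp [faceKernel, f]
    rw [Multiset.map_add, Multiset.prod_add, hs, hs]
  have h2 : corners K = M.toFinset := by
    ext c
    simp [mem_corners, M, Multiset.mem_sum]
  rw [h1, Finset.prod_multiset_map_count, cornerKernel, h2]
  refine Finset.prod_le_prod (fun c _ => pow_nonneg (nrm_rpow_nonneg _ _) _) fun c hc => ?_
  exact pow_le_of_le_one (nrm_rpow_nonneg _ _) (nrm_rpow_neg_le_one _ (by norm_num))
    (Multiset.count_ne_zero.2 (Multiset.mem_toFinset.1 hc))

end Corners

/-! ### Moments of the unit sphere -/

theorem lintegral_radial_gaussian (n : ℕ) :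
    ∫⁻ r in Set.Ioi (0 : ℝ), ENNReal.ofReal (r ^ (2 * n + 3) * Real.exp (-r ^ 2)) =
      ENNReal.ofReal ((n + 1).factorial / 2) := by
  have h := integral_rpow_mul_exp_neg_rpow (p := 2) (q := 2 * n + 3) (by norm_num)
    (by have : (0 : ℝ) ≤ n := n.cast_nonneg; linarith)
  have hG : Real.Gamma ((2 * (n : ℝ) + 3 + 1) / 2) = (n + 1).factorial := by
    rw [← Real.Gamma_nat_eq_factorial]
    congr 1
    push_cast
    ring
  rw [hG] at h
  have h2 : ∫ r in Set.Ioi (0 : ℝ), r ^ (2 * n + 3) * Real.exp (-r ^ 2) =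
      (n + 1).factorial / 2 := by
    rw [div_eq_inv_mul, ← one_div, ← h]
    refine setIntegral_congr_fun measurableSet_Ioi fun r _ => ?_
    rw [show (2 * (n : ℝ) + 3) = ((2 * n + 3 : ℕ) : ℝ) by push_cast; ring, Real.rpow_natCast,
      Real.rpow_two]
  rw [← h2, ofReal_integral_eq_lintegral_ofReal]
  · refine not_imp_comm.1 integral_undef ?_
    rw [h2]
    positivity
  · filter_upwards [ae_restrict_mem measurableSet_Ioi] with r hr
    have : (0 : ℝ) < r := hr
    simp only [Pi.zero_apply]
    positivity

theorem lintegral_complex_gaussian (n : ℕ) :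
    ∫⁻ z : ℂ, ENNReal.ofReal (‖z‖ ^ (2 * n) * Real.exp (-‖z‖ ^ 2)) =
      ENNReal.ofReal (Real.pi * n.factorial) := by
  have h := Complex.integral_rpow_mul_exp_neg_rpow (p := 2) (q := 2 * n) (by norm_num)
    (by have : (0 : ℝ) ≤ n := n.cast_nonneg; linarith)
  have hG : Real.Gamma ((2 * (n : ℝ) + 2) / 2) = n.factorial := by
    rw [← Real.Gamma_nat_eq_factorial]
    congr 1
    ring
  rw [hG] at h
  have h2 : ∫ z : ℂ, ‖z‖ ^ (2 * n) * Real.exp (-‖z‖ ^ 2) = Real.pi * n.factorial := by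
    rw [show Real.pi * (n.factorial : ℝ) = 2 * Real.pi / 2 * n.factorial by ring, ← h]
    refine integral_congr_ae (ae_of_all _ fun r => ?_)
    simp only
    rw [show (2 * (n : ℝ)) = ((2 * n : ℕ) : ℝ) by push_cast; ring, Real.rpow_natCast,
      Real.rpow_two]
  rw [← h2, ofReal_integral_eq_lintegral_ofReal]
  · refine not_imp_comm.1 integral_undef ?_
    rw [h2]
    have := Real.pi_pos
    positivity
  · exact ae_of_all _ fun z => by simp only [Pi.zero_apply]; positivity

/-- A Gaussian moment is computed in polar and in Cartesian coordinates. The constant `c` is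
independent of `a` and `b` and is eliminated by comparison with `a = b = 0`. -/
theorem exists_lintegral_spinor_gaussian : ∃ c : ℝ≥0∞, ∀ a b : ℕ,
    ENNReal.ofReal ((a + b + 1).factorial / 2) * ∫⁻ w : Metric.sphere (0 : Spinor) 1,
      ENNReal.ofReal (‖(w : Spinor) 0‖ ^ (2 * a) * ‖(w : Spinor) 1‖ ^ (2 * b))
        ∂(volume : Measure Spinor).toSphere =
      c * ENNReal.ofReal (a.factorial * b.factorial) := by
  obtain ⟨c, -, hc⟩ := exists_map_spinor_volume
  refine ⟨c * ENNReal.ofReal (Real.pi ^ 2), fun a b => ?_⟩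
  let G : Spinor → ℝ≥0∞ := fun z =>
    ENNReal.ofReal (‖z 0‖ ^ (2 * a) * ‖z 1‖ ^ (2 * b) * Real.exp (-‖z‖ ^ 2))
  have hG : Measurable G := by fun_prop
  have h1 : ∫⁻ z, G z = ENNReal.ofReal ((a + b + 1).factorial / 2) *
      ∫⁻ w : Metric.sphere (0 : Spinor) 1,
        ENNReal.ofReal (‖(w : Spinor) 0‖ ^ (2 * a) * ‖(w : Spinor) 1‖ ^ (2 * b))
        ∂(volume : Measure Spinor).toSphere := by
    rw [lintegral_polar hG, ← lintegral_const_mul' _ _ ENNReal.ofReal_ne_top]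
    refine lintegral_congr fun w => ?_
    rw [← lintegral_radial_gaussian, ← lintegral_mul_const' _ _ ENNReal.ofReal_ne_top]
    refine setLIntegral_congr_fun measurableSet_Ioi fun r hr => ?_
    have hr0 : (0 : ℝ) < r := hr
    have hw : ‖(w : Spinor)‖ = 1 := by simp
    simp only [G]
    rw [← ENNReal.ofReal_mul (by positivity), ← ENNReal.ofReal_mul (by positivity), norm_smul, hw,
      PiLp.smul_apply, PiLp.smul_apply, norm_smul, norm_smul, Real.norm_of_nonneg hr0.le, mul_one]
    congr 1
    ring
  have h2 : ∫⁻ z, G z = c * ENNReal.ofReal (Real.pi ^ 2) *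
      ENNReal.ofReal (a.factorial * b.factorial) := by
    let H : ℂ × ℂ → ℝ≥0∞ := fun p => ENNReal.ofReal (‖p.1‖ ^ (2 * a) * Real.exp (-‖p.1‖ ^ 2)) *
      ENNReal.ofReal (‖p.2‖ ^ (2 * b) * Real.exp (-‖p.2‖ ^ 2))
    have hH : Measurable H := by fun_prop
    have hGH : ∀ z, G z = H (z 0, z 1) := by
      intro z
      simp only [G, H]
      rw [← ENNReal.ofReal_mul (by positivity), spinor_norm_sq, neg_add, Real.exp_add]
      congr 1
      ring
    calc ∫⁻ z, G z = ∫⁻ z : Spinor, H (z 0, z 1) := lintegral_congr hGH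
      _ = ∫⁻ p, H p ∂(Measure.map (fun z : Spinor => (z 0, z 1)) volume) := by
        rw [lintegral_map hH (by fun_prop)]
      _ = _ := by
        have hprod : ∫⁻ p, H p ∂((volume : Measure ℂ).prod (volume : Measure ℂ)) =
            ENNReal.ofReal (Real.pi ^ 2) * ENNReal.ofReal (a.factorial * b.factorial) := by
          have hm : ∀ n : ℕ, AEMeasurable
              (fun z : ℂ => ENNReal.ofReal (‖z‖ ^ (2 * n) * Real.exp (-‖z‖ ^ 2))) volume :=
            fun n => by fun_prop
          refine (lintegral_prod_mul (hm a) (hm b)).trans ?_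
          rw [lintegral_complex_gaussian, lintegral_complex_gaussian,
            ← ENNReal.ofReal_mul (by positivity), ← ENNReal.ofReal_mul (by positivity)]
          congr 1
          ring
        rw [hc, lintegral_smul_measure, smul_eq_mul, mul_assoc]
        exact congrArg (c * ·) hprod
  rw [← h1, h2]

/-- `∫ |w₀|^{2a} |w₁|^{2b} = a! b! / (a + b + 1)!` over the unit sphere of `ℂ²`. -/
theorem lintegral_sphere_moment (a b : ℕ) :
    ENNReal.ofReal (a + b + 1).factorial * ∫⁻ w : Metric.sphere (0 : Spinor) 1,
      ENNReal.ofReal (‖(w : Spinor) 0‖ ^ (2 * a) * ‖(w : Spinor) 1‖ ^ (2 * b)) ∂sphereMeasure =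
      ENNReal.ofReal (a.factorial * b.factorial) := by
  obtain ⟨c, hc⟩ := exists_lintegral_spinor_gaussian
  have h0 := hc 0 0
  have hab := hc a b
  set S := (volume : Measure Spinor).toSphere Set.univ
  have hS0 : S ≠ 0 := toSphere_univ_ne_zero
  have hS : S ≠ ∞ := measure_ne_top _ _
  simp only [mul_zero, pow_zero, mul_one, ENNReal.ofReal_one, lintegral_const, one_mul,
    Nat.factorial_zero, Nat.cast_one, add_zero, zero_add, Nat.factorial_one] at h0
  rw [sphereMeasure, lintegral_smul_measure]
  set X := ∫⁻ w : Metric.sphere (0 : Spinor) 1,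
    ENNReal.ofReal (‖(w : Spinor) 0‖ ^ (2 * a) * ‖(w : Spinor) 1‖ ^ (2 * b))
      ∂(volume : Measure Spinor).toSphere
  rw [← h0, div_eq_mul_one_div, ENNReal.ofReal_mul (by positivity)] at hab
  have hhalf : ENNReal.ofReal (1 / 2) ≠ 0 := by
    rw [Ne, ENNReal.ofReal_eq_zero]
    norm_num
  have h3 : ENNReal.ofReal (a + b + 1).factorial * X =
      S * ENNReal.ofReal (a.factorial * b.factorial) := by
    refine (ENNReal.mul_right_inj hhalf ENNReal.ofReal_ne_top).1 ?_
    rw [← mul_assoc, ← mul_assoc, mul_comm (ENNReal.ofReal (1 / 2)) (ENNReal.ofReal _), hab]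
  rw [smul_eq_mul, mul_left_comm, h3, ← mul_assoc, ENNReal.inv_mul_cancel hS0 hS, one_mul]

/-! ### The principal series on the unit sphere -/

section PrincipalSeries

variable {k : ℕ} {ρ : ℝ}

/-- Neither `k` nor `ρ` survives in the modulus, so `|F|²` has degree `-4`, the degree in which
sphere integrals are `SL(2, ℂ)` invariant. Unitarity follows from this. -/
theorem norm_psFactor {α : ℂ} (hα : α ≠ 0) : ‖psFactor k ρ α‖ = (‖α‖ ^ 2)⁻¹ := by
  have hα' : 0 < ‖α‖ := norm_pos_iff.2 hα
  rw [psFactor, norm_mul, norm_pow, Complex.norm_conj, Complex.norm_cpow_eq_rpow_re_of_pos hα']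
  simp only [Complex.sub_re, Complex.mul_re, Complex.I_re, Complex.ofReal_re, zero_mul,
    Complex.I_im, Complex.ofReal_im, mul_zero, sub_zero, Complex.re_ofNat, Complex.natCast_re,
    zero_sub]
  rw [Real.rpow_sub hα', Real.rpow_natCast, Real.rpow_neg hα'.le, Real.rpow_two]
  field_simp

theorem measurable_principalSeries (F : PrincipalSeries k ρ) : Measurable F.1 :=
  measurable_of_continuousOn_compl_singleton 0 F.2.1

theorem sphere_ne_zero (w : Metric.sphere (0 : Spinor) 1) : (w : Spinor) ≠ 0 :=
  ne_zero_of_mem_unit_sphere w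

theorem continuous_sphere_principalSeries (F : PrincipalSeries k ρ) :
    Continuous fun w : Metric.sphere (0 : Spinor) 1 => F.1 w :=
  F.2.1.comp_continuous continuous_subtype_val fun w => sphere_ne_zero w

/-- The restriction to the unit sphere. -/
def sphereRestrict (k : ℕ) (ρ : ℝ) :
    PrincipalSeries k ρ →ₗ[ℂ] C(Metric.sphere (0 : Spinor) 1, ℂ) where
  toFun F := ⟨fun w => F.1 w, continuous_sphere_principalSeries F⟩
  map_add' _ _ := rfl
  map_smul' _ _ := rfl

theorem sphereRestrict_injective : Function.Injective (sphereRestrict k ρ) := by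
  intro F G h
  refine Subtype.ext (funext fun z => ?_)
  by_cases hz : z = 0
  · rw [hz, F.2.2.1, G.2.2.1]
  have hz' : 0 < ‖z‖ := norm_pos_iff.2 hz
  let w : Metric.sphere (0 : Spinor) 1 := ⟨((‖z‖ : ℂ)⁻¹) • z, by
    rw [mem_sphere_zero_iff_norm, norm_smul, norm_inv, Complex.norm_real, norm_norm,
      inv_mul_cancel₀ hz'.ne']⟩
  have hw : z = (‖z‖ : ℂ) • (w : Spinor) := by
    simp only [w]
    rw [smul_smul, mul_inv_cancel₀ (by exact_mod_cast hz'.ne'), one_smul]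
  have hne : (‖z‖ : ℂ) ≠ 0 := by exact_mod_cast hz'.ne'
  have h1 : F.1 w = G.1 w := congrArg (fun f => f w) h
  rw [hw, F.2.2.2 _ hne, G.2.2.2 _ hne, h1]

/-- The embedding in the Hilbert space `L²` of the sphere. -/
def toL2 (k : ℕ) (ρ : ℝ) : PrincipalSeries k ρ →ₗ[ℂ] Lp ℂ 2 sphereMeasure :=
  (ContinuousMap.toLp (E := ℂ) 2 sphereMeasure ℂ).toLinearMap ∘ₗ sphereRestrict k ρ

/-- The functions are continuous, the sphere measure charges open sets, and homogeneity extends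
equality from the sphere. Identities derived in the Hilbert space thus hold pointwise. -/
theorem toL2_injective : Function.Injective (toL2 k ρ) :=
  (ContinuousMap.toLp_injective sphereMeasure).comp sphereRestrict_injective

theorem psInner_eq_integral (F G : PrincipalSeries k ρ) :
    psInner F G = ∫ w : Metric.sphere (0 : Spinor) 1,
      (starRingEnd ℂ) (F.1 w) * G.1 w ∂sphereMeasure := rfl

theorem inner_toL2 (F G : PrincipalSeries k ρ) : inner ℂ (toL2 k ρ F) (toL2 k ρ G) = psInner F G := by
  rw [psInner_eq_integral]
  refine (ContinuousMap.inner_toLp _ (sphereRestrict k ρ F) (sphereRestrict k ρ G)).trans ?_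
  refine integral_congr_ae (ae_of_all _ fun w => ?_)
  exact mul_comm _ _

theorem norm_toL2_sq (F : PrincipalSeries k ρ) : ENNReal.ofReal (‖toL2 k ρ F‖ ^ 2) =
    ∫⁻ w : Metric.sphere (0 : Spinor) 1, ‖F.1 w‖ₑ ^ 2 ∂sphereMeasure := by
  have h1 : ((‖toL2 k ρ F‖ ^ 2 : ℝ) : ℂ) = psInner F F := by
    rw [← inner_toL2, inner_self_eq_norm_sq_to_K]
    simp
  have h2 : psInner F F = ((∫ w : Metric.sphere (0 : Spinor) 1, ‖F.1 w‖ ^ 2 ∂sphereMeasure : ℝ) : ℂ) := by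
    rw [psInner_eq_integral, ← integral_complex_ofReal]
    refine integral_congr_ae (ae_of_all _ fun w => ?_)
    simp only
    rw [mul_comm, Complex.mul_conj, Complex.normSq_eq_norm_sq]
  have h3 : ‖toL2 k ρ F‖ ^ 2 = ∫ w : Metric.sphere (0 : Spinor) 1, ‖F.1 w‖ ^ 2 ∂sphereMeasure := by
    exact_mod_cast h1.trans h2
  rw [h3, ofReal_integral_eq_lintegral_ofReal]
  · refine lintegral_congr fun w => ?_
    rw [ENNReal.ofReal_pow (norm_nonneg _), ofReal_norm]
  · have : Continuous fun w : Metric.sphere (0 : Spinor) 1 => ‖F.1 w‖ ^ 2 :=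
      (continuous_sphere_principalSeries F).norm.pow 2
    exact this.integrable_of_hasCompactSupport (HasCompactSupport.of_compactSpace _)
  · exact ae_of_all _ fun w => by simp only [Pi.zero_apply]; positivity

/-- Unitarity of the principal series. -/
theorem norm_toL2_rep (g : SL2C) (F : PrincipalSeries k ρ) :
    ‖toL2 k ρ (principalSeriesRep k ρ g F)‖ = ‖toL2 k ρ F‖ := by
  have h1 : ENNReal.ofReal (‖toL2 k ρ (principalSeriesRep k ρ g F)‖ ^ 2) =
      ENNReal.ofReal (‖toL2 k ρ F‖ ^ 2) := by
    rw [norm_toL2_sq, norm_toL2_sq]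
    refine lintegral_sphere_rowMul (f := fun z => ‖F.1 z‖ₑ ^ 2) ?_ ?_ g
    · exact (measurable_principalSeries F).enorm.pow_const 2
    · intro r hr z
      have hr' : (r : ℂ) ≠ 0 := by exact_mod_cast hr.ne'
      have h2 : r • z = (r : ℂ) • z := (Complex.coe_smul r z).symm
      simp only
      rw [h2, F.2.2.2 _ hr', enorm_mul, mul_pow, ← ofReal_norm (psFactor k ρ _), norm_psFactor hr',
        ← ENNReal.ofReal_pow (by positivity)]
      congr 2
      rw [Complex.norm_real, Real.norm_of_nonneg hr.le, inv_pow, ← pow_mul]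
  have h2 := (ENNReal.ofReal_eq_ofReal_iff (by positivity) (by positivity)).1 h1
  exact (sq_eq_sq₀ (norm_nonneg _) (norm_nonneg _)).1 h2

theorem psInner_rep (g : SL2C) (F G : PrincipalSeries k ρ) :
    psInner (principalSeriesRep k ρ g F) (principalSeriesRep k ρ g G) = psInner F G := by
  simp only [← inner_toL2, inner_eq_sum_norm_sq_div_four, ← map_smul, ← map_add, ← map_sub,
    norm_toL2_rep]

/-! ### The lowest weight vectors -/

theorem norm_lowestFun_sq (k : ℕ) (ρ : ℝ) (m : ℕ) (z : Spinor) :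
    ‖lowestFun k ρ m z‖ ^ 2 = ((k : ℝ) + 1) * k.choose m * ((‖z 0‖ ^ 2) ^ (k - m) *
      (‖z 1‖ ^ 2) ^ m) / (‖z‖ ^ 2) ^ (k + 2) := by
  by_cases hz : z = 0
  · simp [lowestFun, hz]
  have hz' : 0 < ‖z‖ := norm_pos_iff.2 hz
  rw [lowestFun, if_neg hz, norm_mul, norm_mul, norm_mul, norm_pow, norm_pow, Complex.norm_conj,
    Complex.norm_conj, Complex.norm_real, Complex.norm_cpow_eq_rpow_re_of_pos hz',
    Real.norm_of_nonneg (Real.sqrt_nonneg _)]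
  simp only [Complex.sub_re, Complex.mul_re, Complex.I_re, Complex.ofReal_re, zero_mul,
    Complex.I_im, Complex.ofReal_im, mul_zero, sub_zero, Complex.re_ofNat, Complex.natCast_re,
    zero_sub]
  rw [show (-2 - (k : ℝ)) = -((k + 2 : ℕ) : ℝ) by push_cast; ring, Real.rpow_neg hz'.le,
    Real.rpow_natCast, mul_pow, mul_pow, Real.sq_sqrt (by positivity)]
  rw [inv_pow, mul_pow, ← pow_mul, ← pow_mul, ← pow_mul, ← pow_mul, ← pow_mul, ← pow_mul,
    div_eq_mul_inv]
  simp only [mul_comm]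

/-- The binomial theorem. The formula later converts a bound on compression matrices into one on
spinor norms. -/
theorem sum_norm_lowestFun_sq (k : ℕ) (ρ : ℝ) (z : Spinor) :
    ∑ m : Fin (k + 1), ‖lowestFun k ρ m z‖ ^ 2 = ((k : ℝ) + 1) * ((‖z‖ ^ 2) ^ 2)⁻¹ := by
  have h1 : ∀ m : Fin (k + 1), ‖lowestFun k ρ m z‖ ^ 2 = ((k : ℝ) + 1) * ((‖z 1‖ ^ 2) ^ (m : ℕ) *
      (‖z 0‖ ^ 2) ^ (k - m) * k.choose m) / (‖z‖ ^ 2) ^ (k + 2) := by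
    intro m
    rw [norm_lowestFun_sq k ρ]
    ring
  simp only [h1]
  rw [← Finset.sum_div, ← Finset.mul_sum, Fin.sum_univ_eq_sum_range
    (fun m => (‖z 1‖ ^ 2) ^ m * (‖z 0‖ ^ 2) ^ (k - m) * (k.choose m : ℝ)), ← add_pow,
    add_comm (‖z 1‖ ^ 2), ← spinor_norm_sq]
  by_cases hz : z = 0
  · simp [hz]
  have hz' : 0 < ‖z‖ := norm_pos_iff.2 hz
  rw [pow_add]
  field_simp

theorem norm_lowestFun_le (k : ℕ) (ρ : ℝ) (m : Fin (k + 1)) (z : Spinor) :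
    ‖lowestFun k ρ m z‖ ≤ √((k : ℝ) + 1) * (‖z‖ ^ 2)⁻¹ := by
  refine le_of_sq_le_sq ?_ (by positivity)
  rw [mul_pow, Real.sq_sqrt (by positivity), inv_pow, ← sum_norm_lowestFun_sq k ρ z]
  exact Finset.single_le_sum (f := fun m : Fin (k + 1) => ‖lowestFun k ρ m z‖ ^ 2)
    (fun _ _ => by positivity) (Finset.mem_univ m)

theorem norm_toL2_lowestVec (m : Fin (k + 1)) : ‖toL2 k ρ (lowestVec k ρ m)‖ = 1 := by
  have hm : (m : ℕ) ≤ k := Nat.lt_succ_iff.1 m.2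
  have h1 : ENNReal.ofReal (‖toL2 k ρ (lowestVec k ρ m)‖ ^ 2) = ENNReal.ofReal 1 := by
    have hmom := lintegral_sphere_moment (k - m) m
    rw [Nat.sub_add_cancel hm] at hmom
    have hpt : ∀ w : Metric.sphere (0 : Spinor) 1, ‖(lowestVec k ρ m).1 w‖ₑ ^ 2 =
        ENNReal.ofReal (((k : ℝ) + 1) * k.choose m) *
        ENNReal.ofReal (‖(w : Spinor) 0‖ ^ (2 * (k - m)) * ‖(w : Spinor) 1‖ ^ (2 * (m : ℕ))) := by
      intro w
      have hw : ‖(w : Spinor)‖ = 1 := by simp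
      rw [← ofReal_norm, ← ENNReal.ofReal_pow (norm_nonneg _), lowestVec,
        norm_lowestFun_sq k ρ, hw, ← ENNReal.ofReal_mul (by positivity)]
      congr 1
      rw [one_pow, one_pow, div_one, pow_mul, pow_mul]
    have hfac : (((k : ℝ) + 1) * k.choose m) * ((k - m).factorial * (m : ℕ).factorial) =
        (k + 1).factorial := by
      rw [Nat.factorial_succ, ← Nat.choose_mul_factorial_mul_factorial hm]
      push_cast
      ring
    rw [norm_toL2_sq, lintegral_congr hpt, lintegral_const_mul' _ _ ENNReal.ofReal_ne_top]
    have hpos : ENNReal.ofReal (k + 1).factorial ≠ 0 := by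
      rw [Ne, ENNReal.ofReal_eq_zero, not_le]
      exact_mod_cast Nat.factorial_pos _
    refine (ENNReal.mul_right_inj hpos ENNReal.ofReal_ne_top).1 ?_
    rw [mul_left_comm, hmom, ← ENNReal.ofReal_mul (by positivity), hfac, ENNReal.ofReal_one, mul_one]
  have h2 := (ENNReal.ofReal_eq_ofReal_iff (by positivity) zero_le_one).1 h1
  exact (pow_eq_one_iff_of_nonneg (norm_nonneg _) two_ne_zero).1 h2

/-- The rotation by the angle `θ` in the diagonal torus. -/
def torus (θ : ℝ) : SL2C :=
  ⟨!![Complex.exp (θ * Complex.I), 0; 0, Complex.exp (-(θ * Complex.I))], by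
    rw [Matrix.det_fin_two_of, ← Complex.exp_add]
    simp⟩

theorem rowMul_torus_zero (θ : ℝ) (z : Spinor) :
    rowMul z (torus θ) 0 = z 0 * Complex.exp (θ * Complex.I) := by
  rw [rowMul_apply]
  simp [torus]

theorem rowMul_torus_one (θ : ℝ) (z : Spinor) :
    rowMul z (torus θ) 1 = z 1 * Complex.exp (-(θ * Complex.I)) := by
  rw [rowMul_apply]
  simp [torus]

theorem norm_rowMul_torus (θ : ℝ) (z : Spinor) : ‖rowMul z (torus θ)‖ = ‖z‖ := by
  refine (sq_eq_sq₀ (norm_nonneg _) (norm_nonneg _)).1 ?_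
  rw [spinor_norm_sq, spinor_norm_sq, rowMul_torus_zero, rowMul_torus_one, norm_mul, norm_mul,
    Complex.norm_exp_ofReal_mul_I, ← neg_mul, ← Complex.ofReal_neg, Complex.norm_exp_ofReal_mul_I,
    mul_one, mul_one]

theorem rep_torus_lowestVec (θ : ℝ) (m : Fin (k + 1)) :
    principalSeriesRep k ρ (torus θ) (lowestVec k ρ m) =
      Complex.exp ((2 * (m : ℝ) - k) * θ * Complex.I) • lowestVec k ρ m := by
  refine Subtype.ext (funext fun z => ?_)
  change lowestFun k ρ m (rowMul z (torus θ)) = _ * lowestFun k ρ m z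
  by_cases hz : z = 0
  · simp [hz, lowestFun, rowMul_zero]
  have hm : (m : ℕ) ≤ k := Nat.lt_succ_iff.1 m.2
  rw [lowestFun, lowestFun, if_neg hz, if_neg (rowMul_ne_zero hz _), norm_rowMul_torus,
    rowMul_torus_zero, rowMul_torus_one, map_mul, map_mul, mul_pow, mul_pow, ← Complex.exp_conj,
    ← Complex.exp_conj, ← Complex.exp_nat_mul, ← Complex.exp_nat_mul]
  have h1 : Complex.exp ((2 * (m : ℝ) - k) * θ * Complex.I) =
      Complex.exp (((k - (m : ℕ) : ℕ) : ℂ) * (starRingEnd ℂ) (θ * Complex.I)) *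
      Complex.exp ((m : ℕ) * (starRingEnd ℂ) (-(θ * Complex.I))) := by
    rw [← Complex.exp_add, Nat.cast_sub hm]
    congr 1
    simp only [map_neg, map_mul, Complex.conj_ofReal, Complex.conj_I]
    push_cast
    ring
  rw [h1]
  ring

/-- The two vectors have different weights under the diagonal torus. At the chosen angle their
relative phase is `e^{iπ} = -1`, so unitarity equates the inner product with its negative. -/
theorem psInner_lowestVec_of_ne {m n : Fin (k + 1)} (hmn : m ≠ n) :
    psInner (lowestVec k ρ m) (lowestVec k ρ n) = 0 := by
  have hne : ((n : ℕ) : ℝ) - (m : ℕ) ≠ 0 := by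
    rw [sub_ne_zero]
    intro h
    exact hmn (Fin.ext (by exact_mod_cast h.symm))
  let θ : ℝ := Real.pi / (2 * ((n : ℕ) - (m : ℕ)))
  have h := psInner_rep (torus θ) (lowestVec k ρ m) (lowestVec k ρ n)
  rw [rep_torus_lowestVec, rep_torus_lowestVec, ← inner_toL2, ← inner_toL2, map_smul, map_smul,
    inner_smul_left, inner_smul_right, ← Complex.exp_conj, ← mul_assoc, ← Complex.exp_add] at h
  have h2 : (starRingEnd ℂ) ((2 * ((m : ℕ) : ℝ) - k) * θ * Complex.I) +
      (2 * ((n : ℕ) : ℝ) - k) * θ * Complex.I = Real.pi * Complex.I := by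
    have h3 : (2 * (((n : ℕ) : ℝ) - (m : ℕ))) * θ = Real.pi := by
      simp only [θ]
      field_simp
    rw [← h3]
    simp only [map_mul, map_sub, Complex.conj_ofReal, Complex.conj_I, map_ofNat, map_natCast]
    push_cast
    ring
  rw [h2, Complex.exp_pi_mul_I] at h
  rw [← inner_toL2]
  linear_combination (-1 / 2 : ℂ) * h

theorem orthonormal_lowestVec (k : ℕ) (ρ : ℝ) :
    Orthonormal ℂ fun m : Fin (k + 1) => toL2 k ρ (lowestVec k ρ m) :=
  ⟨norm_toL2_lowestVec, fun m n hmn => by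
    simp only
    rw [inner_toL2, psInner_lowestVec_of_ne hmn]⟩

end PrincipalSeries

/-! ### Contractions -/

section Contraction

variable {ι : Type*} [Fintype ι]

/-- Matrices that do not increase the Hermitian norm. -/
def IsContraction (M : Matrix ι ι ℂ) : Prop :=
  ∀ x : ι → ℂ, ∑ i, ‖M.mulVec x i‖ ^ 2 ≤ ∑ i, ‖x i‖ ^ 2

theorem isContraction_one [DecidableEq ι] : IsContraction (1 : Matrix ι ι ℂ) := fun x => by
  rw [Matrix.one_mulVec]

theorem IsContraction.mul {M L : Matrix ι ι ℂ} (hM : IsContraction M) (hL : IsContraction L) :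
    IsContraction (M * L) := fun x => by
  rw [← Matrix.mulVec_mulVec]
  exact (hM _).trans (hL x)

theorem isContraction_list_prod [DecidableEq ι] {α : Type*} (l : List α) (f : α → Matrix ι ι ℂ)
    (h : ∀ a ∈ l, IsContraction (f a)) : IsContraction (l.map f).prod := by
  induction l with
  | nil => exact isContraction_one
  | cons a l ih =>
    rw [List.map_cons, List.prod_cons]
    exact (h a List.mem_cons_self).mul (ih fun b hb => h b (List.mem_cons_of_mem _ hb))

theorem IsContraction.sum_col_le [DecidableEq ι] {M : Matrix ι ι ℂ} (hM : IsContraction M) (j : ι) :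
    ∑ i, ‖M i j‖ ^ 2 ≤ 1 := by
  have h := hM (Pi.single j 1)
  have h2 : ∑ i, ‖(Pi.single j 1 : ι → ℂ) i‖ ^ 2 = 1 := by
    rw [Finset.sum_eq_single j (fun i _ hi => by simp [hi]) (by simp)]
    simp
  rw [h2] at h
  simpa [Matrix.mulVec_single_one] using h

theorem IsContraction.norm_entry_le [DecidableEq ι] {M : Matrix ι ι ℂ} (hM : IsContraction M)
    (i j : ι) : ‖M i j‖ ≤ 1 := by
  have h := (Finset.single_le_sum (f := fun i => ‖M i j‖ ^ 2) (fun _ _ => by positivity)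
    (Finset.mem_univ i)).trans (hM.sum_col_le j)
  exact (sq_le_one_iff₀ (norm_nonneg _)).1 h

theorem IsContraction.norm_trace_le [DecidableEq ι] {M : Matrix ι ι ℂ} (hM : IsContraction M) :
    ‖M.trace‖ ≤ Fintype.card ι := by
  refine (norm_sum_le _ _).trans ((Finset.sum_le_sum fun i _ => hM.norm_entry_le i i).trans ?_)
  simp

/-- With `y = Mᵀ x` one has `‖y‖² = ∑ xᵢ (M ȳ)ᵢ ≤ ‖x‖ ‖y‖` by the Cauchy-Schwarz inequality. -/
theorem IsContraction.transpose {M : Matrix ι ι ℂ} (hM : IsContraction M) :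
    IsContraction M.transpose := by
  intro x
  set y : ι → ℂ := M.transpose.mulVec x with hy
  set S := ∑ i, ‖y i‖ ^ 2 with hS
  set T := ∑ i, ‖x i‖ ^ 2 with hT
  have hS0 : 0 ≤ S := Finset.sum_nonneg fun _ _ => by positivity
  have hT0 : 0 ≤ T := Finset.sum_nonneg fun _ _ => by positivity
  set z : ι → ℂ := fun i => (starRingEnd ℂ) (y i)
  have h1 : (S : ℂ) = ∑ i, x i * M.mulVec z i := by
    rw [hS]
    push_cast
    have h2 : ∀ i, ((‖y i‖ : ℂ)) ^ 2 = y i * z i := fun i => by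
      rw [Complex.mul_conj, Complex.normSq_eq_norm_sq]
      push_cast
      rfl
    simp only [h2]
    have h3 : dotProduct y z = dotProduct x (M.mulVec z) := by
      rw [hy, Matrix.mulVec_transpose, Matrix.dotProduct_mulVec]
    exact h3
  have hz : ∑ i, ‖M.mulVec z i‖ ^ 2 ≤ S := by
    refine (hM z).trans (le_of_eq ?_)
    simp [z, hS]
  have h4 : S ≤ ∑ i, ‖x i‖ * ‖M.mulVec z i‖ := by
    have h5 : ‖(S : ℂ)‖ = S := by rw [Complex.norm_real, Real.norm_of_nonneg hS0]
    rw [← h5, h1]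
    refine (norm_sum_le _ _).trans (le_of_eq ?_)
    simp
  have h6 : S ^ 2 ≤ T * S := by
    calc S ^ 2 ≤ (∑ i, ‖x i‖ * ‖M.mulVec z i‖) ^ 2 := by gcongr
      _ ≤ T * ∑ i, ‖M.mulVec z i‖ ^ 2 := Finset.sum_mul_sq_le_sq_mul_sq _ _ _
      _ ≤ T * S := by gcongr
  nlinarith

/-- A contraction whose trace has the largest possible modulus is a multiple of the identity. -/
theorem IsContraction.eq_smul_one [DecidableEq ι] [Nonempty ι] {M : Matrix ι ι ℂ}
    (hM : IsContraction M) (h : (Fintype.card ι : ℝ) ≤ ‖M.trace‖) :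
    ∃ c : ℂ, ‖c‖ = 1 ∧ M = c • 1 := by
  have hd : (0 : ℝ) < Fintype.card ι := by exact_mod_cast Fintype.card_pos
  have heq : ‖M.trace‖ = Fintype.card ι := le_antisymm hM.norm_trace_le h
  have htr : M.trace ≠ 0 := norm_pos_iff.1 (hd.trans_le h)
  set c : ℂ := M.trace / ‖M.trace‖ with hcdef
  have hn : (‖M.trace‖ : ℂ) ≠ 0 := by exact_mod_cast (norm_pos_iff.2 htr).ne'
  have hc : ‖c‖ = 1 := by
    rw [hcdef, norm_div, Complex.norm_real, norm_norm, div_self (norm_pos_iff.2 htr).ne']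
  have hcc : (starRingEnd ℂ) c * c = 1 := by
    rw [mul_comm, Complex.mul_conj, Complex.normSq_eq_norm_sq, hc]
    simp
  -- After division by the phase `c`, the diagonal entries have real part at most `1` and trace
  -- equal to the dimension, so all are `1`. The column bound then leaves no room for off-diagonal
  -- entries.
  have hsum : ∑ i, ((starRingEnd ℂ) c * M i i).re = ∑ _i : ι, (1 : ℝ) := by
    rw [← Complex.re_sum, ← Finset.mul_sum]
    have h1 : ∑ i, M i i = c * ‖M.trace‖ := by
      rw [hcdef, div_mul_cancel₀ _ hn]
      rfl
    rw [h1, ← mul_assoc, hcc, one_mul, Complex.ofReal_re, heq]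
    simp
  have hle : ∀ i ∈ Finset.univ, ((starRingEnd ℂ) c * M i i).re ≤ (1 : ℝ) := by
    intro i _
    refine (Complex.re_le_norm _).trans ?_
    rw [norm_mul, Complex.norm_conj, hc, one_mul]
    exact hM.norm_entry_le i i
  have hone := (Finset.sum_eq_sum_iff_of_le hle).1 hsum
  have hdiag : ∀ i, M i i = c := by
    intro i
    set u := (starRingEnd ℂ) c * M i i with hu
    have h1 : u.re = 1 := hone i (Finset.mem_univ i)
    have h2 : ‖u‖ ≤ 1 := by
      rw [hu, norm_mul, Complex.norm_conj, hc, one_mul]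
      exact hM.norm_entry_le i i
    have h3 : u.re ^ 2 + u.im ^ 2 ≤ 1 := by
      have : ‖u‖ ^ 2 = u.re ^ 2 + u.im ^ 2 := by
        rw [← Complex.normSq_eq_norm_sq, Complex.normSq_apply]
        ring
      rw [← this]
      exact (sq_le_one_iff₀ (norm_nonneg _)).2 h2
    have h4 : u.im = 0 := by nlinarith [sq_nonneg u.im]
    have h5 : u = 1 := Complex.ext h1 h4
    linear_combination c * h5 - (M i i) * hcc
  refine ⟨c, hc, ?_⟩
  ext i j
  by_cases hij : i = j
  · subst hij
    simp [hdiag]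
  · have h1 := hM.sum_col_le j
    have h2 : ‖M i j‖ ^ 2 + ‖M j j‖ ^ 2 ≤ ∑ i, ‖M i j‖ ^ 2 := by
      have := Finset.sum_le_univ_sum_of_nonneg (f := fun i => ‖M i j‖ ^ 2) (s := {i, j})
        (fun _ => by positivity)
      rwa [Finset.sum_pair hij] at this
    rw [hdiag, hc] at h2
    have h3 : ‖M i j‖ = 0 := by nlinarith [norm_nonneg (M i j)]
    simp [norm_eq_zero.1 h3, hij]

/-- If a product of contractions is a phase, then every factor is isometric. -/
theorem sum_col_eq_one_of_prod_eq_smul [DecidableEq ι] {α : Type*} {l : List α}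
    {f : α → Matrix ι ι ℂ} (h : ∀ a ∈ l, IsContraction (f a)) {c : ℂ} (hc : ‖c‖ = 1)
    (hprod : (l.map f).prod = c • 1) {a : α} (ha : a ∈ l) (j : ι) : ∑ i, ‖f a i j‖ ^ 2 = 1 := by
  obtain ⟨s, t, rfl⟩ := List.append_of_mem ha
  have hcs : ∀ b ∈ s, IsContraction (f b) := fun b hb => h b (by simp [hb])
  have hct : ∀ b ∈ t, IsContraction (f b) := fun b hb => h b (by simp [hb])
  have hca : IsContraction (f a) := h a (by simp)
  set A := (s.map f).prod
  set B := (t.map f).prod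
  have hc0 : c ≠ 0 := by
    rintro rfl
    simp at hc
  have h1 : A * (f a * B) = c • 1 := by
    simpa [A, B, mul_assoc] using hprod
  have h2 : (c⁻¹ • A) * (f a * B) = 1 := by
    rw [Matrix.smul_mul, h1, smul_smul, inv_mul_cancel₀ hc0, one_smul]
  have h3 : f a * (B * (c⁻¹ • A)) = 1 := by
    rw [← mul_assoc]
    exact mul_eq_one_comm.1 h2
  -- The factor has a left inverse that is itself a contraction, so it cannot shrink any vector.
  have h4 : (B * (c⁻¹ • A)) * f a = 1 := mul_eq_one_comm.1 h3
  have hAc : IsContraction (c⁻¹ • A) := fun x => by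
    have := isContraction_list_prod s f hcs x
    simpa [Matrix.smul_mulVec, mul_pow, hc] using this
  have h5 := ((isContraction_list_prod t f hct).mul hAc) ((f a).mulVec (Pi.single j 1))
  rw [Matrix.mulVec_mulVec, h4, Matrix.one_mulVec] at h5
  refine le_antisymm (hca.sum_col_le j) ?_
  have h6 : ∑ i, ‖(Pi.single j 1 : ι → ℂ) i‖ ^ 2 = 1 := by
    rw [Finset.sum_eq_single j (fun i _ hi => by simp [hi]) (by simp)]
    simp
  rw [h6] at h5
  simpa [Matrix.mulVec_single_one] using h5

end Contraction

/-! ### The compression to the lowest weight space -/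

section Compression

variable {k : ℕ} {ρ : ℝ}

theorem compression_apply (g : SL2C) (m n : Fin (k + 1)) : compression k ρ g m n =
    inner ℂ (toL2 k ρ (lowestVec k ρ m)) (toL2 k ρ (principalSeriesRep k ρ g (lowestVec k ρ n))) := by
  rw [inner_toL2]
  rfl

/-- Bessel's inequality for the orthonormal lowest vectors, applied to the unitary image of `∑ x n •
lowestVec n`. -/
theorem isContraction_compression (g : SL2C) : IsContraction (compression k ρ g) := by
  intro x
  set F : PrincipalSeries k ρ := ∑ n, x n • lowestVec k ρ n
  have h1 : ∀ m, (compression k ρ g).mulVec x m =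
      inner ℂ (toL2 k ρ (lowestVec k ρ m)) (toL2 k ρ (principalSeriesRep k ρ g F)) := by
    intro m
    simp only [F, map_sum, map_smul, inner_sum, inner_smul_right, ← compression_apply]
    simp only [Matrix.mulVec, dotProduct, mul_comm]
  have h2 := (orthonormal_lowestVec k ρ).sum_inner_products_le (s := Finset.univ)
    (toL2 k ρ (principalSeriesRep k ρ g F))
  simp only [← h1, norm_toL2_rep] at h2
  refine h2.trans (le_of_eq ?_)
  have h3 : ((‖toL2 k ρ F‖ ^ 2 : ℝ) : ℂ) = ((∑ i, ‖x i‖ ^ 2 : ℝ) : ℂ) := by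
    have h4 : toL2 k ρ F = ∑ n, x n • toL2 k ρ (lowestVec k ρ n) := by
      simp only [F, map_sum, map_smul]
    have h5 := (orthonormal_lowestVec k ρ).inner_sum x x Finset.univ
    rw [← h4, inner_self_eq_norm_sq_to_K] at h5
    push_cast
    refine h5.trans (Finset.sum_congr rfl fun i _ => ?_)
    rw [mul_comm, Complex.mul_conj, Complex.normSq_eq_norm_sq]
    push_cast
    rfl
  exact_mod_cast h3

/-- If a column of the compression is normalised, the image stays in the lowest weight space. -/
theorem rep_lowestVec_eq_sum (g : SL2C) (n : Fin (k + 1))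
    (h : ∑ m, ‖compression k ρ g m n‖ ^ 2 = 1) :
    principalSeriesRep k ρ g (lowestVec k ρ n) =
      ∑ m, compression k ρ g m n • lowestVec k ρ m := by
  refine toL2_injective ?_
  set y := toL2 k ρ (principalSeriesRep k ρ g (lowestVec k ρ n)) with hy
  have h1 : ‖y‖ = 1 := by rw [hy, norm_toL2_rep, norm_toL2_lowestVec]
  have hsum : ∑ m, (starRingEnd ℂ) (compression k ρ g m n) * compression k ρ g m n = 1 := by
    have h2 : ((∑ m, ‖compression k ρ g m n‖ ^ 2 : ℝ) : ℂ) = 1 := by rw [h]; simp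
    rw [← h2]
    push_cast
    refine Finset.sum_congr rfl fun m _ => ?_
    rw [mul_comm, Complex.mul_conj, Complex.normSq_eq_norm_sq]
    push_cast
    rfl
  rw [map_sum]
  simp only [map_smul]
  set p := ∑ m, compression k ρ g m n • toL2 k ρ (lowestVec k ρ m) with hp
  have h3 : inner ℂ p y = 1 := by
    rw [hp, sum_inner, ← hsum]
    refine Finset.sum_congr rfl fun m _ => ?_
    rw [inner_smul_left, hy, ← compression_apply]
  have h4 : inner ℂ p p = 1 := by
    rw [hp, (orthonormal_lowestVec k ρ).inner_sum, hsum]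
  have h5 : ‖p‖ ^ 2 = 1 := by
    rw [inner_self_eq_norm_sq_to_K] at h4
    have h4' : ((‖p‖ ^ 2 : ℝ) : ℂ) = 1 := by
      push_cast
      exact h4
    exact_mod_cast h4'
  have h6 : ‖p - y‖ ^ 2 = 0 := by
    rw [norm_sub_sq (𝕜 := ℂ), h3, h1, h5]
    norm_num
  exact (sub_eq_zero.1 (norm_eq_zero.1 (pow_eq_zero_iff two_ne_zero |>.1 h6))).symm

/-- When every factor maps the lowest weight space into itself, the intermediate projections can be
omitted, so the product of compressions represents the product of the group elements. -/
theorem rep_prod_lowestVec {α : Type*} (l : List α) (f : α → SL2C)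
    (h : ∀ a ∈ l, ∀ n, ∑ m, ‖compression k ρ (f a) m n‖ ^ 2 = 1) (n : Fin (k + 1)) :
    principalSeriesRep k ρ (l.map f).prod (lowestVec k ρ n) =
      ∑ m, (l.map fun a => compression k ρ (f a)).prod m n • lowestVec k ρ m := by
  induction l generalizing n with
  | nil => simp [Matrix.one_apply]
  | cons a l ih =>
    rw [List.map_cons, List.prod_cons, map_mul, Module.End.mul_apply,
      ih (fun b hb => h b (List.mem_cons_of_mem _ hb)), map_sum]
    simp only [map_smul, rep_lowestVec_eq_sum (f a) _ (h a List.mem_cons_self _), Finset.smul_sum,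
      smul_smul]
    rw [Finset.sum_comm]
    refine Finset.sum_congr rfl fun m _ => ?_
    rw [← Finset.sum_smul, List.map_cons, List.prod_cons, Matrix.mul_apply]
    simp only [mul_comm]

/-- If the compression is isometric then `g` does not shrink spinors. -/
theorem norm_le_norm_rowMul_of_isometric (g : SL2C)
    (h : ∀ n, ∑ m, ‖compression k ρ g m n‖ ^ 2 = 1) (z : Spinor) : ‖z‖ ≤ ‖rowMul z g‖ := by
  by_cases hz : z = 0
  · simp [hz]
  have hz1 : 0 < ‖z‖ := norm_pos_iff.2 hz
  have hz2 : 0 < ‖rowMul z g‖ := norm_pos_iff.2 (rowMul_ne_zero hz g)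
  have h1 : ∀ n : Fin (k + 1), lowestFun k ρ n (rowMul z g) =
      (compression k ρ g).transpose.mulVec (fun m => lowestFun k ρ m z) n := by
    intro n
    have h2 := congrArg (fun F : PrincipalSeries k ρ => F.1 z) (rep_lowestVec_eq_sum g n (h n))
    have h3 : (∑ m, compression k ρ g m n • lowestVec k ρ m : PrincipalSeries k ρ).1 z =
        ∑ m, compression k ρ g m n * lowestFun k ρ m z := by
      rw [Submodule.coe_sum, Finset.sum_apply]
      rfl
    exact h2.trans h3
  -- The transposed matrix maps the values of the lowest vectors at `z` to those at `z g`. The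
  -- squared norms of these value vectors are `(k+1)‖z‖⁻⁴` and `(k+1)‖z g‖⁻⁴`.
  have h4 := (isContraction_compression (k := k) (ρ := ρ) g).transpose
    (fun m => lowestFun k ρ m z)
  simp only [← h1] at h4
  rw [sum_norm_lowestFun_sq, sum_norm_lowestFun_sq] at h4
  have h5 := le_of_mul_le_mul_left h4 (by positivity)
  rw [inv_le_inv₀ (by positivity) (by positivity), ← pow_mul, ← pow_mul] at h5
  exact le_of_pow_le_pow_left₀ (by norm_num) (norm_nonneg _) h5

theorem nrm_sq_eq_rows (g : SL2C) : nrm g ^ 2 =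
    ‖rowMul (WithLp.toLp 2 ![1, 0]) g‖ ^ 2 + ‖rowMul (WithLp.toLp 2 ![0, 1]) g‖ ^ 2 := by
  rw [spinor_norm_sq, spinor_norm_sq, nrm, hsNorm_sq]
  simp only [rowMul_apply]
  simp
  ring

/-- Since `g` does not shrink spinors, `g⁻¹` does not stretch them, so both rows of `g⁻¹` have norm
at most `1`; `g` and `g⁻¹` have equal norm. -/
theorem nrm_le_sqrt_two_of_isometric (g : SL2C)
    (h : ∀ n, ∑ m, ‖compression k ρ g m n‖ ^ 2 = 1) : nrm g ≤ √2 := by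
  rw [← nrm_inv]
  refine Real.le_sqrt_of_sq_le ?_
  have h1 : ∀ z : Spinor, ‖rowMul z g⁻¹‖ ≤ ‖z‖ := by
    intro z
    have := norm_le_norm_rowMul_of_isometric g h (rowMul z g⁻¹)
    rwa [rowMul_mul, inv_mul_cancel, rowMul_one] at this
  have h2 : ∀ z : Spinor, ‖rowMul z g⁻¹‖ ^ 2 ≤ ‖z‖ ^ 2 := fun z => by
    have := h1 z
    gcongr
  have h3 := h2 (WithLp.toLp 2 ![1, 0])
  have h4 := h2 (WithLp.toLp 2 ![0, 1])
  rw [nrm_sq_eq_rows]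
  rw [spinor_norm_sq (WithLp.toLp 2 ![1, 0])] at h3
  rw [spinor_norm_sq (WithLp.toLp 2 ![0, 1])] at h4
  simp at h3 h4
  have h5 := pow_le_one₀ (n := 2) (norm_nonneg _) h3
  have h6 := pow_le_one₀ (n := 2) (norm_nonneg _) h4
  linarith

/-- For entries `a, b, c, d` one has `‖g‖² - 2 Re det g = |d - ā|² + |c + b̄|²`. The left side is at
most `0`, so `g` has the form of an `SU(2)` matrix. -/
theorem mem_su2_of_nrm_le {g : SL2C} (h : nrm g ≤ √2) :
    (g : Matrix (Fin 2) (Fin 2) ℂ) ∈ Matrix.specialUnitaryGroup (Fin 2) ℂ := by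
  have hN : nrm g ^ 2 ≤ 2 := by
    have h0 := nrm_pos g
    calc nrm g ^ 2 ≤ √2 ^ 2 := by gcongr
      _ = 2 := Real.sq_sqrt (by norm_num)
  rw [nrm, hsNorm_sq] at hN
  have hdet := det_eq_one g
  set M := (g : Matrix (Fin 2) (Fin 2) ℂ) with hM
  have hre := congrArg Complex.re hdet
  simp only [Complex.sub_re, Complex.mul_re, Complex.one_re] at hre
  simp only [← Complex.normSq_eq_norm_sq, Complex.normSq_apply] at hN
  have hz : ((M 1 1).re - (M 0 0).re) ^ 2 + ((M 1 1).im + (M 0 0).im) ^ 2 +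
      ((M 0 1).re + (M 1 0).re) ^ 2 + ((M 0 1).im - (M 1 0).im) ^ 2 ≤ 0 := by nlinarith
  have h1 : (M 1 1).re = (M 0 0).re := by
    nlinarith [sq_nonneg ((M 1 1).re - (M 0 0).re), sq_nonneg ((M 1 1).im + (M 0 0).im),
      sq_nonneg ((M 0 1).re + (M 1 0).re), sq_nonneg ((M 0 1).im - (M 1 0).im)]
  have h2 : (M 1 1).im = -(M 0 0).im := by
    nlinarith [sq_nonneg ((M 1 1).re - (M 0 0).re), sq_nonneg ((M 1 1).im + (M 0 0).im),
      sq_nonneg ((M 0 1).re + (M 1 0).re), sq_nonneg ((M 0 1).im - (M 1 0).im)]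
  have h3 : (M 1 0).re = -(M 0 1).re := by
    nlinarith [sq_nonneg ((M 1 1).re - (M 0 0).re), sq_nonneg ((M 1 1).im + (M 0 0).im),
      sq_nonneg ((M 0 1).re + (M 1 0).re), sq_nonneg ((M 0 1).im - (M 1 0).im)]
  have h4 : (M 1 0).im = (M 0 1).im := by
    nlinarith [sq_nonneg ((M 1 1).re - (M 0 0).re), sq_nonneg ((M 1 1).im + (M 0 0).im),
      sq_nonneg ((M 0 1).re + (M 1 0).re), sq_nonneg ((M 0 1).im - (M 1 0).im)]
  have h5 : M 1 1 = (starRingEnd ℂ) (M 0 0) := Complex.ext (by simp [h1]) (by simp [h2])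
  have h6 : M 1 0 = -(starRingEnd ℂ) (M 0 1) := Complex.ext (by simp [h3]) (by simp [h4])
  rw [h5, h6] at hdet
  refine Matrix.mem_specialUnitaryGroup_iff.2 ⟨Matrix.mem_unitaryGroup_iff.2 ?_, g.2⟩
  ext i j
  fin_cases i <;> fin_cases j <;>
    simp [Matrix.mul_apply, Fin.sum_univ_two, Matrix.star_eq_conjTranspose, h5, h6] <;>
    first | ring1 | linear_combination hdet

theorem nrm_of_mem_su2 {g : SL2C}
    (h : (g : Matrix (Fin 2) (Fin 2) ℂ) ∈ Matrix.specialUnitaryGroup (Fin 2) ℂ) : nrm g = √2 := by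
  have h1 := nrm_ofSU2_mul ⟨_, h⟩ 1
  rw [mul_one, nrm_one] at h1
  exact h1

theorem norm_rowMul_of_mem_su2 {g : SL2C}
    (h : (g : Matrix (Fin 2) (Fin 2) ℂ) ∈ Matrix.specialUnitaryGroup (Fin 2) ℂ) (z : Spinor) :
    ‖rowMul z g‖ = ‖z‖ :=
  norm_rowMul_ofSU2 z ⟨_, h⟩

/-- A unitary that acts by a phase on the lowest weight space of positive spin is `±1`. -/
theorem eq_units_smul_one_of_rep (hk : 1 ≤ k) {U : SL2C} (hU : ∀ z, ‖rowMul z U‖ = ‖z‖) {c : ℂ}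
    (hc : c ≠ 0)
    (h : ∀ n : Fin (k + 1), principalSeriesRep k ρ U (lowestVec k ρ n) = c • lowestVec k ρ n) :
    ∃ s : ℤˣ, (U : Matrix (Fin 2) (Fin 2) ℂ) = (((s : ℤ) : ℂ)) • 1 := by
  have key : ∀ m, m ≤ k → ∀ z : Spinor, z ≠ 0 →
      (starRingEnd ℂ) (rowMul z U 0) ^ (k - m) * (starRingEnd ℂ) (rowMul z U 1) ^ m =
        c * ((starRingEnd ℂ) (z 0) ^ (k - m) * (starRingEnd ℂ) (z 1) ^ m) := by
    intro m hm z hz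
    have h1 : lowestFun k ρ m (rowMul z U) = c * lowestFun k ρ m z :=
      congrArg (fun F : PrincipalSeries k ρ => F.1 z) (h ⟨m, Nat.lt_succ_of_le hm⟩)
    rw [lowestFun, lowestFun, if_neg hz, if_neg (rowMul_ne_zero hz _), hU] at h1
    have hA : (√(((k : ℝ) + 1) * (k.choose m : ℝ)) : ℂ) ≠ 0 := by
      have : 0 < k.choose m := Nat.choose_pos hm
      exact_mod_cast (Real.sqrt_pos.2 (by positivity)).ne'
    have hB : (‖z‖ : ℂ) ^ (Complex.I * (ρ : ℂ) - 2 - (k : ℂ)) ≠ 0 := by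
      rw [Ne, Complex.cpow_eq_zero_iff]
      have : (‖z‖ : ℂ) ≠ 0 := by exact_mod_cast (norm_pos_iff.2 hz).ne'
      tauto
    refine mul_left_cancel₀ hA (mul_right_cancel₀ hB ?_)
    rw [h1]
    ring
  have hne : ∀ z : Spinor, z 0 ≠ 0 ∨ z 1 ≠ 0 → z ≠ 0 := by
    rintro z hz rfl
    simp at hz
  -- The extreme monomials `m = 0` and `m = k`, evaluated at the basis spinors, annihilate the
  -- off-diagonal entries; for `k = 0` they would be constant.
  have h10 : (U : Matrix (Fin 2) (Fin 2) ℂ) 1 0 = 0 := by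
    have := key 0 (Nat.zero_le k) (WithLp.toLp 2 ![0, 1]) (hne _ (by simp))
    rw [rowMul_apply] at this
    simpa [Nat.one_le_iff_ne_zero.1 hk] using this
  have h01 : (U : Matrix (Fin 2) (Fin 2) ℂ) 0 1 = 0 := by
    have := key k le_rfl (WithLp.toLp 2 ![1, 0]) (hne _ (by simp))
    rw [rowMul_apply, rowMul_apply] at this
    simpa [Nat.one_le_iff_ne_zero.1 hk] using this
  have hz : (WithLp.toLp 2 ![1, 1] : Spinor) ≠ 0 := hne _ (by simp)
  have hk0 := key 0 (Nat.zero_le k) _ hz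
  have hk1 := key 1 hk _ hz
  have hdet := det_eq_one U
  rw [rowMul_apply, rowMul_apply] at hk0 hk1
  simp only [h10, h01, Matrix.cons_val_zero, Matrix.cons_val_one, one_mul, add_zero, zero_add,
    pow_zero, mul_one, map_one, one_pow, pow_one, Nat.sub_zero] at hk0 hk1
  -- At the spinor `(1, 1)` the monomials `m = 0` and `m = 1` acquire the same phase `c`, so the
  -- diagonal entries agree and the determinant leaves only a sign.
  have h11 : (U : Matrix (Fin 2) (Fin 2) ℂ) 1 1 = (U : Matrix (Fin 2) (Fin 2) ℂ) 0 0 := by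
    have hp : (starRingEnd ℂ) ((U : Matrix (Fin 2) (Fin 2) ℂ) 0 0) ^ k =
        (starRingEnd ℂ) ((U : Matrix (Fin 2) (Fin 2) ℂ) 0 0) ^ (k - 1) *
          (starRingEnd ℂ) ((U : Matrix (Fin 2) (Fin 2) ℂ) 0 0) := by
      rw [← pow_succ, Nat.sub_add_cancel hk]
    have hne0 : (starRingEnd ℂ) ((U : Matrix (Fin 2) (Fin 2) ℂ) 0 0) ^ (k - 1) ≠ 0 := by
      intro h0
      rw [h0, zero_mul] at hk1
      exact hc hk1.symm
    have h2 := mul_left_cancel₀ hne0 (hk1.trans (hk0.symm.trans hp))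
    exact (starRingEnd ℂ).injective h2
  rw [h11, h01, zero_mul, sub_zero] at hdet
  have hU : ∀ a : ℂ, (U : Matrix (Fin 2) (Fin 2) ℂ) 0 0 = a →
      (U : Matrix (Fin 2) (Fin 2) ℂ) = a • 1 := by
    intro a ha
    ext i j
    fin_cases i <;> fin_cases j <;> simp [h10, h01, h11, ha]
  rcases mul_self_eq_one_iff.1 hdet with h0 | h0
  · exact ⟨1, by simpa using hU 1 h0⟩
  · exact ⟨-1, by simpa using hU (-1) h0⟩

end Compression

/-! ### Bounds on the face amplitudes -/

section FaceAmplitudes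

variable {K : RootComplex}

theorem norm_tauInt_le (γ : ℝ) (k : ℕ) (h : K.FInt) (g : K.D → SL2C) :
    ‖tauInt γ k h g‖ ≤ ((k : ℝ) + 1) ^ 2 := by
  have h1 : IsContraction ((K.bdInt h).map fun c => compression k (rhoOf γ k) (wedge g c)).prod :=
    isContraction_list_prod _ _ fun _ _ => isContraction_compression _
  have h2 := h1.norm_trace_le
  rw [Fintype.card_fin] at h2
  have h3 : ‖(k : ℂ) + 1‖ = (k : ℝ) + 1 := by exact_mod_cast Complex.norm_natCast (k + 1)
  rw [tauInt, norm_mul, h3, sq]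
  push_cast at h2
  gcongr

/-- The face amplitude has its largest possible modulus only on the critical manifold. -/
theorem exists_inCh_of_le_norm_tauInt {γ : ℝ} {k : ℕ} (hk : 1 ≤ k) {h : K.FInt} {g : K.D → SL2C}
    (hle : ((k : ℝ) + 1) ^ 2 ≤ ‖tauInt γ k h g‖) : ∃ s : ℤˣ, InCh h s g := by
  have hC : ∀ c ∈ K.bdInt h, IsContraction (compression k (rhoOf γ k) (wedge g c)) :=
    fun _ _ => isContraction_compression _
  have h1 := isContraction_list_prod (K.bdInt h) _ hC
  have h3 : ‖(k : ℂ) + 1‖ = (k : ℝ) + 1 := by exact_mod_cast Complex.norm_natCast (k + 1)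
  rw [tauInt, norm_mul, h3, sq] at hle
  have h4 := le_of_mul_le_mul_left hle (by positivity)
  obtain ⟨c, hc, hprod⟩ := h1.eq_smul_one (by rw [Fintype.card_fin]; exact_mod_cast h4)
  -- The product of the compressions is a phase, so each one is isometric. This makes each wedge
  -- unitary and lets the full product act by that phase on the lowest weight space.
  have hcol : ∀ a ∈ K.bdInt h, ∀ n, ∑ m, ‖compression k (rhoOf γ k) (wedge g a) m n‖ ^ 2 = 1 :=
    fun a ha n => sum_col_eq_one_of_prod_eq_smul hC hc hprod ha n
  have hsu : ∀ a ∈ K.bdInt h, (wedge g a : Matrix (Fin 2) (Fin 2) ℂ) ∈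
      Matrix.specialUnitaryGroup (Fin 2) ℂ := fun a ha =>
    mem_su2_of_nrm_le (nrm_le_sqrt_two_of_isometric _ (hcol a ha))
  have hnorm : ∀ (l : List (K.D × K.D)), (∀ a ∈ l, a ∈ K.bdInt h) → ∀ z,
      ‖rowMul z (l.map (wedge g)).prod‖ = ‖z‖ := by
    intro l
    induction l with
    | nil => intro _ z; simp [rowMul_one]
    | cons a l ih =>
      intro hl z
      rw [List.map_cons, List.prod_cons, ← rowMul_mul,
        ih (fun b hb => hl b (List.mem_cons_of_mem _ hb)),
        norm_rowMul_of_mem_su2 (hsu a (hl a List.mem_cons_self))]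
  have hrep : ∀ n, principalSeriesRep k (rhoOf γ k) ((K.bdInt h).map (wedge g)).prod
      (lowestVec k (rhoOf γ k) n) = c • lowestVec k (rhoOf γ k) n := by
    intro n
    rw [rep_prod_lowestVec _ _ hcol, hprod]
    simp [Matrix.one_apply]
  have hc0 : c ≠ 0 := by
    rintro rfl
    simp at hc
  obtain ⟨s, hs⟩ := eq_units_smul_one_of_rep hk (hnorm _ fun _ h => h) hc0 hrep
  exact ⟨s, hsu, hs⟩

end FaceAmplitudes

/-! ### Continuity and decay of the compression -/

theorem continuous_compression (k : ℕ) (ρ : ℝ) : Continuous (compression k ρ) := by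
  refine continuous_matrix fun m n => ?_
  have h1 : Continuous fun p : SL2C × Metric.sphere (0 : Spinor) 1 =>
      (starRingEnd ℂ) ((lowestVec k ρ m).1 p.2) * (lowestVec k ρ n).1 (rowMul p.2 p.1) := by
    refine Continuous.mul ?_ ?_
    · exact Complex.continuous_conj.comp
        ((continuous_sphere_principalSeries (lowestVec k ρ m)).comp continuous_snd)
    · have h2 : Continuous fun p : SL2C × Metric.sphere (0 : Spinor) 1 =>
          rowMul (p.2 : Spinor) p.1 :=
        continuous_rowMul_uncurry.comp
          ((continuous_subtype_val.comp continuous_snd).prodMk continuous_fst)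
      exact (lowestVec k ρ n).2.1.comp_continuous h2 fun p =>
        rowMul_ne_zero (sphere_ne_zero p.2) p.1
  have h3 := continuous_parametric_integral_of_continuous (μ := sphereMeasure)
    (f := fun (g : SL2C) (w : Metric.sphere (0 : Spinor) 1) =>
      (starRingEnd ℂ) ((lowestVec k ρ m).1 w) * (lowestVec k ρ n).1 (rowMul w g)) h1 isCompact_univ
  simp only [Measure.restrict_univ] at h3
  exact h3

/-- In the integral over the sphere the first vector is at most `√(k+1)` and the second, evaluated
at `w g`, at most `√(k+1) ‖w g‖⁻²`. -/
theorem enorm_compression_le (k : ℕ) (ρ : ℝ) (g : SL2C) (m n : Fin (k + 1)) :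
    ‖compression k ρ g m n‖ₑ ≤ ENNReal.ofReal ((k : ℝ) + 1) * spherical g := by
  have h1 : compression k ρ g m n = ∫ w : Metric.sphere (0 : Spinor) 1,
      (starRingEnd ℂ) (lowestFun k ρ m w) * lowestFun k ρ n (rowMul w g) ∂sphereMeasure := rfl
  rw [h1, spherical, ← lintegral_const_mul' _ _ ENNReal.ofReal_ne_top]
  refine (enorm_integral_le_lintegral_enorm _).trans (lintegral_mono fun w => ?_)
  have hw : ‖(w : Spinor)‖ = 1 := by simp
  have hpos : 0 < ‖rowMul (w : Spinor) g‖ := norm_pos_iff.2 (rowMul_ne_zero (sphere_ne_zero w) g)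
  have h2 := norm_lowestFun_le k ρ m (w : Spinor)
  have h3 := norm_lowestFun_le k ρ n (rowMul (w : Spinor) g)
  rw [hw, one_pow, inv_one, mul_one] at h2
  rw [← ofReal_norm, ← ofReal_norm (rowMul _ _), ENNReal.ofReal_rpow_of_pos hpos,
    ← ENNReal.ofReal_mul (by positivity), norm_mul, Complex.norm_conj]
  refine ENNReal.ofReal_le_ofReal ?_
  calc ‖lowestFun k ρ m w‖ * ‖lowestFun k ρ n (rowMul w g)‖
      ≤ √((k : ℝ) + 1) * (√((k : ℝ) + 1) * (‖rowMul (w : Spinor) g‖ ^ 2)⁻¹) := by gcongr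
    _ = _ := by
      rw [← mul_assoc, Real.mul_self_sqrt (by positivity), Real.rpow_neg hpos.le, Real.rpow_two]

/-- The loss `e = 1/4` yields the exponent `3/2`: below the limit `2` of the decay, yet large enough
for three corners to exceed `4`. The constant is uniform in `k` and `ρ`. -/
theorem exists_norm_compression_le : ∃ C : ℝ, 1 ≤ C ∧ ∀ (k : ℕ) (ρ : ℝ) (g : SL2C)
    (m n : Fin (k + 1)), ‖compression k ρ g m n‖ ≤ ((k : ℝ) + 1) * C * nrm g ^ (-(3 / 2 : ℝ)) := by
  obtain ⟨C, hC, hle⟩ := spherical_le (e := 1 / 4) (by norm_num) (by norm_num)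
  refine ⟨max C.toReal 1, le_max_right _ _, fun k ρ g m n => ?_⟩
  have h1 := (enorm_compression_le k ρ g m n).trans (mul_le_mul_right (hle g) _)
  rw [show (-2 + 2 * (1 / 4) : ℝ) = -(3 / 2) by norm_num, ← ENNReal.ofReal_toReal hC,
    ← ENNReal.ofReal_mul ENNReal.toReal_nonneg, ← ENNReal.ofReal_mul (by positivity),
    ← ofReal_norm, ENNReal.ofReal_le_ofReal_iff (mul_nonneg (by positivity)
      (mul_nonneg ENNReal.toReal_nonneg (nrm_rpow_nonneg _ _)))] at h1
  refine h1.trans ?_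
  rw [mul_assoc]
  have := nrm_rpow_nonneg g (-(3 / 2 : ℝ))
  gcongr
  exact le_max_left _ _

theorem norm_list_prod_entry_le {α : Type*} (l : List α) {d : ℕ} (f : α → Matrix (Fin d) (Fin d) ℂ)
    (b : α → ℝ) (B : ℝ) (hB : 0 ≤ B) (hb : ∀ a, 0 ≤ b a) (h : ∀ a i j, ‖f a i j‖ ≤ B * b a)
    (i j : Fin d) : ‖(l.map f).prod i j‖ ≤ (d * B) ^ l.length * (l.map b).prod := by
  induction l generalizing i with
  | nil =>
    simp only [List.map_nil, List.prod_nil, List.length_nil, pow_zero, mul_one, Matrix.one_apply]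
    split_ifs <;> simp
  | cons a l ih =>
    rw [List.map_cons, List.prod_cons, Matrix.mul_apply, List.map_cons, List.prod_cons,
      List.length_cons]
    refine (norm_sum_le _ _).trans ?_
    have h1 : ∀ m ∈ Finset.univ, ‖f a i m * (l.map f).prod m j‖ ≤
        (B * b a) * ((d * B) ^ l.length * (l.map b).prod) := fun m _ => by
      rw [norm_mul]
      exact mul_le_mul (h a i m) (ih m) (norm_nonneg _) (mul_nonneg hB (hb a))
    refine (Finset.sum_le_sum h1).trans (le_of_eq ?_)
    rw [Finset.sum_const, Finset.card_univ, Fintype.card_fin, nsmul_eq_mul]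
    ring

section FaceAmplitudes

variable {K : RootComplex}

/-- The face amplitudes are bounded by the corner kernels, polynomially in the spin. -/
theorem exists_norm_tauInt_le (γ : ℝ) (h : K.FInt) : ∃ (P : ℝ) (m : ℕ), 0 ≤ P ∧
    ∀ (k : ℕ) (g : K.D → SL2C),
      ‖tauInt γ k h g‖ ≤ P * ((k : ℝ) + 1) ^ m * faceKernel (K.bdInt h) g := by
  obtain ⟨C, hC, hle⟩ := exists_norm_compression_le
  -- Powers of `k + 1`: one from `d_k`, one from the trace, and two for each corner, from the matrix
  -- size and from the entry bound.
  refine ⟨C ^ (K.bdInt h).length, 2 + 2 * (K.bdInt h).length, by positivity, fun k g => ?_⟩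
  have h1 := norm_list_prod_entry_le (K.bdInt h)
    (fun c => compression k (rhoOf γ k) (wedge g c)) (fun c => nrm (wedge g c) ^ (-(3 / 2 : ℝ)))
    (((k : ℝ) + 1) * C) (by positivity) (fun _ => nrm_rpow_nonneg _ _)
    (fun _ _ _ => hle _ _ _ _ _)
  have h3 : ‖(k : ℂ) + 1‖ = (k : ℝ) + 1 := by exact_mod_cast Complex.norm_natCast (k + 1)
  rw [tauInt, norm_mul, h3]
  refine (mul_le_mul_of_nonneg_left ((norm_sum_le _ _).trans
    (Finset.sum_le_sum fun i _ => h1 i i)) (by positivity)).trans (le_of_eq ?_)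
  rw [Finset.sum_const, Finset.card_univ, Fintype.card_fin, nsmul_eq_mul, faceKernel]
  push_cast
  rw [mul_pow, mul_pow]
  ring

theorem exists_norm_tauBd_le (γ : ℝ) (b : K.FBd) : ∃ (P : ℝ) (m : ℕ), 0 ≤ P ∧
    ∀ (k : ℕ) (g : K.D → SL2C) (H : SU2),
      ‖tauBd γ k b g H‖ ≤ P * ((k : ℝ) + 1) ^ m * faceKernel (K.bdBd b) g := by
  obtain ⟨C, hC, hle⟩ := exists_norm_compression_le
  -- One power more than for an internal face, from the multiplication by the matrix of `H`, whose
  -- entries are at most `1`.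
  refine ⟨C ^ (K.bdBd b).length, 3 + 2 * (K.bdBd b).length, by positivity, fun k g H => ?_⟩
  have h1 := norm_list_prod_entry_le (K.bdBd b)
    (fun c => compression k (rhoOf γ k) (wedge g c)) (fun c => nrm (wedge g c) ^ (-(3 / 2 : ℝ)))
    (((k : ℝ) + 1) * C) (by positivity) (fun _ => nrm_rpow_nonneg _ _)
    (fun _ _ _ => hle _ _ _ _ _)
  have h3 : ‖(k : ℂ) + 1‖ = (k : ℝ) + 1 := by exact_mod_cast Complex.norm_natCast (k + 1)
  have hH := isContraction_compression (k := k) (ρ := rhoOf γ k) (ofSU2 H)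
  rw [tauBd, norm_mul, h3]
  set M := ((K.bdBd b).map fun c => compression k (rhoOf γ k) (wedge g c)).prod
  set R := (((k + 1 : ℕ) : ℝ) * (((k : ℝ) + 1) * C)) ^ (K.bdBd b).length *
    ((K.bdBd b).map fun c => nrm (wedge g c) ^ (-(3 / 2 : ℝ))).prod with hR
  have h4 : ‖(M * compression k (rhoOf γ k) (ofSU2 H)).trace‖ ≤ ((k : ℝ) + 1) * (((k : ℝ) + 1) * R) := by
    refine (norm_sum_le _ _).trans ?_
    have h5 : ∀ i ∈ Finset.univ, ‖(M * compression k (rhoOf γ k) (ofSU2 H)).diag i‖ ≤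
        ((k : ℝ) + 1) * R := by
      intro i _
      rw [Matrix.diag_apply, Matrix.mul_apply]
      refine (norm_sum_le _ _).trans ?_
      have h6 : ∀ j ∈ Finset.univ, ‖M i j * compression k (rhoOf γ k) (ofSU2 H) j i‖ ≤ R := by
        intro j _
        rw [norm_mul]
        exact (mul_le_of_le_one_right (norm_nonneg _) (hH.norm_entry_le j i)).trans (h1 i j)
      refine (Finset.sum_le_sum h6).trans (le_of_eq ?_)
      rw [Finset.sum_const, Finset.card_univ, Fintype.card_fin, nsmul_eq_mul]
      push_cast
      rfl
    refine (Finset.sum_le_sum h5).trans (le_of_eq ?_)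
    rw [Finset.sum_const, Finset.card_univ, Fintype.card_fin, nsmul_eq_mul]
    push_cast
    rfl
  refine (mul_le_mul_of_nonneg_left h4 (by positivity)).trans (le_of_eq ?_)
  rw [hR, faceKernel]
  push_cast
  rw [mul_pow, mul_pow]
  ring

theorem continuous_list_map_prod {X M α : Type*} [TopologicalSpace X] [TopologicalSpace M]
    [Monoid M] [ContinuousMul M] (l : List α) {f : X → α → M} (hf : ∀ a, Continuous fun x => f x a) :
    Continuous fun x => (l.map (f x)).prod := by
  induction l with
  | nil => simpa using continuous_const
  | cons a l ih =>
    simp only [List.map_cons, List.prod_cons]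
    exact (hf a).mul ih

theorem continuous_wedge (c : K.D × K.D) : Continuous fun g : K.D → SL2C => wedge g c :=
  ((continuous_apply c.1).inv).mul (continuous_apply c.2)

theorem continuous_tauInt (γ : ℝ) (k : ℕ) (h : K.FInt) : Continuous (tauInt γ k h) := by
  unfold tauInt
  exact continuous_const.mul (continuous_list_map_prod (M := Matrix (Fin (k + 1)) (Fin (k + 1)) ℂ) _
    fun c => (continuous_compression k _).comp (continuous_wedge c)).matrix_trace

theorem continuous_tauBd (γ : ℝ) (k : ℕ) (b : K.FBd) (H : SU2) :
    Continuous fun g => tauBd γ k b g H := by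
  unfold tauBd
  exact continuous_const.mul ((continuous_list_map_prod
    (M := Matrix (Fin (k + 1)) (Fin (k + 1)) ℂ) _
    fun c => (continuous_compression k _).comp (continuous_wedge c)).mul
      continuous_const).matrix_trace

variable {e₀ : K.V → K.D}

theorem continuous_full : Continuous (Config.full : Config K e₀ → K.D → SL2C) := by
  refine continuous_pi fun d => ?_
  unfold Config.full
  by_cases h : d ≠ e₀ (K.vert d)
  · simp only [dif_pos h]
    exact continuous_apply _
  · simp only [dif_neg h]
    exact continuous_const

theorem continuous_intFull : Continuous (IntConfig.full : IntConfig K e₀ → K.D → SL2C) := by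
  refine continuous_pi fun d => ?_
  unfold IntConfig.full
  by_cases h : d ≠ e₀ (K.vert d) ∧ K.IsInt d
  · simp only [dif_pos h]
    exact continuous_apply _
  · simp only [dif_neg h]
    exact continuous_const

theorem full_eq_toInt_full (x : Config K e₀) {d : K.D} (hd : K.IsInt d) :
    x.full d = x.toInt.full d := by
  unfold Config.full IntConfig.full
  by_cases h : d ≠ e₀ (K.vert d)
  · rw [dif_pos h, dif_pos ⟨h, hd⟩]
    rfl
  · rw [dif_neg h, dif_neg fun h' => h h'.1]

theorem wedge_full_eq (x : Config K e₀) {h : K.FInt} {c : K.D × K.D} (hc : c ∈ K.bdInt h) :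
    wedge x.full c = wedge x.toInt.full c := by
  rw [wedge, wedge, full_eq_toInt_full x ⟨h, c, hc, Or.inl rfl⟩,
    full_eq_toInt_full x ⟨h, c, hc, Or.inr rfl⟩]

theorem tauInt_full_eq (γ : ℝ) (k : ℕ) (h : K.FInt) (x : Config K e₀) :
    tauInt γ k h x.full = tauInt γ k h x.toInt.full := by
  have h1 : ((K.bdInt h).map fun c => compression k (rhoOf γ k) (wedge x.full c)) =
      (K.bdInt h).map fun c => compression k (rhoOf γ k) (wedge x.toInt.full c) :=
    List.map_congr_left fun c hc => by rw [wedge_full_eq x hc]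
  rw [tauInt, tauInt, h1]

theorem measurable_toInt : Measurable (Config.toInt : Config K e₀ → IntConfig K e₀) :=
  measurable_pi_lambda _ fun _ => measurable_pi_apply _

end FaceAmplitudes

/-! ### Sums over stacks -/

/-- The spin sequences of the stacks. -/
abbrev SpinSeq : Type := Σ p : ℕ, {k : Fin (p + 1) → ℕ // Monotone k ∧ ∀ i, 1 ≤ k i}

namespace SpinSeq

/-- The spins as a list. -/
def toList (s : SpinSeq) : List ℕ := List.ofFn s.2.1

theorem toList_injective : Function.Injective toList := by
  rintro ⟨p, k, hk⟩ ⟨p', k', hk'⟩ h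
  have hp : p = p' := by
    have := congrArg List.length h
    simpa [toList] using this
  subst hp
  have hkk : k = k' := List.ofFn_injective h
  subst hkk
  rfl

theorem toList_eq_of_count {s t : SpinSeq} (h : ∀ j, s.toList.count j = t.toList.count j) :
    s = t :=
  toList_injective (List.Perm.eq_of_sortedLE s.2.2.1.sortedLE_ofFn t.2.2.1.sortedLE_ofFn
    (List.perm_iff_count.2 h))

theorem prod_eq_prod_count (s : SpinSeq) (q : ℕ → ℝ) {n : ℕ} (hn : ∀ j ∈ s.toList, j < n) :
    ∏ i, q (s.2.1 i) = ∏ j : Fin n, q j ^ s.toList.count (j : ℕ) := by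
  rw [Fin.prod_univ_eq_prod_range (fun j => q j ^ s.toList.count j) n]
  have h1 : ∏ i, q (s.2.1 i) = (s.toList.map q).prod := by
    rw [toList, List.map_ofFn, List.prod_ofFn]
    rfl
  rw [h1, Finset.prod_list_map_count]
  refine Finset.prod_subset (fun j hj => ?_) fun j _ hj => ?_
  · exact Finset.mem_range.2 (hn j (List.mem_toFinset.1 hj))
  · rw [List.count_eq_zero.2 fun h => hj (List.mem_toFinset.2 h), pow_zero]

/-- A nondecreasing sequence is determined by the multiplicities of its values. Partial sums are
therefore bounded by finite parts of the partition product `∏ (1 - q j)⁻¹`, which is at most `exp (∑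
q j / (1 - r))`. -/
theorem summable_prod {q : ℕ → ℝ} (hq0 : ∀ j, 0 ≤ q j) {r : ℝ} (hr : r < 1) (hqr : ∀ j, q j ≤ r)
    (hsum : Summable q) : Summable fun s : SpinSeq => ∏ i, q (s.2.1 i) := by
  classical
  have hr1 : 0 < 1 - r := by linarith
  refine summable_of_sum_le (c := Real.exp ((∑' j, q j) / (1 - r)))
    (fun s => Finset.prod_nonneg fun i _ => hq0 _) fun u => ?_
  obtain ⟨n, hn⟩ : ∃ n, ∀ s ∈ u, ∀ j ∈ s.toList, j < n := by
    refine ⟨(u.sup fun s => s.toList.sum) + 1, fun s hs j hj => Nat.lt_succ_of_le ?_⟩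
    exact (List.le_sum_of_mem hj).trans (Finset.le_sup (f := fun s : SpinSeq => s.toList.sum) hs)
  obtain ⟨L, hL⟩ : ∃ L, ∀ s ∈ u, s.toList.length < L :=
    ⟨(u.sup fun s => s.toList.length) + 1, fun s hs => Nat.lt_succ_of_le
      (Finset.le_sup (f := fun s : SpinSeq => s.toList.length) hs)⟩
  let Φ : SpinSeq → Fin n → ℕ := fun s j => s.toList.count (j : ℕ)
  have hΦ : Set.InjOn Φ u := by
    intro s hs t ht hst
    refine toList_eq_of_count fun j => ?_
    by_cases hj : j < n
    · exact congrFun hst ⟨j, hj⟩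
    · rw [List.count_eq_zero.2 fun h => hj (hn s hs j h),
        List.count_eq_zero.2 fun h => hj (hn t ht j h)]
  calc ∑ s ∈ u, ∏ i, q (s.2.1 i) = ∑ s ∈ u, ∏ j : Fin n, q j ^ Φ s j :=
        Finset.sum_congr rfl fun s hs => prod_eq_prod_count s q (hn s hs)
    _ = ∑ c ∈ u.image Φ, ∏ j : Fin n, q j ^ c j := 
        (Finset.sum_image (f := fun c : Fin n → ℕ => ∏ j : Fin n, q j ^ c j) hΦ).symm
    _ ≤ ∑ c ∈ Fintype.piFinset fun _ : Fin n => Finset.range L, ∏ j : Fin n, q j ^ c j := by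
        refine Finset.sum_le_sum_of_subset_of_nonneg (fun c hc => ?_) fun c _ _ =>
          Finset.prod_nonneg fun j _ => pow_nonneg (hq0 _) _
        obtain ⟨s, hs, rfl⟩ := Finset.mem_image.1 hc
        exact Fintype.mem_piFinset.2 fun j =>
          Finset.mem_range.2 ((List.count_le_length).trans_lt (hL s hs))
    _ = ∏ j : Fin n, ∑ c ∈ Finset.range L, q j ^ c :=
        (Finset.prod_univ_sum (fun _ : Fin n => Finset.range L) fun j c => q j ^ c).symm
    _ ≤ ∏ j : Fin n, Real.exp (q j / (1 - r)) := by
        refine Finset.prod_le_prod (fun j _ => Finset.sum_nonneg fun c _ => pow_nonneg (hq0 _) _)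
          fun j _ => ?_
        have hj1 : q j < 1 := (hqr j).trans_lt hr
        have h1 : ∑ c ∈ Finset.range L, q j ^ c ≤ (1 - q j)⁻¹ := by
          rw [← tsum_geometric_of_lt_one (hq0 j) hj1]
          exact (summable_geometric_of_lt_one (hq0 j) hj1).sum_le_tsum _
            fun c _ => pow_nonneg (hq0 _) _
        refine h1.trans ?_
        have h2 : (1 - q j)⁻¹ ≤ q j / (1 - r) + 1 := by
          have h3 : 0 < 1 - q j := by linarith
          rw [inv_le_iff_one_le_mul₀ h3]
          have h4 : q j ≤ q j / (1 - r) * (1 - q j) := by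
            rw [div_mul_eq_mul_div, le_div_iff₀ hr1]
            exact mul_le_mul_of_nonneg_left (by linarith [hqr j]) (hq0 j)
          linarith
        exact h2.trans (Real.add_one_le_exp _)
    _ = Real.exp (∑ j : Fin n, q j / (1 - r)) := (Real.exp_sum _ _).symm
    _ ≤ Real.exp ((∑' j, q j) / (1 - r)) := by
        refine Real.exp_le_exp.2 ?_
        rw [← Finset.sum_div, Fin.sum_univ_eq_sum_range (fun j => q j) n]
        exact div_le_div_of_nonneg_right (hsum.sum_le_tsum _ fun j _ => hq0 j) hr1.le

end SpinSeq

/-- For large `k` the growth condition gives `k ≤ k ^ N ≤ C * E k`; for the finitely many `k < n`,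
`E k ≥ 1` suffices with the constant `n`. -/
theorem IsEnergy.exists_linear_le {E : ℕ → ℕ} (hE : IsEnergy E) :
    ∃ c : ℝ, 0 < c ∧ ∀ k, 1 ≤ k → c * k ≤ E k := by
  obtain ⟨N, hN, hΘ⟩ := hE.growth
  obtain ⟨C, hC, hb⟩ := hΘ.2.exists_pos
  obtain ⟨n, hn⟩ := eventually_atTop.1 hb.bound
  have hM : 0 < max C n := lt_max_of_lt_left hC
  refine ⟨(max C n)⁻¹, inv_pos.2 hM, fun k hk => ?_⟩
  rw [inv_mul_le_iff₀ hM]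
  have hE1 : (1 : ℝ) ≤ E k := by exact_mod_cast hE.pos k hk
  by_cases hkn : n ≤ k
  · have h1 := hn k hkn
    rw [Real.norm_of_nonneg (by positivity), Real.norm_of_nonneg (by positivity)] at h1
    have h2 : (k : ℝ) ≤ (k : ℝ) ^ N :=
      le_self_pow₀ (by exact_mod_cast hk) (by omega)
    exact (h2.trans h1).trans (mul_le_mul_of_nonneg_right (le_max_left _ _) (by linarith))
  · have h1 : (k : ℝ) ≤ n := by exact_mod_cast (not_le.1 hkn).le
    calc (k : ℝ) ≤ n := h1
      _ ≤ max C n := le_max_right _ _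
      _ ≤ max C n * E k := le_mul_of_one_le_right hM.le hE1

theorem IsEnergy.summable_prod_exp {E : ℕ → ℕ} (hE : IsEnergy E) {δ : ℝ} (hδ : 0 < δ) :
    Summable fun s : SpinSeq => ∏ i, Real.exp (-(δ * E (s.2.1 i))) := by
  obtain ⟨c, hc, hlin⟩ := hE.exists_linear_le
  -- The value `E 0` is unconstrained; spins start at `1`, so index `0` gets weight zero.
  let q : ℕ → ℝ := fun j => if j = 0 then 0 else Real.exp (-(δ * E j))
  have hq0 : ∀ j, 0 ≤ q j := fun j => by
    simp only [q]
    split_ifs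
    · exact le_rfl
    · positivity
  have hqr : ∀ j, q j ≤ Real.exp (-δ) := fun j => by
    simp only [q]
    split_ifs with hj
    · positivity
    · refine Real.exp_le_exp.2 (neg_le_neg ?_)
      have : (1 : ℝ) ≤ E j := by exact_mod_cast hE.pos j (Nat.one_le_iff_ne_zero.2 hj)
      nlinarith
  have hsum : Summable q := by
    refine Summable.of_nonneg_of_le hq0 (fun j => ?_)
      (summable_geometric_of_lt_one (r := Real.exp (-(δ * c))) (Real.exp_pos _).le
        (Real.exp_lt_one_iff.2 (by nlinarith)))
    simp only [q]
    split_ifs with hj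
    · positivity
    · rw [← Real.exp_nat_mul]
      refine Real.exp_le_exp.2 ?_
      have := hlin j (Nat.one_le_iff_ne_zero.2 hj)
      nlinarith
  have h := SpinSeq.summable_prod hq0 (Real.exp_lt_one_iff.2 (by linarith)) hqr hsum
  refine h.congr fun s => Finset.prod_congr rfl fun i _ => ?_
  have : s.2.1 i ≠ 0 := Nat.one_le_iff_ne_zero.1 (s.2.2.2 i)
  simp [q, this]

/-- The summands of the stack amplitude. -/
def stackTerm (E : ℕ → ℕ) (A : ℝ) (lam : ℂ) (τ : ℕ → ℕ → ℂ) (s : SpinSeq) : ℂ :=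
  lam ^ (s.1 + 1) * (∏ i : Fin (s.1 + 1), τ i (s.2.1 i)) *
    (stepTheta (A - ∑ i : Fin (s.1 + 1), (E (s.2.1 i) : ℝ)) : ℂ)

theorem stepTheta_of_neg {x : ℝ} (hx : x < 0) : stepTheta x = 0 := by
  rw [stepTheta, if_neg (by linarith), if_neg (by linarith)]

theorem norm_stepTheta_le (x : ℝ) : ‖(stepTheta x : ℂ)‖ ≤ 1 := by
  rw [Complex.norm_real, stepTheta]
  split_ifs <;> norm_num

/-- The stack amplitude is a finite sum. -/
theorem IsEnergy.exists_stackSum_eq_sum {E : ℕ → ℕ} (hE : IsEnergy E) (A : ℝ) :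
    ∃ T : Finset SpinSeq, ∀ (lam : ℂ) (τ : ℕ → ℕ → ℂ),
      stackSum E A lam τ = ∑ s ∈ T, stackTerm E A lam τ s := by
  -- Summability leaves only finitely many sequences with `∑ E ≤ A`. The resulting `T` depends on
  -- `E` and `A` alone, which makes the stack sum continuous in `τ`.
  have h1 := (hE.summable_prod_exp one_pos).tendsto_cofinite_zero
  have h2 := h1.eventually (gt_mem_nhds (Real.exp_pos (-A)))
  rw [eventually_cofinite] at h2
  refine ⟨h2.toFinset, fun lam τ => ?_⟩
  have h3 : ∀ s ∉ h2.toFinset, stackTerm E A lam τ s = 0 := by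
    intro s hs
    rw [Set.Finite.mem_toFinset, Set.mem_ofPred_eq, not_not, ← Real.exp_sum, Real.exp_lt_exp,
      Finset.sum_neg_distrib, neg_lt_neg_iff] at hs
    simp only [one_mul] at hs
    rw [stackTerm, stepTheta_of_neg (by linarith)]
    simp
  have h4 : Summable (stackTerm E A lam τ) := summable_of_ne_finset_zero h3
  exact h4.tsum_sigma.symm.trans (tsum_eq_sum h3)

theorem IsEnergy.exists_pow_le_exp {E : ℕ → ℕ} (hE : IsEnergy E) (m : ℕ) {δ : ℝ} (hδ : 0 < δ) :
    ∃ C : ℝ, 0 < C ∧ ∀ k : ℕ, 1 ≤ k → ((k : ℝ) + 1) ^ m ≤ C * Real.exp (δ * E k) := by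
  obtain ⟨c, hc, hlin⟩ := hE.exists_linear_le
  refine ⟨(m.factorial / (δ * c) ^ m) * Real.exp (δ * c), by positivity, fun k hk => ?_⟩
  have h1 := Real.pow_div_factorial_le_exp (δ * c * (k + 1)) (by positivity) m
  rw [div_le_iff₀ (by positivity), mul_pow] at h1
  have h2 : Real.exp (δ * c * (k + 1)) ≤ Real.exp (δ * c) * Real.exp (δ * E k) := by
    rw [← Real.exp_add]
    refine Real.exp_le_exp.2 ?_
    have := hlin k hk
    nlinarith
  rw [div_mul_eq_mul_div, div_mul_eq_mul_div, le_div_iff₀ (by positivity)]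
  calc ((k : ℝ) + 1) ^ m * (δ * c) ^ m ≤ Real.exp (δ * c * (k + 1)) * m.factorial := by
        rw [mul_comm]
        exact h1
    _ ≤ (Real.exp (δ * c) * Real.exp (δ * E k)) * m.factorial := by gcongr
    _ = _ := by ring

/-- The stack amplitude grows with the largest rate of its face amplitudes, and one of the face
amplitudes can be estimated separately. -/
theorem IsEnergy.exists_norm_stackSum_le {E : ℕ → ℕ} (hE : IsEnergy E) {b : ℝ} (hb : 0 ≤ b) (m : ℕ)
    {δ : ℝ} (hδ : 0 < δ) : ∃ C : ℝ, 0 < C ∧ ∀ (A : ℝ) (lam : ℂ) (τ : ℕ → ℕ → ℂ) (R : ℝ), 0 ≤ R →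
      (∀ i k, 1 ≤ k → ‖lam * τ i k‖ ≤ Real.exp (b * E k)) →
      (∀ i k, 1 ≤ k → ‖lam * τ i k‖ ≤ ((k : ℝ) + 1) ^ m * R) →
      ‖stackSum E A lam τ‖ ≤ C * Real.exp ((b + δ) * A) * R := by
  have hδ2 : 0 < δ / 2 := by linarith
  obtain ⟨C, hC, hpow⟩ := hE.exists_pow_le_exp m hδ2
  have hsum := hE.summable_prod_exp hδ2
  set S := ∑' s : SpinSeq, ∏ i, Real.exp (-(δ / 2 * E (s.2.1 i))) with hS
  have hS0 : 0 ≤ S := tsum_nonneg fun s => Finset.prod_nonneg fun i _ => (Real.exp_pos _).le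
  refine ⟨C * (S + 1), by positivity, fun A lam τ R hR h1 h2 => ?_⟩
  obtain ⟨T, hT⟩ := hE.exists_stackSum_eq_sum A
  have hterm : ∀ s : SpinSeq, ‖stackTerm E A lam τ s‖ ≤ C * Real.exp ((b + δ) * A) * R *
      ∏ i, Real.exp (-(δ / 2 * E (s.2.1 i))) := by
    intro s
    have hprod0 : 0 ≤ ∏ i, Real.exp (-(δ / 2 * E (s.2.1 i))) :=
      Finset.prod_nonneg fun i _ => (Real.exp_pos _).le
    by_cases hA : ∑ i : Fin (s.1 + 1), (E (s.2.1 i) : ℝ) ≤ A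
    · have e1 : lam ^ (s.1 + 1) * ∏ i : Fin (s.1 + 1), τ i (s.2.1 i) =
          ∏ i : Fin (s.1 + 1), lam * τ i (s.2.1 i) := by
        rw [Finset.prod_mul_distrib, Finset.prod_const, Finset.card_univ, Fintype.card_fin]
      have e2 : ‖stackTerm E A lam τ s‖ ≤ ∏ i : Fin (s.1 + 1), ‖lam * τ i (s.2.1 i)‖ := by
        rw [stackTerm, e1, norm_mul, norm_prod]
        exact mul_le_of_le_one_right (Finset.prod_nonneg fun _ _ => norm_nonneg _)
          (norm_stepTheta_le _)
      -- Only the first factor uses the bound by `R`: one integrable kernel per stack is enough. Its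
      -- polynomial in `k` is absorbed by `exp (δ/2 * E)`, and all other factors carry the rate `b`.
      have e3 : ∏ i : Fin (s.1 + 1), ‖lam * τ i (s.2.1 i)‖ ≤
          C * R * ∏ i : Fin (s.1 + 1), Real.exp ((b + δ / 2) * E (s.2.1 i)) := by
        rw [Fin.prod_univ_succ, Fin.prod_univ_succ, ← mul_assoc]
        refine mul_le_mul ?_ ?_ (Finset.prod_nonneg fun _ _ => norm_nonneg _) (by positivity)
        · refine (h2 _ _ (s.2.2.2 0)).trans ?_
          rw [mul_assoc, mul_comm R, ← mul_assoc]
          refine mul_le_mul_of_nonneg_right ((hpow _ (s.2.2.2 0)).trans ?_) hR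
          refine mul_le_mul_of_nonneg_left (Real.exp_le_exp.2 ?_) hC.le
          have : (0 : ℝ) ≤ E (s.2.1 0) := Nat.cast_nonneg _
          nlinarith
        · refine Finset.prod_le_prod (fun _ _ => norm_nonneg _) fun i _ => ?_
          refine (h1 _ _ (s.2.2.2 _)).trans (Real.exp_le_exp.2 ?_)
          have : (0 : ℝ) ≤ E (s.2.1 i.succ) := Nat.cast_nonneg _
          nlinarith
      -- Raising the rate from `b + δ/2` to `b + δ` before using `∑ E ≤ A` frees a factor `exp (-δ/2
      -- * ∑ E)` that makes the sum over all sequences converge.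
      have e4 : ∏ i : Fin (s.1 + 1), Real.exp ((b + δ / 2) * E (s.2.1 i)) ≤
          Real.exp ((b + δ) * A) * ∏ i, Real.exp (-(δ / 2 * E (s.2.1 i))) := by
        rw [← Real.exp_sum, ← Real.exp_sum, ← Real.exp_add, ← Finset.mul_sum,
          Finset.sum_neg_distrib, ← Finset.mul_sum]
        refine Real.exp_le_exp.2 ?_
        nlinarith
      calc ‖stackTerm E A lam τ s‖ ≤ _ := e2.trans e3
        _ ≤ C * R * (Real.exp ((b + δ) * A) * ∏ i, Real.exp (-(δ / 2 * E (s.2.1 i)))) := by gcongr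
        _ = _ := by ring
    · rw [stackTerm, stepTheta_of_neg (by linarith)]
      simp only [Complex.ofReal_zero, mul_zero, norm_zero]
      positivity
  rw [hT]
  calc ‖∑ s ∈ T, stackTerm E A lam τ s‖
      ≤ ∑ s ∈ T, C * Real.exp ((b + δ) * A) * R * ∏ i, Real.exp (-(δ / 2 * E (s.2.1 i))) :=
        norm_sum_le_of_le _ fun s _ => hterm s
    _ = C * Real.exp ((b + δ) * A) * R * ∑ s ∈ T, ∏ i, Real.exp (-(δ / 2 * E (s.2.1 i))) :=
        (Finset.mul_sum _ _ _).symm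
    _ ≤ C * Real.exp ((b + δ) * A) * R * (S + 1) := by
        refine mul_le_mul_of_nonneg_left ?_ (by positivity)
        have := hsum.sum_le_tsum T fun s _ => Finset.prod_nonneg fun i _ => (Real.exp_pos _).le
        linarith
    _ = _ := by ring

theorem IsEnergy.continuous_stackSum {E : ℕ → ℕ} (hE : IsEnergy E) (A : ℝ) (lam : ℂ) {X : Type*}
    [TopologicalSpace X] {τ : X → ℕ → ℕ → ℂ} (hτ : ∀ i k, Continuous fun x => τ x i k) :
    Continuous fun x => stackSum E A lam (τ x) := by
  obtain ⟨T, hT⟩ := hE.exists_stackSum_eq_sum A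
  simp only [hT, stackTerm]
  exact continuous_finsetSum _ fun s _ => (continuous_const.mul
    (continuous_finsetProd _ fun i _ => hτ _ _)).mul continuous_const

/-! ### Condensation spins -/

theorem exp_beta_mul {E : ℕ → ℕ} (hE : IsEnergy E) {lam : ℂ} (hlam : lam ≠ 0) {k : ℕ} (hk : 1 ≤ k) :
    Real.exp (beta E lam k * E k) = ‖lam‖ * ((k : ℝ) + 1) ^ 2 := by
  have h1 : (0 : ℝ) < E k := by exact_mod_cast hE.pos k hk
  have h2 : 0 < ‖lam‖ := norm_pos_iff.2 hlam
  rw [beta, div_mul_cancel₀ _ h1.ne', Real.exp_log (by positivity)]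

theorem IsCondensationSpin.le_betaStar {E : ℕ → ℕ} {lam : ℂ} {k₀ : ℕ}
    (h : IsCondensationSpin E lam k₀) {k : ℕ} (hk : 1 ≤ k) (hne : k ≠ k₀) :
    beta E lam k ≤ betaStar E lam k₀ := by
  refine le_csSup ⟨beta E lam k₀, ?_⟩ ⟨k, ⟨hk, hne⟩, rfl⟩
  rintro _ ⟨l, hl, rfl⟩
  exact (h.2 l hl.1 hl.2).le

theorem IsCondensationSpin.le_beta {E : ℕ → ℕ} {lam : ℂ} {k₀ : ℕ}
    (h : IsCondensationSpin E lam k₀) {k : ℕ} (hk : 1 ≤ k) : beta E lam k ≤ beta E lam k₀ := by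
  by_cases hne : k = k₀
  · rw [hne]
  · exact (h.2 k hk hne).le

/-- For large `k` the number `|λ| d_k²` exceeds `1`, and such `k` differ from `k₀`. -/
theorem IsCondensationSpin.betaStar_pos {E : ℕ → ℕ} (hE : IsEnergy E) {lam : ℂ} (hlam : lam ≠ 0)
    {k₀ : ℕ} (h : IsCondensationSpin E lam k₀) : 0 < betaStar E lam k₀ := by
  have h2 : 0 < ‖lam‖ := norm_pos_iff.2 hlam
  obtain ⟨n, hn⟩ := exists_nat_gt ‖lam‖⁻¹
  set k := max n (k₀ + 1) with hk
  have hk1 : 1 ≤ k := le_trans (by omega) (le_max_right n (k₀ + 1))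
  have hkne : k ≠ k₀ := by
    have := le_max_right n (k₀ + 1)
    omega
  refine lt_of_lt_of_le ?_ (h.le_betaStar hk1 hkne)
  refine div_pos (Real.log_pos ?_) (by exact_mod_cast hE.pos k hk1)
  have h3 : (n : ℝ) ≤ k := by exact_mod_cast le_max_left n (k₀ + 1)
  have h4 : ‖lam‖⁻¹ < (k : ℝ) + 1 := by linarith
  have h5 : (1 : ℝ) ≤ (k : ℝ) + 1 := by linarith [(Nat.cast_nonneg k : (0 : ℝ) ≤ k)]
  rw [inv_lt_iff_one_lt_mul₀ h2] at h4
  rw [mul_comm] at h4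
  calc 1 < ‖lam‖ * ((k : ℝ) + 1) := h4
    _ ≤ ‖lam‖ * ((k : ℝ) + 1) ^ 2 := by
      refine mul_le_mul_of_nonneg_left ?_ h2.le
      exact le_self_pow₀ h5 two_ne_zero

theorem IsCondensationSpin.beta_pos {E : ℕ → ℕ} (hE : IsEnergy E) {lam : ℂ} (hlam : lam ≠ 0)
    {k₀ : ℕ} (h : IsCondensationSpin E lam k₀) : 0 < beta E lam k₀ := by
  refine (h.betaStar_pos hE hlam).trans_le (csSup_le ⟨_, k₀ + 1, ⟨by omega, by omega⟩, rfl⟩ ?_)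
  rintro _ ⟨l, hl, rfl⟩
  exact h.le_beta hl.1

/-- The logarithm of `d_k²` is negligible against `E k`, so `beta` is at most half its maximum for
large `k`. The finitely many other values with `k ≠ k₀` have a maximum strictly below that at `k₀`.
-/
theorem IsCondensationSpin.betaStar_lt {E : ℕ → ℕ} (hE : IsEnergy E) {lam : ℂ} (hlam : lam ≠ 0)
    {k₀ : ℕ} (h : IsCondensationSpin E lam k₀) : betaStar E lam k₀ < beta E lam k₀ := by
  have hlam' : 0 < ‖lam‖ := norm_pos_iff.2 hlam
  have hβ := h.beta_pos hE hlam
  set β := beta E lam k₀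
  obtain ⟨c, hc, hlin⟩ := hE.exists_linear_le
  obtain ⟨C, hC, hpow⟩ := hE.exists_pow_le_exp 2 (δ := β / 4) (by linarith)
  obtain ⟨n, hn⟩ := exists_nat_gt (Real.log (‖lam‖ * C) / (c * (β / 4)))
  rw [div_lt_iff₀ (by positivity)] at hn
  have hlarge : ∀ k, 1 ≤ k → n ≤ k → beta E lam k ≤ β / 2 := by
    intro k hk hnk
    have hEk : (0 : ℝ) < E k := by exact_mod_cast hE.pos k hk
    have h1 : Real.log (‖lam‖ * ((k : ℝ) + 1) ^ 2) ≤ Real.log (‖lam‖ * C) + β / 4 * E k := by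
      rw [← Real.log_exp (β / 4 * E k), ← Real.log_mul (by positivity) (by positivity), mul_assoc]
      exact Real.log_le_log (by positivity) (mul_le_mul_of_nonneg_left (hpow k hk) hlam'.le)
    have h2 : Real.log (‖lam‖ * C) ≤ β / 4 * E k := by
      have h3 := hlin k hk
      have h4 : (n : ℝ) ≤ k := by exact_mod_cast hnk
      have h5 : c * (n : ℝ) ≤ E k := (mul_le_mul_of_nonneg_left h4 hc.le).trans h3
      nlinarith
    rw [beta, div_le_iff₀ hEk]
    linarith
  obtain ⟨b, hb, hbk⟩ : ∃ b < β, ∀ k, 1 ≤ k → k ≠ k₀ → k < n → beta E lam k ≤ b := by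
    let F := (Finset.range n).filter fun k => 1 ≤ k ∧ k ≠ k₀
    rcases F.eq_empty_or_nonempty with hF | hF
    · refine ⟨β - 1, by linarith, fun k hk hne hkn => ?_⟩
      have : k ∈ F := Finset.mem_filter.2 ⟨Finset.mem_range.2 hkn, hk, hne⟩
      rw [hF] at this
      simp at this
    · obtain ⟨m, hm, hmax⟩ := F.exists_max_image (beta E lam) hF
      have hm' := (Finset.mem_filter.1 hm).2
      exact ⟨beta E lam m, h.2 m hm'.1 hm'.2, fun k hk hne hkn =>
        hmax k (Finset.mem_filter.2 ⟨Finset.mem_range.2 hkn, hk, hne⟩)⟩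
  refine lt_of_le_of_lt (csSup_le ⟨_, k₀ + 1, ⟨by omega, by omega⟩, rfl⟩ ?_)
    (max_lt hb (by linarith : β / 2 < β))
  rintro _ ⟨k, hk, rfl⟩
  by_cases hkn : k < n
  · exact (hbk k hk.1 hk.2 hkn).trans (le_max_left _ _)
  · exact (hlarge k hk.1 (not_lt.1 hkn)).trans (le_max_right _ _)

/-! ### Compactness -/

section Compactness

variable {K : RootComplex} {e₀ : K.V → K.D}

theorem faceKernel_le_one (l : List (K.D × K.D)) (g : K.D → SL2C) : faceKernel l g ≤ 1 := by
  induction l with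
  | nil => simp [faceKernel]
  | cons a l ih =>
    rw [faceKernel, List.map_cons, List.prod_cons]
    exact mul_le_one₀ (nrm_rpow_neg_le_one _ (by norm_num)) (faceKernel_nonneg l g) ih

theorem faceKernel_le (l : List (K.D × K.D)) (g : K.D → SL2C) {c : K.D × K.D} (hc : c ∈ l) :
    faceKernel l g ≤ nrm (wedge g c) ^ (-(3 / 2 : ℝ)) := by
  induction l with
  | nil => simp at hc
  | cons a l ih =>
    rw [faceKernel, List.map_cons, List.prod_cons]
    rcases List.mem_cons.1 hc with rfl | hc
    · exact mul_le_of_le_one_right (nrm_rpow_nonneg _ _) (faceKernel_le_one l g)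
    · exact (mul_le_of_le_one_left (faceKernel_nonneg l g)
        (nrm_rpow_neg_le_one _ (by norm_num))).trans (ih hc)

/-- The internal configurations with bounded wedge holonomies. -/
def boundedWedges (e₀ : K.V → K.D) (M : ℝ) : Set (IntConfig K e₀) :=
  {x | ∀ h, ∀ c ∈ K.bdInt h, nrm (wedge x.full c) ≤ M}

theorem continuous_nrm_wedge (c : K.D × K.D) :
    Continuous fun x : IntConfig K e₀ => nrm (wedge x.full c) :=
  continuous_nrm.comp ((continuous_wedge c).comp continuous_intFull)

theorem isClosed_boundedWedges (M : ℝ) : IsClosed (boundedWedges e₀ M) := by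
  simp only [boundedWedges, Set.ofPred_forall]
  exact isClosed_iInter fun h => isClosed_iInter fun c => isClosed_iInter fun _ =>
    isClosed_le (continuous_nrm_wedge c) continuous_const

theorem intFull_of_base (he₀ : ∀ v, K.vert (e₀ v) = v) (x : IntConfig K e₀) (v : K.V) :
    x.full (e₀ v) = 1 :=
  dif_neg fun h => h.1 (by rw [he₀])

theorem nrm_le_mul_nrm_wedge (g : K.D → SL2C) (a b : K.D) :
    nrm (g b) ≤ nrm (g a) * nrm (wedge g (a, b)) := by
  have h := nrm_mul_le (g a) (wedge g (a, b))
  rwa [wedge, mul_inv_cancel_left] at h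

theorem nrm_le_mul_nrm_wedge' (g : K.D → SL2C) (a b : K.D) :
    nrm (g b) ≤ nrm (g a) * nrm (wedge g (b, a)) := by
  have h := nrm_le_mul_nrm_wedge g a b
  rwa [wedge, nrm_inv_mul_comm] at h

theorem exists_nrm_full_le_of_walk (M : ℝ) {v : K.V}
    {a b : {d : K.D // K.vert d = v ∧ K.IsInt d}} (p : (K.interiorVertexGraph v).Walk a b)
    (ha : ∃ R : ℝ, ∀ x ∈ boundedWedges e₀ M, nrm (IntConfig.full x a.1) ≤ R) :
    ∃ R : ℝ, ∀ x ∈ boundedWedges e₀ M, nrm (IntConfig.full x b.1) ≤ R := by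
  induction p with
  | nil => exact ha
  | @cons a b c hab p ih =>
    obtain ⟨R, hR⟩ := ha
    refine ih ⟨R * M, fun x hx => ?_⟩
    rw [RootComplex.interiorVertexGraph, SimpleGraph.fromRel_adj] at hab
    have hR0 : 0 ≤ R := (nrm_pos _).le.trans (hR x hx)
    rcases hab.2 with ⟨h, hc⟩ | ⟨h, hc⟩
    · exact (nrm_le_mul_nrm_wedge _ a.1 b.1).trans
        (mul_le_mul (hR x hx) (hx h _ hc) (nrm_pos _).le hR0)
    · exact (nrm_le_mul_nrm_wedge' _ a.1 b.1).trans
        (mul_le_mul (hR x hx) (hx h _ hc) (nrm_pos _).le hR0)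

/-- A walk in `Γ_{v,-}` joins the half-edge to `e₀ v`, where the variable is `1`. Each link of the
walk is a corner and multiplies the norm by at most `M`. -/
theorem exists_nrm_full_le (he₀ : ∀ v, K.vert (e₀ v) = v)
    (he₀int : ∀ v, (∃ d, K.vert d = v ∧ K.IsInt d) → K.IsInt (e₀ v))
    (hconn : ∀ v, (K.interiorVertexGraph v).Preconnected) (M : ℝ) {d : K.D} (hd : K.IsInt d) :
    ∃ R : ℝ, ∀ x ∈ boundedWedges e₀ M, nrm (IntConfig.full x d) ≤ R := by
  have hbase : ∀ x ∈ boundedWedges e₀ M, nrm (IntConfig.full x (e₀ (K.vert d))) ≤ √2 := by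
    intro x _
    have h1 := congrArg nrm (intFull_of_base he₀ x (K.vert d))
    rw [nrm_one] at h1
    exact h1.le
  have hint : K.IsInt (e₀ (K.vert d)) := he₀int (K.vert d) ⟨d, rfl, hd⟩
  obtain ⟨p⟩ := hconn (K.vert d) ⟨e₀ (K.vert d), he₀ (K.vert d), hint⟩ ⟨d, rfl, hd⟩
  have h := exists_nrm_full_le_of_walk (e₀ := e₀) M p ⟨√2, hbase⟩
  dsimp only at h
  exact h

theorem isCompact_boundedWedges (he₀ : ∀ v, K.vert (e₀ v) = v)
    (he₀int : ∀ v, (∃ d, K.vert d = v ∧ K.IsInt d) → K.IsInt (e₀ v))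
    (hconn : ∀ v, (K.interiorVertexGraph v).Preconnected) (M : ℝ) :
    IsCompact (boundedWedges e₀ M) := by
  have h : ∀ d : {d : K.D // d ≠ e₀ (K.vert d) ∧ K.IsInt d}, ∃ R : ℝ,
      ∀ x ∈ boundedWedges e₀ M, nrm (x.full d.1) ≤ R := fun d =>
    exists_nrm_full_le he₀ he₀int hconn M d.2.2
  choose R hR using h
  refine (isCompact_univ_pi fun d => isCompact_nrm_le (R d)).of_isClosed_subset
    (isClosed_boundedWedges M) fun x hx d _ => ?_
  have h1 := hR d x hx
  have h2 : IntConfig.full x d.1 = x d := dif_pos d.2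
  rwa [h2] at h1

theorem eventually_exists_lt_nrm_wedge (he₀ : ∀ v, K.vert (e₀ v) = v)
    (he₀int : ∀ v, (∃ d, K.vert d = v ∧ K.IsInt d) → K.IsInt (e₀ v))
    (hconn : ∀ v, (K.interiorVertexGraph v).Preconnected) {x : ℕ → IntConfig K e₀}
    (hx : Tendsto x atTop (cocompact (IntConfig K e₀))) (M : ℝ) :
    ∀ᶠ n in atTop, ∃ h, ∃ c ∈ K.bdInt h, M < nrm (wedge (x n).full c) := by
  filter_upwards [hx.eventually (isCompact_boundedWedges he₀ he₀int hconn M).compl_mem_cocompact]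
    with n hn
  by_contra! hno
  exact hn hno

theorem tendsto_mul_rpow_neg (P : ℝ) : Tendsto (fun M : ℝ => P * M ^ (-(3 / 2 : ℝ))) atTop (𝓝 0) := by
  simpa using (tendsto_rpow_neg_atTop (y := 3 / 2) (by norm_num)).const_mul P

/-- One large wedge makes the amplitude of its face small, as the other kernel factors are at most
`1`. The threshold `M` is chosen for all finitely many faces at once, so the face may vary with `n`.
-/
theorem eventually_exists_norm_tauInt_lt (he₀ : ∀ v, K.vert (e₀ v) = v)
    (he₀int : ∀ v, (∃ d, K.vert d = v ∧ K.IsInt d) → K.IsInt (e₀ v))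
    (hconn : ∀ v, (K.interiorVertexGraph v).Preconnected) {x : ℕ → IntConfig K e₀}
    (hx : Tendsto x atTop (cocompact (IntConfig K e₀))) (γ : ℝ) (k : ℕ) {ε : ℝ} (hε : 0 < ε) :
    ∀ᶠ n in atTop, ∃ h, ‖tauInt γ k h (x n).full‖ < ε := by
  choose P m hP hle using fun h => exists_norm_tauInt_le (K := K) γ h
  have h1 : ∀ᶠ M : ℝ in atTop, ∀ h, P h * ((k : ℝ) + 1) ^ m h * M ^ (-(3 / 2 : ℝ)) < ε :=
    eventually_all.2 fun h => (tendsto_mul_rpow_neg _).eventually (gt_mem_nhds hε)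
  obtain ⟨M, hM, hM0⟩ := (h1.and (eventually_gt_atTop 0)).exists
  filter_upwards [eventually_exists_lt_nrm_wedge he₀ he₀int hconn hx M] with n hn
  obtain ⟨h, c, hc, hlt⟩ := hn
  refine ⟨h, ((hle h k _).trans ?_).trans_lt (hM h)⟩
  have hPh := hP h
  refine mul_le_mul_of_nonneg_left ((faceKernel_le _ _ hc).trans ?_) (by positivity)
  exact Real.rpow_le_rpow_of_nonpos hM0 hlt.le (by norm_num)

theorem exists_subseq_tendsto (he₀ : ∀ v, K.vert (e₀ v) = v)
    (he₀int : ∀ v, (∃ d, K.vert d = v ∧ K.IsInt d) → K.IsInt (e₀ v))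
    (hconn : ∀ v, (K.interiorVertexGraph v).Preconnected) {x : ℕ → IntConfig K e₀}
    (hx : Tendsto x atTop (cocompact (IntConfig K e₀))) (γ : ℝ) :
    ∃ h, ∃ c ∈ K.bdInt h, ∃ φ : ℕ → ℕ, StrictMono φ ∧
      Tendsto (fun n => nrm (wedge (x (φ n)).full c)) atTop atTop ∧
      ∀ k, Tendsto (fun n => tauInt γ k h (x (φ n)).full) atTop (𝓝 0) := by
  -- Pigeonhole principle over the finitely many corners: otherwise each wedge norm would eventually
  -- be bounded.
  obtain ⟨h, c, hc, hfreq⟩ : ∃ h, ∃ c ∈ K.bdInt h, ∀ M : ℝ,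
      ∃ᶠ n in atTop, M ≤ nrm (wedge (x n).full c) := by
    by_contra! hno
    have h2 : ∀ h, ∀ c : K.D × K.D, ∃ M : ℝ, c ∈ K.bdInt h →
        ∀ᶠ n in atTop, nrm (wedge (x n).full c) < M := by
      intro h c
      by_cases hc : c ∈ K.bdInt h
      · obtain ⟨M, hM⟩ := hno h c hc
        exact ⟨M, fun _ => hM⟩
      · exact ⟨0, fun h' => absurd h' hc⟩
    choose M hM using h2
    obtain ⟨B, hB⟩ := (Set.finite_range fun p : K.FInt × (K.D × K.D) => M p.1 p.2).bddAbove
    have h3 : ∀ᶠ n in atTop, ∀ h, ∀ c : K.D × K.D, c ∈ K.bdInt h →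
        nrm (wedge (x n).full c) < M h c :=
      eventually_all.2 fun h => eventually_all.2 fun c => by
        by_cases hc : c ∈ K.bdInt h
        · filter_upwards [hM h c hc] with n hn _ using hn
        · exact Eventually.of_forall fun n h' => absurd h' hc
    obtain ⟨n, hn1, h, c, hc, hn2⟩ :=
      (h3.and (eventually_exists_lt_nrm_wedge he₀ he₀int hconn hx B)).exists
    exact absurd ((hn1 h c hc).trans_le (hB ⟨(h, c), rfl⟩)) (not_lt.2 hn2.le)
  obtain ⟨φ, hφ, hle⟩ := extraction_forall_of_frequently fun n : ℕ => hfreq n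
  have htend : Tendsto (fun n => nrm (wedge (x (φ n)).full c)) atTop atTop :=
    tendsto_atTop_mono hle tendsto_natCast_atTop_atTop
  refine ⟨h, c, hc, φ, hφ, htend, fun k => ?_⟩
  obtain ⟨P, m, hP, hbd⟩ := exists_norm_tauInt_le (K := K) γ h
  refine squeeze_zero_norm (fun n => (hbd k _).trans (mul_le_mul_of_nonneg_left
    (faceKernel_le _ _ hc) (by positivity))) ?_
  exact (tendsto_mul_rpow_neg _).comp htend

variable {E : ℕ → ℕ} {lam : K.FInt → ℂ} {k₀ : K.FInt → ℕ}

/-- On `𝒰_int` the logarithm exceeds `β* E > 0`, so `|λ τ| > 1`, while the decay estimate gives `|λ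
τ| ≤ X ‖U‖^{-3/2}`. Hence `‖U‖ ≤ ‖U‖^{3/2} ≤ X`. -/
theorem exists_uInt_subset_boundedWedges (hE : IsEnergy E) (hlam : ∀ h, lam h ≠ 0)
    (hk₀ : ∀ h, IsCondensationSpin E (lam h) (k₀ h)) (γ : ℝ) :
    ∃ M, UInt e₀ γ E lam k₀ ⊆ boundedWedges e₀ M := by
  choose P m hP hle using fun h => exists_norm_tauInt_le (K := K) γ h
  set X : K.FInt → ℝ := fun h => ‖lam h‖ * (P h * ((k₀ h : ℝ) + 1) ^ m h) with hX
  have hX0 : ∀ h, 0 ≤ X h := fun h => by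
    have := hP h
    positivity
  refine ⟨∑ h, X h, fun x hx h c hc => ?_⟩
  refine le_trans ?_ (Finset.single_le_sum (fun h _ => hX0 h) (Finset.mem_univ h))
  obtain ⟨hne, hlt⟩ := hx h
  have hE0 : (0 : ℝ) < E (k₀ h) := by exact_mod_cast hE.pos _ (hk₀ h).1
  have h1 : 0 < Real.log ‖lam h * tauInt γ (k₀ h) h x.full‖ := by
    have := ((hk₀ h).betaStar_pos hE (hlam h)).trans hlt
    exact (div_pos_iff_of_pos_right hE0).1 this
  have h2 : 1 < ‖lam h * tauInt γ (k₀ h) h x.full‖ :=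
    (Real.log_pos_iff (norm_nonneg _)).1 h1
  have hN := nrm_pos (wedge x.full c)
  have h3 : 1 ≤ X h * nrm (wedge x.full c) ^ (-(3 / 2 : ℝ)) := by
    rw [norm_mul] at h2
    refine h2.le.trans ?_
    rw [hX, mul_assoc]
    refine mul_le_mul_of_nonneg_left ((hle h _ _).trans ?_) (norm_nonneg _)
    have := hP h
    exact mul_le_mul_of_nonneg_left (faceKernel_le _ _ hc) (by positivity)
  rw [Real.rpow_neg hN.le, ← div_eq_mul_inv, le_div_iff₀ (Real.rpow_pos_of_pos hN _), one_mul] at h3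
  refine le_trans ?_ h3
  calc nrm (wedge x.full c) = nrm (wedge x.full c) ^ (1 : ℝ) := (Real.rpow_one _).symm
    _ ≤ _ := Real.rpow_le_rpow_of_exponent_le (one_le_nrm _) (by norm_num)

theorem isCompact_cIntSector (he₀ : ∀ v, K.vert (e₀ v) = v)
    (he₀int : ∀ v, (∃ d, K.vert d = v ∧ K.IsInt d) → K.IsInt (e₀ v))
    (hconn : ∀ v, (K.interiorVertexGraph v).Preconnected) (S : K.FInt → ℤˣ) :
    IsCompact (CIntSector e₀ S) := by
  -- Unitarity of a wedge is the closed condition `nrm ≤ √2`, so a sector is the closed locus of the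
  -- product condition in a compact set.
  have heq : CIntSector e₀ S = boundedWedges e₀ √2 ∩
      {x : IntConfig K e₀ | ∀ h, (((K.bdInt h).map (wedge x.full)).prod : Matrix (Fin 2) (Fin 2) ℂ) =
        ((((S h : ℤˣ) : ℤ) : ℂ)) • (1 : Matrix (Fin 2) (Fin 2) ℂ)} := by
    ext x
    constructor
    · intro hx
      exact ⟨fun h c hc => (nrm_of_mem_su2 ((hx h).1 c hc)).le, fun h => (hx h).2⟩
    · intro hx h
      exact ⟨fun c hc => mem_su2_of_nrm_le (hx.1 h c hc), hx.2 h⟩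
  rw [heq]
  refine (isCompact_boundedWedges he₀ he₀int hconn _).inter_right ?_
  simp only [Set.ofPred_forall]
  refine isClosed_iInter fun h => isClosed_eq ?_ continuous_const
  exact Matrix.SpecialLinearGroup.isClosedEmbedding_val.continuous.comp
    (continuous_list_map_prod (M := SL2C) _ fun c => (continuous_wedge c).comp continuous_intFull)

theorem isCompact_cInt (he₀ : ∀ v, K.vert (e₀ v) = v)
    (he₀int : ∀ v, (∃ d, K.vert d = v ∧ K.IsInt d) → K.IsInt (e₀ v))
    (hconn : ∀ v, (K.interiorVertexGraph v).Preconnected) : IsCompact (CInt e₀) :=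
  isCompact_iUnion fun S => isCompact_cIntSector he₀ he₀int hconn S

end Compactness

/-! ### Localization -/

section Localization

variable {K : RootComplex} {e₀ : K.V → K.D} {E : ℕ → ℕ}

theorem exists_norm_omegaInt_le (hE : IsEnergy E) (γ : ℝ) (lam : ℂ) (h : K.FInt) {b δ : ℝ}
    (hb : 0 ≤ b) (hδ : 0 < δ) : ∃ C : ℝ, 0 < C ∧ ∀ (A : ℝ) (g : K.D → SL2C),
      (∀ k, 1 ≤ k → ‖lam * tauInt γ k h g‖ ≤ Real.exp (b * E k)) →
      ‖omegaInt γ E A lam h g‖ ≤ C * Real.exp ((b + δ) * A) * faceKernel (K.bdInt h) g := by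
  obtain ⟨P, m, hP, hle⟩ := exists_norm_tauInt_le (K := K) γ h
  obtain ⟨C, hC, hbd⟩ := hE.exists_norm_stackSum_le hb m hδ
  refine ⟨C * (‖lam‖ * P + 1), by positivity, fun A g hg => ?_⟩
  have hΦ := faceKernel_nonneg (K.bdInt h) g
  have h1 := hbd A lam (fun _ k => tauInt γ k h g) (‖lam‖ * P * faceKernel (K.bdInt h) g)
    (by positivity) (fun _ k hk => hg k hk) fun _ k _ => by
      rw [norm_mul]
      refine (mul_le_mul_of_nonneg_left (hle k g) (norm_nonneg _)).trans (le_of_eq ?_)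
      ring
  refine h1.trans ?_
  calc C * Real.exp ((b + δ) * A) * (‖lam‖ * P * faceKernel (K.bdInt h) g)
      ≤ C * Real.exp ((b + δ) * A) * ((‖lam‖ * P + 1) * faceKernel (K.bdInt h) g) := by
        gcongr
        linarith
    _ = _ := by ring

/-- The cut-off of a boundary face stays fixed, so its exponential rate is immaterial and a crude
one, `c + 1`, is used. -/
theorem exists_norm_omegaBd_le (hE : IsEnergy E) (γ A : ℝ) (lam : ℂ) (b : K.FBd) (H : ℕ → SU2) :
    ∃ C : ℝ, 0 < C ∧ ∀ g : K.D → SL2C,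
      ‖omegaBd γ E A lam b H g‖ ≤ C * faceKernel (K.bdBd b) g := by
  obtain ⟨P, m, hP, hle⟩ := exists_norm_tauBd_le (K := K) γ b
  obtain ⟨C₁, hC₁, hpow⟩ := hE.exists_pow_le_exp m one_pos
  set c : ℝ := max (Real.log (‖lam‖ * P * C₁)) 0 with hc
  have hc0 : 0 ≤ c := le_max_right _ _
  obtain ⟨C, hC, hbd⟩ := hE.exists_norm_stackSum_le (b := c + 1) (by linarith) m one_pos
  refine ⟨C * Real.exp ((c + 1 + 1) * A) * (‖lam‖ * P + 1), by positivity, fun g => ?_⟩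
  have hΦ := faceKernel_nonneg (K.bdBd b) g
  have h0 : ∀ i k, ‖lam * tauBd γ k b g (H i)‖ ≤
      ((k : ℝ) + 1) ^ m * (‖lam‖ * P * faceKernel (K.bdBd b) g) := fun i k => by
    rw [norm_mul]
    refine (mul_le_mul_of_nonneg_left (hle k g (H i)) (norm_nonneg _)).trans (le_of_eq ?_)
    ring
  have h1 := hbd A lam (fun i k => tauBd γ k b g (H i)) (‖lam‖ * P * faceKernel (K.bdBd b) g)
    (by positivity) (fun i k hk => ?_) fun i k _ => h0 i k
  · refine h1.trans ?_
    calc C * Real.exp ((c + 1 + 1) * A) * (‖lam‖ * P * faceKernel (K.bdBd b) g)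
        ≤ C * Real.exp ((c + 1 + 1) * A) * ((‖lam‖ * P + 1) * faceKernel (K.bdBd b) g) := by
          gcongr
          linarith
      _ = _ := by ring
  · have hE1 : (1 : ℝ) ≤ E k := by exact_mod_cast hE.pos k hk
    have h2 : ‖lam‖ * P * C₁ ≤ Real.exp (c * E k) := by
      have h3 : ‖lam‖ * P * C₁ ≤ Real.exp c := by
        rcases (show 0 ≤ ‖lam‖ * P * C₁ by positivity).eq_or_lt with h4 | h4
        · rw [← h4]
          positivity
        · calc ‖lam‖ * P * C₁ = Real.exp (Real.log (‖lam‖ * P * C₁)) := (Real.exp_log h4).symm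
            _ ≤ Real.exp c := Real.exp_le_exp.2 (le_max_left _ _)
      exact h3.trans (Real.exp_le_exp.2 (by nlinarith))
    calc ‖lam * tauBd γ k b g (H i)‖
        ≤ ((k : ℝ) + 1) ^ m * (‖lam‖ * P * faceKernel (K.bdBd b) g) := h0 i k
      _ ≤ (C₁ * Real.exp (1 * E k)) * (‖lam‖ * P * 1) := by
        have := faceKernel_le_one (K.bdBd b) g
        have := hpow k hk
        gcongr
      _ = (‖lam‖ * P * C₁) * Real.exp (1 * E k) := by ring
      _ ≤ Real.exp (c * E k) * Real.exp (1 * E k) := by gcongr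
      _ = Real.exp ((c + 1) * E k) := by
        rw [← Real.exp_add]
        congr 1
        ring

variable {lam : K.FInt → ℂ} {k₀ : K.FInt → ℕ}

theorem norm_mul_tauInt_le (hE : IsEnergy E) {l : ℂ} (hl : l ≠ 0) (γ : ℝ) {k : ℕ} (hk : 1 ≤ k)
    (h : K.FInt) (g : K.D → SL2C) : ‖l * tauInt γ k h g‖ ≤ Real.exp (beta E l k * E k) := by
  rw [exp_beta_mul hE hl hk, norm_mul]
  exact mul_le_mul_of_nonneg_left (norm_tauInt_le γ k h g) (norm_nonneg _)

/-- All internal faces contribute their maximal rate, except that `h₁` may be slower by `δ₀`. For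
`δ₀ = 0` the condition on `h₁` always holds, and the bound yields absolute convergence. -/
theorem exists_norm_integrand_le (hE : IsEnergy E) (hlam : ∀ h, lam h ≠ 0)
    (hk₀ : ∀ h, IsCondensationSpin E (lam h) (k₀ h)) (γ : ℝ) (a : K.FInt → ℝ) (cutBd : K.FBd → ℝ)
    (lamBd : K.FBd → ℂ) (H : K.FBd → ℕ → SU2) {δ₀ δ : ℝ}
    (hδ₀ : ∀ h, δ₀ ≤ beta E (lam h) (k₀ h)) (hδ : 0 < δ) :
    ∃ B : ℝ, 0 < B ∧ ∀ (A : ℝ) (x : Config K e₀) (h₁ : K.FInt),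
      (∀ k, 1 ≤ k → ‖lam h₁ * tauInt γ k h₁ x.full‖ ≤
        Real.exp ((beta E (lam h₁) (k₀ h₁) - δ₀) * E k)) →
      ‖integrand e₀ γ E ⟨fun h => A * a h, lam, cutBd, lamBd, H⟩ x‖ ≤
        B * Real.exp ((∑ h, beta E (lam h) (k₀ h) * a h + δ * ∑ h, a h - δ₀ * a h₁) * A) *
          cornerKernel K x.full := by
  classical
  have hβ : ∀ h, 0 ≤ beta E (lam h) (k₀ h) := fun h => ((hk₀ h).beta_pos hE (hlam h)).le
  choose C₁ hC₁ hb₁ using fun h => exists_norm_omegaInt_le (K := K) hE γ (lam h) h (hβ h) hδ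
  choose C₂ hC₂ hb₂ using fun h => exists_norm_omegaInt_le (K := K) hE γ (lam h) h
    (b := beta E (lam h) (k₀ h) - δ₀) (by linarith [hδ₀ h]) hδ
  choose D hD hbD using fun b => exists_norm_omegaBd_le (K := K) hE γ (cutBd b) (lamBd b) b (H b)
  refine ⟨(∏ h, (C₁ h + C₂ h)) * ∏ b, D b, mul_pos
    (Finset.prod_pos fun h _ => add_pos (hC₁ h) (hC₂ h)) (Finset.prod_pos fun b _ => hD b),
    fun A x h₁ hx => ?_⟩
  let η : K.FInt → ℝ := fun h => if h = h₁ then δ₀ else 0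
  have hint : ∀ h, ‖omegaInt γ E (A * a h) (lam h) h x.full‖ ≤
      (C₁ h + C₂ h) * Real.exp ((beta E (lam h) (k₀ h) - η h + δ) * (A * a h)) *
        faceKernel (K.bdInt h) x.full := by
    intro h
    have hΦ := faceKernel_nonneg (K.bdInt h) x.full
    have h1 := hC₁ h
    have h2 := hC₂ h
    by_cases hh : h = h₁
    · subst hh
      refine (hb₂ h (A * a h) x.full hx).trans ?_
      simp only [η, if_true]
      gcongr
      linarith
    · have h3 := hb₁ h (A * a h) x.full fun k hk => (norm_mul_tauInt_le hE (hlam h) γ hk h _).trans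
        (Real.exp_le_exp.2 (mul_le_mul_of_nonneg_right ((hk₀ h).le_beta hk) (Nat.cast_nonneg _)))
      refine h3.trans ?_
      simp only [η, hh, if_false, sub_zero]
      gcongr
      linarith
  have hexp : ∑ h, (beta E (lam h) (k₀ h) - η h + δ) * (A * a h) =
      (∑ h, beta E (lam h) (k₀ h) * a h + δ * ∑ h, a h - δ₀ * a h₁) * A := by
    have h1 : δ₀ * a h₁ = ∑ h, η h * a h := by
      simp [η]
    rw [h1, Finset.mul_sum, ← Finset.sum_add_distrib, ← Finset.sum_sub_distrib, Finset.sum_mul]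
    exact Finset.sum_congr rfl fun h _ => by ring
  have hprod : ‖∏ h, omegaInt γ E (A * a h) (lam h) h x.full‖ ≤
      (∏ h, (C₁ h + C₂ h)) *
        Real.exp ((∑ h, beta E (lam h) (k₀ h) * a h + δ * ∑ h, a h - δ₀ * a h₁) * A) *
        ∏ h, faceKernel (K.bdInt h) x.full := by
    rw [norm_prod, ← hexp, Real.exp_sum, ← Finset.prod_mul_distrib, ← Finset.prod_mul_distrib]
    exact Finset.prod_le_prod (fun _ _ => norm_nonneg _) fun h _ => hint h
  have hprod' : ‖∏ b, omegaBd γ E (cutBd b) (lamBd b) b (H b) x.full‖ ≤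
      (∏ b, D b) * ∏ b, faceKernel (K.bdBd b) x.full := by
    rw [norm_prod, ← Finset.prod_mul_distrib]
    exact Finset.prod_le_prod (fun _ _ => norm_nonneg _) fun b _ => hbD b x.full
  have hC : 0 ≤ ∏ h, (C₁ h + C₂ h) := Finset.prod_nonneg fun h _ => (add_pos (hC₁ h) (hC₂ h)).le
  have hD' : 0 ≤ ∏ b, D b := Finset.prod_nonneg fun b _ => (hD b).le
  have hF : 0 ≤ ∏ h, faceKernel (K.bdInt h) x.full :=
    Finset.prod_nonneg fun h _ => faceKernel_nonneg _ _
  rw [integrand, norm_mul]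
  refine (mul_le_mul hprod hprod' (norm_nonneg _) (by positivity)).trans ?_
  calc _ = (∏ h, (C₁ h + C₂ h)) * (∏ b, D b) *
        Real.exp ((∑ h, beta E (lam h) (k₀ h) * a h + δ * ∑ h, a h - δ₀ * a h₁) * A) *
        ((∏ h, faceKernel (K.bdInt h) x.full) * ∏ b, faceKernel (K.bdBd b) x.full) := by ring
    _ ≤ _ := mul_le_mul_of_nonneg_left (prod_faceKernel_le _) (by positivity)

theorem continuous_integrand (hE : IsEnergy E) (γ : ℝ) (S : StackData K) :
    Continuous (integrand e₀ γ E S) := by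
  unfold integrand
  refine (continuous_finsetProd _ fun h _ => ?_).mul (continuous_finsetProd _ fun b _ => ?_)
  · exact hE.continuous_stackSum _ _ fun _ k => (continuous_tauInt γ k h).comp continuous_full
  · exact hE.continuous_stackSum _ _ fun i k =>
      (continuous_tauBd γ k b (S.hol b i)).comp continuous_full

theorem continuous_cornerKernel_full :
    Continuous fun x : Config K e₀ => cornerKernel K x.full := by
  unfold cornerKernel
  refine continuous_finsetProd _ fun c _ => ?_
  exact (continuous_nrm.comp ((continuous_wedge c).comp continuous_full)).rpow_const
    fun x => Or.inl (nrm_pos _).ne'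

theorem cornerKernel_nonneg (g : K.D → SL2C) : 0 ≤ cornerKernel K g :=
  Finset.prod_nonneg fun _ _ => nrm_rpow_nonneg _ _

theorem integrable_cornerKernel (he₀ : ∀ v, K.vert (e₀ v) = v)
    (h3 : ∀ v, IsThreeConnected (K.vertexGraph v)) (μ : Measure SL2C) [μ.IsHaarMeasure] :
    Integrable (fun x : Config K e₀ => cornerKernel K x.full) (measureOmega e₀ μ) :=
  ⟨continuous_cornerKernel_full.measurable.aestronglyMeasurable,
    (hasFiniteIntegral_iff_ofReal (ae_of_all _ fun _ => cornerKernel_nonneg _)).2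
      (lintegral_cornerKernel_lt_top he₀ h3 μ)⟩

theorem integrable_integrand [Nonempty K.FInt] (he₀ : ∀ v, K.vert (e₀ v) = v)
    (h3 : ∀ v, IsThreeConnected (K.vertexGraph v)) (μ : Measure SL2C) [μ.IsHaarMeasure]
    (hE : IsEnergy E) (hlam : ∀ h, lam h ≠ 0)
    (hk₀ : ∀ h, IsCondensationSpin E (lam h) (k₀ h)) (γ : ℝ) (a : K.FInt → ℝ) (cutBd : K.FBd → ℝ)
    (lamBd : K.FBd → ℂ) (H : K.FBd → ℕ → SU2) (A : ℝ) :
    Integrable (integrand e₀ γ E ⟨fun h => A * a h, lam, cutBd, lamBd, H⟩) (measureOmega e₀ μ) := by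
  obtain ⟨B, hB, hle⟩ := exists_norm_integrand_le (e₀ := e₀) hE hlam hk₀ γ a cutBd lamBd H (δ₀ := 0)
    (fun h => ((hk₀ h).beta_pos hE (hlam h)).le) one_pos
  obtain ⟨h₁⟩ := ‹Nonempty K.FInt›
  refine ((integrable_cornerKernel he₀ h3 μ).const_mul _).mono'
    (continuous_integrand hE γ _).measurable.aestronglyMeasurable (ae_of_all _ fun x => hle A x h₁ ?_)
  intro k hk
  rw [sub_zero]
  exact (norm_mul_tauInt_le hE (hlam h₁) γ hk h₁ _).trans
    (Real.exp_le_exp.2 (mul_le_mul_of_nonneg_right ((hk₀ h₁).le_beta hk) (Nat.cast_nonneg _)))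

/-- Regions where one of the face amplitudes is uniformly suppressed are exponentially negligible. -/
theorem exists_norm_amplitudeOn_le [Nonempty K.FInt] (he₀ : ∀ v, K.vert (e₀ v) = v)
    (h3 : ∀ v, IsThreeConnected (K.vertexGraph v)) (μ : Measure SL2C) [μ.IsHaarMeasure]
    (hE : IsEnergy E) (hlam : ∀ h, lam h ≠ 0)
    (hk₀ : ∀ h, IsCondensationSpin E (lam h) (k₀ h)) (γ : ℝ) {a : K.FInt → ℝ} (ha : ∀ h, 0 < a h)
    (cutBd : K.FBd → ℝ) (lamBd : K.FBd → ℂ) (H : K.FBd → ℕ → SU2) {Z : Set (IntConfig K e₀)}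
    (hZ : MeasurableSet Z) {δ₀ : ℝ} (hδ₀ : 0 < δ₀) (hδβ : ∀ h, δ₀ ≤ beta E (lam h) (k₀ h))
    (hbad : ∀ x ∈ Z, ∃ h, ∀ k, 1 ≤ k → ‖lam h * tauInt γ k h x.full‖ ≤
      Real.exp ((beta E (lam h) (k₀ h) - δ₀) * E k)) :
    ∃ B β' : ℝ, 0 < B ∧ β' < ∑ h, beta E (lam h) (k₀ h) * a h ∧ ∀ A : ℝ, 0 < A →
      ‖amplitudeOn e₀ μ γ E ⟨fun h => A * a h, lam, cutBd, lamBd, H⟩ Z‖ ≤ B * Real.exp (β' * A) := by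
  set κ := ∑ h, beta E (lam h) (k₀ h) * a h
  obtain ⟨hm, -, hmin⟩ := Finset.exists_min_image Finset.univ a Finset.univ_nonempty
  have hS : 0 < ∑ h, a h := Finset.sum_pos (fun h _ => ha h) Finset.univ_nonempty
  have ham := ha hm
  -- The stack bounds lose `δ ∑ a h` in the rate; with this `δ` the loss is half of the least
  -- possible gain `δ₀ min a`.
  set δ := δ₀ * a hm / (2 * ∑ h, a h) with hδdef
  have hδ : 0 < δ := by positivity
  obtain ⟨B, hB, hle⟩ :=
    exists_norm_integrand_le (e₀ := e₀) hE hlam hk₀ γ a cutBd lamBd H hδβ hδ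
  have hδS : δ * ∑ h, a h = δ₀ * a hm / 2 := by
    rw [hδdef]
    field_simp
  have hint := integrable_cornerKernel he₀ h3 μ
  set I := ∫ x : Config K e₀, cornerKernel K x.full ∂measureOmega e₀ μ
  have hI : 0 ≤ I := integral_nonneg fun _ => cornerKernel_nonneg _
  refine ⟨B * (I + 1), κ - δ₀ * a hm / 2, by positivity, by nlinarith, fun A hA => ?_⟩
  set R := B * Real.exp ((κ - δ₀ * a hm / 2) * A) with hR
  have hR0 : 0 ≤ R := by positivity
  have hmeas : MeasurableSet {x : Config K e₀ | x.toInt ∈ Z} := measurable_toInt hZ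
  have hpt : ∀ x ∈ {x : Config K e₀ | x.toInt ∈ Z},
      ‖integrand e₀ γ E ⟨fun h => A * a h, lam, cutBd, lamBd, H⟩ x‖ ≤
        R * cornerKernel K x.full := by
    intro x hx
    obtain ⟨h₁, hh₁⟩ := hbad _ hx
    refine (hle A x h₁ fun k hk => ?_).trans ?_
    · rw [tauInt_full_eq]
      exact hh₁ k hk
    · refine mul_le_mul_of_nonneg_right (mul_le_mul_of_nonneg_left (Real.exp_le_exp.2 ?_) hB.le)
        (cornerKernel_nonneg _)
      refine mul_le_mul_of_nonneg_right ?_ hA.le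
      have := mul_le_mul_of_nonneg_left (hmin h₁ (Finset.mem_univ _)) hδ₀.le
      rw [hδS]
      linarith
  have h1 : ‖amplitudeOn e₀ μ γ E ⟨fun h => A * a h, lam, cutBd, lamBd, H⟩ Z‖ ≤
      ∫ x in {x : Config K e₀ | x.toInt ∈ Z}, R * cornerKernel K x.full ∂measureOmega e₀ μ :=
    norm_integral_le_of_norm_le ((hint.const_mul R).integrableOn)
      ((ae_restrict_iff' hmeas).2 (ae_of_all _ hpt))
  have h2 : ∫ x in {x : Config K e₀ | x.toInt ∈ Z}, R * cornerKernel K x.full ∂measureOmega e₀ μ ≤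
      ∫ x : Config K e₀, R * cornerKernel K x.full ∂measureOmega e₀ μ :=
    setIntegral_le_integral (hint.const_mul R)
      (ae_of_all _ fun x => mul_nonneg hR0 (cornerKernel_nonneg _))
  have h4 : ∫ x : Config K e₀, R * cornerKernel K x.full ∂measureOmega e₀ μ = R * I :=
    integral_const_mul _ _
  refine (h1.trans (h2.trans h4.le)).trans ?_
  calc R * I ≤ R * (I + 1) := by gcongr; linarith
    _ = _ := by rw [hR]; ring

/-- Outside `UInt` one of the face amplitudes is suppressed. -/
theorem exists_norm_le_of_notMem_uInt (hE : IsEnergy E) (hlam : ∀ h, lam h ≠ 0)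
    (hk₀ : ∀ h, IsCondensationSpin E (lam h) (k₀ h)) (γ : ℝ) {x : IntConfig K e₀}
    (hx : x ∉ UInt e₀ γ E lam k₀) : ∃ h, ∀ k, 1 ≤ k → ‖lam h * tauInt γ k h x.full‖ ≤
      Real.exp (betaStar E (lam h) (k₀ h) * E k) := by
  simp only [UInt, Set.mem_ofPred_eq, not_forall] at hx
  obtain ⟨h, hh⟩ := hx
  refine ⟨h, fun k hk => ?_⟩
  by_cases hkk : k = k₀ h
  · subst hkk
    by_cases hτ : tauInt γ (k₀ h) h x.full = 0
    · rw [hτ, mul_zero, norm_zero]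
      positivity
    · have hE0 : (0 : ℝ) < E (k₀ h) := by exact_mod_cast hE.pos _ hk
      have h1 : Real.log ‖lam h * tauInt γ (k₀ h) h x.full‖ / E (k₀ h) ≤
          betaStar E (lam h) (k₀ h) := by
        by_contra hlt
        exact hh ⟨hτ, not_le.1 hlt⟩
      rw [div_le_iff₀ hE0] at h1
      have h2 : 0 < ‖lam h * tauInt γ (k₀ h) h x.full‖ := norm_pos_iff.2 (mul_ne_zero (hlam h) hτ)
      exact (Real.log_le_iff_le_exp h2).1 h1
  · exact (norm_mul_tauInt_le hE (hlam h) γ hk h _).trans (Real.exp_le_exp.2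
      (mul_le_mul_of_nonneg_right ((hk₀ h).le_betaStar hk hkk) (Nat.cast_nonneg _)))

theorem exists_gap [Nonempty K.FInt] (hE : IsEnergy E) (hlam : ∀ h, lam h ≠ 0)
    (hk₀ : ∀ h, IsCondensationSpin E (lam h) (k₀ h)) :
    ∃ δ₀ : ℝ, 0 < δ₀ ∧ ∀ h, betaStar E (lam h) (k₀ h) ≤ beta E (lam h) (k₀ h) - δ₀ := by
  obtain ⟨hm, -, hmin⟩ := Finset.exists_min_image Finset.univ
    (fun h => beta E (lam h) (k₀ h) - betaStar E (lam h) (k₀ h)) Finset.univ_nonempty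
  refine ⟨_, sub_pos.2 ((hk₀ hm).betaStar_lt hE (hlam hm)), fun h => ?_⟩
  have := hmin h (Finset.mem_univ _)
  linarith

/-- Outside a neighbourhood of the critical manifold one of the face amplitudes is suppressed. -/
theorem exists_norm_le_of_notMem_nhds [Nonempty K.FInt] (he₀ : ∀ v, K.vert (e₀ v) = v)
    (he₀int : ∀ v, (∃ d, K.vert d = v ∧ K.IsInt d) → K.IsInt (e₀ v))
    (hconn : ∀ v, (K.interiorVertexGraph v).Preconnected) (hE : IsEnergy E)
    (hlam : ∀ h, lam h ≠ 0) (hk₀ : ∀ h, IsCondensationSpin E (lam h) (k₀ h)) (γ : ℝ)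
    {U : Set (IntConfig K e₀)} (hU : CInt e₀ ⊆ interior U) :
    ∃ δ₀ : ℝ, 0 < δ₀ ∧ (∀ h, δ₀ ≤ beta E (lam h) (k₀ h)) ∧ ∀ x ∈ Uᶜ, ∃ h, ∀ k, 1 ≤ k →
      ‖lam h * tauInt γ k h x.full‖ ≤ Real.exp ((beta E (lam h) (k₀ h) - δ₀) * E k) := by
  obtain ⟨δ₁, hδ₁, hgap⟩ := exists_gap hE hlam hk₀
  have hβs : ∀ h, 0 < betaStar E (lam h) (k₀ h) := fun h => (hk₀ h).betaStar_pos hE (hlam h)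
  obtain ⟨M, hM⟩ := exists_uInt_subset_boundedWedges (e₀ := e₀) hE hlam hk₀ γ
  have hKc : IsCompact (boundedWedges e₀ M ∩ (interior U)ᶜ) :=
    (isCompact_boundedWedges he₀ he₀int hconn M).inter_right isOpen_interior.isClosed_compl
  -- The total deficit of the amplitudes at `k₀`. It vanishes only if every face amplitude is
  -- maximal, that is on `𝒞_int`, so it has a positive minimum on the compact set away from
  -- `interior U`.
  let f : IntConfig K e₀ → ℝ := fun x =>
    ∑ h, (((k₀ h : ℝ) + 1) ^ 2 - ‖tauInt γ (k₀ h) h x.full‖)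
  have hf : Continuous f := continuous_finsetSum _ fun h _ =>
    continuous_const.sub ((continuous_tauInt γ (k₀ h) h).comp continuous_intFull).norm
  have hfpos : ∀ x ∈ boundedWedges e₀ M ∩ (interior U)ᶜ, 0 < f x := by
    intro x hx
    have hnn : ∀ h ∈ Finset.univ, 0 ≤ ((k₀ h : ℝ) + 1) ^ 2 - ‖tauInt γ (k₀ h) h x.full‖ :=
      fun h _ => sub_nonneg.2 (norm_tauInt_le γ (k₀ h) h _)
    refine lt_of_le_of_ne (Finset.sum_nonneg hnn) fun h0 => hx.2 (hU ?_)
    have hall := (Finset.sum_eq_zero_iff_of_nonneg hnn).1 h0.symm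
    have hs : ∀ h, ∃ s : ℤˣ, InCh h s x.full := fun h =>
      exists_inCh_of_le_norm_tauInt (hk₀ h).1 (sub_eq_zero.1 (hall h (Finset.mem_univ h))).le
    choose s hs using hs
    exact Set.mem_iUnion.2 ⟨s, hs⟩
  obtain ⟨ε, hε, hfε⟩ : ∃ ε > 0, ∀ x ∈ boundedWedges e₀ M ∩ (interior U)ᶜ, ε ≤ f x := by
    rcases (boundedWedges e₀ M ∩ (interior U)ᶜ).eq_empty_or_nonempty with he | hne
    · exact ⟨1, one_pos, by simp [he]⟩
    · obtain ⟨x, hx, hmin⟩ := hKc.exists_isMinOn hne hf.continuousOn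
      exact ⟨f x, hfpos x hx, fun y hy => hmin hy⟩
  have hcard : (0 : ℝ) < Fintype.card K.FInt := by exact_mod_cast Fintype.card_pos
  set ε' := ε / Fintype.card K.FInt with hε'
  have hε'0 : 0 < ε' := by positivity
  -- The deficit becomes a loss of rate: `1 - ε' / d² = 1 - δ₂ E ≤ exp (-δ₂ E)`.
  let δ₂ : K.FInt → ℝ := fun h => ε' / (((k₀ h : ℝ) + 1) ^ 2 * E (k₀ h))
  have hδ₂ : ∀ h, 0 < δ₂ h := fun h => by
    have : 0 < E (k₀ h) := hE.pos _ (hk₀ h).1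
    positivity
  obtain ⟨hm, -, hmin⟩ := Finset.exists_min_image Finset.univ δ₂ Finset.univ_nonempty
  have hle1 : min δ₁ (δ₂ hm) ≤ δ₁ := min_le_left _ _
  have hle2 : ∀ h, min δ₁ (δ₂ hm) ≤ δ₂ h := fun h =>
    (min_le_right _ _).trans (hmin h (Finset.mem_univ h))
  refine ⟨min δ₁ (δ₂ hm), lt_min hδ₁ (hδ₂ hm), fun h => by linarith [hgap h, hβs h], ?_⟩
  have hstar : ∀ h k, Real.exp (betaStar E (lam h) (k₀ h) * E k) ≤
      Real.exp ((beta E (lam h) (k₀ h) - min δ₁ (δ₂ hm)) * E k) := fun h k =>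
    Real.exp_le_exp.2 (mul_le_mul_of_nonneg_right (by linarith [hgap h]) (Nat.cast_nonneg _))
  intro x hx
  -- In `𝒰_int` the deficit lowers the rate at `k₀` for some face, and its other spins have rate at
  -- most `β*`. Outside `𝒰_int` some face has rate at most `β*` at all spins.
  by_cases hxU : x ∈ UInt e₀ γ E lam k₀
  · have hxK : x ∈ boundedWedges e₀ M ∩ (interior U)ᶜ := ⟨hM hxU, fun h => hx (interior_subset h)⟩
    obtain ⟨h, -, hh⟩ : ∃ h ∈ Finset.univ, ε' ≤
        ((k₀ h : ℝ) + 1) ^ 2 - ‖tauInt γ (k₀ h) h x.full‖ := by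
      refine Finset.exists_le_of_sum_le Finset.univ_nonempty ?_
      rw [Finset.sum_const, Finset.card_univ, nsmul_eq_mul, hε', mul_div_cancel₀ _ hcard.ne']
      exact hfε x hxK
    refine ⟨h, fun k hk => ?_⟩
    by_cases hkk : k = k₀ h
    · subst hkk
      have hE0 : (0 : ℝ) < E (k₀ h) := by exact_mod_cast hE.pos _ hk
      have hd : (0 : ℝ) < ((k₀ h : ℝ) + 1) ^ 2 := by positivity
      have h1 : 1 - δ₂ h * E (k₀ h) ≤ Real.exp (-(min δ₁ (δ₂ hm) * E (k₀ h))) := by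
        have h2 := Real.add_one_le_exp (-(min δ₁ (δ₂ hm) * E (k₀ h)))
        have h3 := mul_le_mul_of_nonneg_right (hle2 h) hE0.le
        linarith
      have h4 : δ₂ h * E (k₀ h) = ε' / ((k₀ h : ℝ) + 1) ^ 2 := by
        simp only [δ₂]
        field_simp
      have h5 : ‖tauInt γ (k₀ h) h x.full‖ ≤
          ((k₀ h : ℝ) + 1) ^ 2 * Real.exp (-(min δ₁ (δ₂ hm) * E (k₀ h))) := by
        refine le_trans ?_ (mul_le_mul_of_nonneg_left h1 hd.le)
        rw [h4, mul_sub, mul_one, mul_div_cancel₀ _ hd.ne']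
        linarith
      rw [sub_mul, sub_eq_add_neg, Real.exp_add, exp_beta_mul hE (hlam h) hk, norm_mul, mul_assoc]
      exact mul_le_mul_of_nonneg_left h5 (norm_nonneg _)
    · exact ((norm_mul_tauInt_le hE (hlam h) γ hk h _).trans (Real.exp_le_exp.2
        (mul_le_mul_of_nonneg_right ((hk₀ h).le_betaStar hk hkk) (Nat.cast_nonneg _)))).trans
          (hstar h k)
  · obtain ⟨h, hh⟩ := exists_norm_le_of_notMem_uInt hE hlam hk₀ γ hxU
    exact ⟨h, fun k hk => (hh k hk).trans (hstar h k)⟩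

theorem amplitude_sub_amplitudeOn {S : StackData K} {γ : ℝ} {μ : Measure SL2C}
    (hint : Integrable (integrand e₀ γ E S) (measureOmega e₀ μ)) {U : Set (IntConfig K e₀)}
    (hU : MeasurableSet U) :
    amplitude e₀ μ γ E S - amplitudeOn e₀ μ γ E S U = amplitudeOn e₀ μ γ E S Uᶜ := by
  rw [sub_eq_iff_eq_add']
  exact (integral_add_compl (measurable_toInt hU) hint).symm

/-- The lower bound on `g` is used with `δ` equal to half of the gap `κ - β'`; the other half
remains as the relative decay rate. -/
theorem eventually_norm_le_of_exp_le {κ β' B : ℝ} (hβ : β' < κ) {f g : ℝ → ℂ} {T : Set ℝ}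
    (hf : ∀ A : ℝ, 0 < A → ‖f A‖ ≤ B * Real.exp (β' * A))
    (hg : ∀ δ : ℝ, 0 < δ → ∀ᶠ A in atTop ⊓ 𝓟 T, Real.exp ((κ - δ) * A) ≤ ‖g A‖) (hB : 0 < B) :
    ∀ᶠ A in atTop ⊓ 𝓟 T, ‖f A‖ ≤ B * Real.exp (-((κ - β') / 2) * A) * ‖g A‖ ∧ g A ≠ 0 := by
  have h0 : ∀ᶠ A : ℝ in atTop ⊓ 𝓟 T, 0 < A :=
    (eventually_gt_atTop 0).filter_mono inf_le_left
  filter_upwards [hg ((κ - β') / 2) (by linarith), h0] with A h1 hA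
  constructor
  · calc ‖f A‖ ≤ B * Real.exp (β' * A) := hf A hA
      _ = B * Real.exp (-((κ - β') / 2) * A) * Real.exp ((κ - (κ - β') / 2) * A) := by
        rw [mul_assoc, ← Real.exp_add]
        congr 2
        ring
      _ ≤ _ := by gcongr
  · exact norm_pos_iff.1 ((Real.exp_pos _).trans_le h1)

end Localization

end SpinfoamStack

end

/-! ### The main theorem -/

theorem mainTheorem5
    -- a root 2-complex with at least one internal face
    (K : RootComplex) [Nonempty K.FInt]
    -- the gauge fixed edges: `e₀ v` is an edge at `v`, in `E_int` if `v` lies on an internal face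
    (e₀ : K.V → K.D) (he₀ : ∀ v, K.vert (e₀ v) = v)
    (he₀int : ∀ v, (∃ d, K.vert d = v ∧ K.IsInt d) → K.IsInt (e₀ v))
    -- every interior vertex graph is connected (or empty, if `v` lies on no internal face)
    (hconn : ∀ v, (K.interiorVertexGraph v).Preconnected)
    (γ : ℝ) (E : ℕ → ℕ) (hE : IsEnergy E)
    -- couplings of the internal faces with unique condensation spins
    (lam : K.FInt → ℂ) (hlam : ∀ h, lam h ≠ 0)
    (k₀ : K.FInt → ℕ) (hk₀ : ∀ h, IsCondensationSpin E (lam h) (k₀ h)) :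
    -- sequences going to infinity
    (∀ x : ℕ → IntConfig K e₀, Tendsto x atTop (cocompact (IntConfig K e₀)) →
      -- the maximum over all `(v, h)` of the norms of the wedge holonomies tends to infinity
      (∀ M : ℝ, ∀ᶠ n in atTop, ∃ h, ∃ c ∈ K.bdInt h,
        M ≤ hsNorm (wedge (x n).full c : Matrix (Fin 2) (Fin 2) ℂ)) ∧
      -- for every spin the minimum over all `h` of the face amplitudes tends to zero
      (∀ k, 1 ≤ k → ∀ ε : ℝ, 0 < ε → ∀ᶠ n in atTop, ∃ h, ‖tauInt γ k h (x n).full‖ < ε) ∧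
      -- along a subsequence both happen at one fixed face, and for all spins
      (∃ h, ∃ c ∈ K.bdInt h, ∃ φ : ℕ → ℕ, StrictMono φ ∧
        Tendsto (fun n => hsNorm (wedge (x (φ n)).full c : Matrix (Fin 2) (Fin 2) ℂ))
          atTop atTop ∧
        ∀ k, 1 ≤ k → Tendsto (fun n => tauInt γ k h (x (φ n)).full) atTop (𝓝 0))) ∧
    -- compactness
    (IsCompact (closure (UInt e₀ γ E lam k₀)) ∧
      (∀ S : K.FInt → ℤˣ, IsCompact (CIntSector e₀ S)) ∧
      IsCompact (CInt e₀)) ∧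
    -- localization of the stack amplitude for `A_h = A a_h`, `A → ∞`, at fixed boundary data
    ((∀ v, IsThreeConnected (K.vertexGraph v)) →
      ∀ (μ : Measure SL2C) [μ.IsHaarMeasure] (a : K.FInt → ℝ), (∀ h, 0 < a h) →
      ∀ (cutBd : K.FBd → ℝ) (lamBd : K.FBd → ℂ) (H : K.FBd → ℕ → SU2)
        (data : ℝ → StackData K),
        (∀ A, data A = ⟨fun h => A * a h, lam, cutBd, lamBd, H⟩) →
      ∀ κ : ℝ, κ = ∑ h, beta E (lam h) (k₀ h) * a h →
      -- absolute convergence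
      (∀ A : ℝ, Integrable (integrand e₀ γ E (data A)) (measureOmega e₀ μ)) ∧
      -- regions outside `𝒰_int`
      (∀ W : Set (IntConfig K e₀), MeasurableSet W → Disjoint W (UInt e₀ γ E lam k₀) →
        ∃ B β' : ℝ, 0 < B ∧ β' < κ ∧ ∀ A : ℝ, 0 < A →
          ‖amplitudeOn e₀ μ γ E (data A) W‖ ≤ B * Real.exp (β' * A)) ∧
      -- compact neighbourhoods `U` of `𝒞_int` in `𝒰_int`
      (∀ U : Set (IntConfig K e₀), IsCompact U → CInt e₀ ⊆ interior U →
        U ⊆ UInt e₀ γ E lam k₀ →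
        (∃ B β' : ℝ, 0 < B ∧ β' < κ ∧ ∀ A : ℝ, 0 < A →
          ‖amplitude e₀ μ γ E (data A) - amplitudeOn e₀ μ γ E (data A) U‖
            ≤ B * Real.exp (β' * A)) ∧
        -- relative form, along any set `T` of scales on which the amplitude on `U` has its
        -- exponential order `e^{κ A}`
        (∀ T : Set ℝ,
          (∀ δ : ℝ, 0 < δ → ∀ᶠ A in atTop ⊓ 𝓟 T,
            Real.exp ((κ - δ) * A) ≤ ‖amplitudeOn e₀ μ γ E (data A) U‖) →
          (∀ W : Set (IntConfig K e₀), MeasurableSet W → Disjoint W (UInt e₀ γ E lam k₀) →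
            ∃ B c : ℝ, 0 < c ∧ ∀ᶠ A in atTop ⊓ 𝓟 T,
              ‖amplitudeOn e₀ μ γ E (data A) W‖
                ≤ B * Real.exp (-c * A) * ‖amplitudeOn e₀ μ γ E (data A) U‖) ∧
          (∃ (ε : ℝ → ℂ) (B c : ℝ), 0 < c ∧ ∀ᶠ A in atTop ⊓ 𝓟 T,
            ‖ε A‖ ≤ B * Real.exp (-c * A) ∧
            amplitude e₀ μ γ E (data A)
              = amplitudeOn e₀ μ γ E (data A) U * (1 + ε A))))) := by
  refine ⟨fun x hx => ⟨fun M => ?_, fun k _ ε hε =>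
      eventually_exists_norm_tauInt_lt he₀ he₀int hconn hx γ k hε, ?_⟩,
    ⟨?_, isCompact_cIntSector he₀ he₀int hconn, isCompact_cInt he₀ he₀int hconn⟩, ?_⟩
  · filter_upwards [eventually_exists_lt_nrm_wedge he₀ he₀int hconn hx M] with n hn
    obtain ⟨h, c, hc, hlt⟩ := hn
    exact ⟨h, c, hc, hlt.le⟩
  · obtain ⟨h, c, hc, φ, hφ, h1, h2⟩ := exists_subseq_tendsto he₀ he₀int hconn hx γ
    exact ⟨h, c, hc, φ, hφ, h1, fun k _ => h2 k⟩
  · obtain ⟨M, hM⟩ := exists_uInt_subset_boundedWedges (e₀ := e₀) hE hlam hk₀ γ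
    exact (isCompact_boundedWedges he₀ he₀int hconn M).of_isClosed_subset isClosed_closure
      (closure_minimal hM (isClosed_boundedWedges M))
  intro h3 μ _ a ha cutBd lamBd H data hdata κ hκ
  have hint : ∀ A : ℝ, Integrable (integrand e₀ γ E (data A)) (measureOmega e₀ μ) := fun A => by
    rw [hdata A]
    exact integrable_integrand he₀ h3 μ hE hlam hk₀ γ a cutBd lamBd H A
  have hW : ∀ W : Set (IntConfig K e₀), MeasurableSet W → Disjoint W (UInt e₀ γ E lam k₀) →
      ∃ B β' : ℝ, 0 < B ∧ β' < κ ∧ ∀ A : ℝ, 0 < A →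
        ‖amplitudeOn e₀ μ γ E (data A) W‖ ≤ B * Real.exp (β' * A) := by
    intro W hWm hdisj
    obtain ⟨δ₀, hδ₀, hgap⟩ := exists_gap hE hlam hk₀
    obtain ⟨B, β', hB, hβ', hle⟩ := exists_norm_amplitudeOn_le he₀ h3 μ hE hlam hk₀ γ ha cutBd
      lamBd H hWm hδ₀
      (fun h => by linarith [hgap h, (hk₀ h).betaStar_pos hE (hlam h)])
      fun x hx => by
        obtain ⟨h, hh⟩ := exists_norm_le_of_notMem_uInt hE hlam hk₀ γ
          (Set.disjoint_left.1 hdisj hx)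
        exact ⟨h, fun k hk => (hh k hk).trans (Real.exp_le_exp.2
          (mul_le_mul_of_nonneg_right (hgap h) (Nat.cast_nonneg _)))⟩
    exact ⟨B, β', hB, hκ ▸ hβ', fun A hA => by rw [hdata A]; exact hle A hA⟩
  refine ⟨hint, hW, fun U hUc hCU hUsub => ?_⟩
  have hU : ∃ B β' : ℝ, 0 < B ∧ β' < κ ∧ ∀ A : ℝ, 0 < A →
      ‖amplitude e₀ μ γ E (data A) - amplitudeOn e₀ μ γ E (data A) U‖ ≤
        B * Real.exp (β' * A) := by
    obtain ⟨δ₀, hδ₀, hδβ, hbad⟩ :=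
      exists_norm_le_of_notMem_nhds he₀ he₀int hconn hE hlam hk₀ γ hCU
    have hUm : MeasurableSet U := hUc.isClosed.measurableSet
    obtain ⟨B, β', hB, hβ', hle⟩ := exists_norm_amplitudeOn_le he₀ h3 μ hE hlam hk₀ γ ha cutBd
      lamBd H hUm.compl hδ₀ hδβ hbad
    refine ⟨B, β', hB, hκ ▸ hβ', fun A hA => ?_⟩
    rw [amplitude_sub_amplitudeOn (hint A) hUm, hdata A]
    exact hle A hA
  refine ⟨hU, fun T hT => ⟨fun W hWm hdisj => ?_, ?_⟩⟩
  · obtain ⟨B, β', hB, hβ', hle⟩ := hW W hWm hdisj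
    exact ⟨B, (κ - β') / 2, by linarith,
      (eventually_norm_le_of_exp_le hβ' hle hT hB).mono fun A h => h.1⟩
  · obtain ⟨B, β', hB, hβ', hle⟩ := hU
    -- The relative remainder. The lower bound on the amplitude over `U` makes the denominator
    -- nonzero for all large `A ∈ T`.
    refine ⟨fun A => (amplitude e₀ μ γ E (data A) - amplitudeOn e₀ μ γ E (data A) U) /
      amplitudeOn e₀ μ γ E (data A) U, B, (κ - β') / 2, by linarith,
      (eventually_norm_le_of_exp_le hβ' hle hT hB).mono fun A h => ⟨?_, ?_⟩⟩
    · rw [norm_div]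
      exact div_le_of_le_mul₀ (norm_nonneg _) (by positivity) h.1
    · have := h.2
      rw [mul_add, mul_one, mul_div_cancel₀ _ this, add_sub_cancel]
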